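/- Let $\Bbbk$ be an algebraically closed field of characteristic $0$, let $n>2$ be odd, $m=n^2$, and let $\xi\in\Bbbk$ be a primitive $m^2$-th root of unity. Put $\mathbf q=\xi^m$ (a primitive $m$-th root of unity) and $q=\mathbf q^{\,n}$ (a primitive $n$-th root of unity). **The quasi-Hopf algebra $\widetilde U_q$.** As an algebra, $\widetilde U_q$ is generated by $E,F,K,K^{-1}$ subject to $$KK^{-1}=K^{-1}K=1,\quad KEK^{-1}=q^2E,\quad KFK^{-1}=q^{-2}F,\quad EF-FE=\frac{K-K^{-1}}{q-q^{-1}},\quad E^n=F^n=0,\quad K^{n^2}=1 .$$ Let $G=\langle K\rangle\cong\mathbb Z/m$; for $g=K^s$ with $0\le s<m$ let $\chi_g(K^r)=\mathbf q^{sr}$ and $1_g=\frac1m\sum_{h\in G}\chi_g(h)h$. The comultiplication, counit and associator are $$\Delta(E)=\sum_{f,g\in G}\Phi_1(f,g)\,E1_f\otimes 1_g+K\otimes E,\qquad \Delta(F)=\sum_{f,g\in G}\Phi_2(f,g)\chi_g(K)\,F1_f\otimes 1_g+1\otimes F,\qquad \Delta(K)=K\otimes K,$$ $$\varepsilon(E)=\varepsilon(F)=0,\quad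 \varepsilon(K)=1,\qquad \Phi=\sum_{f,g,h\in G}\phi(f,g,h)\,1_f\otimes1_g\otimes 1_h,$$ where, for $0\le s,t,r<m$, $$\Phi_1(K^s,K^r)=\xi^{\,nr(\overline{s-2n}-(s-2n))},\quad \Phi_2(K^s,K^r)=\xi^{\,nr(\overline{s+2n}-(s+2n))},\quad \phi(K^s,K^t,K^r)=\mathbf q^{\,nr\lfloor (s+t)/m\rfloor},$$ and $\overline a$ is the remainder of $a$ modulo $m$. The convention for the associator is $(\mathrm{id}\otimes\Delta)\Delta(h)\cdot\Phi=\Phi\cdot(\Delta\otimes\mathrm{id})\Delta(h)$. **The rings.** The Green ring $r(\widetilde U_q)$ is the abelian group generated by the isomorphism classes $[V]$ of finite dimensional $\widetilde U_q$-modules modulo the relations $[U\oplus V]=[U]+[V]$, with multiplication $[U][V]=[U\otimes V]$. The projective class ring $r_p(\widetilde U_q)$ is the subring of $r(\widetilde U_q)$ generated by the classes of the projective modules and of the simple modules (all finite dimensional). **The modules.** $V_2$ has basis $m_1,m_2$ with $Em_1=m_2$, $Em_2=0$, $Fm_1=0$, $Fm_2=m_1$, $Km_1=q^{-1}m_1$,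 $Km_2=qm_2$. For $1\le t\le n-1$ and an integer $r\ge 0$, $\mathbf V(t,r)$ has basis $v_1,\dots,v_n$ with $$Ev_i=v_{i+1}\ (i<n),\quad Ev_n=0,\quad Fv_1=0,\quad Fv_i=\gamma_{i-1}v_{i-1}\ (i\ge2),\quad Kv_i=\mathbf q^{\,t}q^{2(r+i-1)}v_i,$$ $$\gamma_j=\frac1{q-q^{-1}}\Big(\mathbf q^{-t}\,\frac{q^{-2r}-q^{-2(r+j)}}{1-q^{-2}}-\mathbf q^{\,t}\,\frac{q^{2r}-q^{2(r+j)}}{1-q^2}\Big).$$ **The polynomials.** Let $X'=\{y,x_t,\varepsilon_t\mid 1\le t\le n-1\}$. In $\mathbb Z[y]\subset\mathbb Z[X']$ put $$f_1=\sum_{i=0}^{\frac{n-1}2}(-1)^i\binom{n-1-i}{i}y^{n-1-2i},\qquad f_2=\sum_{i=0}^{\frac{n-1}2}(-1)^i\frac n{n-i}\binom{n-i}{i}y^{n-2i}-2,\qquad f_4=\sum_{i=1}^{\frac{n-1}2}(-1)^{i-1}\binom{n-i-1}{i-1}y^{n-2i},$$ $$g_1=\sum_{i=0}^{\lfloor\frac{n+1}4\rfloor}(-1)^i\frac{n+1}{n+1-2i}\binom{\frac{n+1}2-i}{i}y^{\frac{n+1}2-2i},\qquad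 g_2=\sum_{i=0}^{\lfloor\frac{n-1}4\rfloor}(-1)^i\frac{n-1}{n-1-2i}\binom{\frac{n-1}2-i}{i}y^{\frac{n-1}2-2i},$$ $$g_3=\sum_{2\le i\le\frac{n-1}2}(-1)^i\binom{n-2-i}{i-2}y^{n-2i}+y^2-1,$$ $$g_4=\sum_{k=1}^{\frac{n-1}2}\ \sum_{i=0}^{\lfloor\frac{n-1-2k}4\rfloor}(-1)^i\frac{k+2i}{k+i}\binom{k+i}{i}y^k+\sum_{1\le i\le\lfloor\frac{n-1}4\rfloor}(-1)^i\,2+1 .$$ Let $J$ be the ideal of $\mathbb Z[X']$ generated by the following elements, for all $1\le t,t',t_1,t_2,t_3\le n-1$ with $t+t_1\ne n$, $t+t_2<n$, $t+t_3>n$: $$f_1f_2,\quad (g_1-g_2)x_t,\quad g_4(x_t-\varepsilon_t),\quad x_tx_{t'}-x_t\varepsilon_{t'},\quad x_tx_{t_1}-\varepsilon_t\varepsilon_{t_1},\quad x_tx_{t_2}-g_4x_{t+t_2},\quad x_tx_{t_3}-g_4x_{t+t_3-n},$$ $$x_tx_{n-t}-(f_4+1)f_1,\quad \varepsilon_t\varepsilon_{n-t}-g_3f_1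 .$$ **Theorem.** There is a ring isomorphism $\mathbb Z[X']/J\to r_p(\widetilde U_q)$ that sends $y\mapsto[V_2]$, $x_t\mapsto[\mathbf V(t,0)]$ and $\varepsilon_t\mapsto[\mathbf V(t,1)]$ for $1\le t\le n-1$. Moreover, the family $$[V_2]^i\ (0\le i\le 2n-2),\qquad [V_2]^j[\mathbf V(t,0)]\ \big(0\le j\le\tfrac{n-1}2\big),\qquad [V_2]^l[\mathbf V(t,1)]\ \big(0\le l\le\tfrac{n-3}2\big),\qquad 1\le t\le n-1,$$ is a $\mathbb Z$-basis of $r_p(\widetilde U_q)$; in particular $r_p(\widetilde U_q)$ is a free abelian group of rank $n^2+n-1$. -/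

import Mathlib

open scoped TensorProduct

universe u

noncomputable section

/-! ### Quasi-bialgebras and their finite dimensional modules -/

/-- A quasi-bialgebra structure on a `k`-algebra `H`: comultiplication `Δ`, counit `ε`,
invertible associator `Φ ∈ H ⊗ H ⊗ H`, with
`(id ⊗ Δ)Δ(h) · Φ = Φ · (Δ ⊗ id)Δ(h)`, the counit laws, the pentagon equation
`(id ⊗ id ⊗ Δ)(Φ) · (Δ ⊗ id ⊗ id)(Φ) = (1 ⊗ Φ) · (id ⊗ Δ ⊗ id)(Φ) · (Φ ⊗ 1)` and
`(id ⊗ ε ⊗ id)(Φ) = 1 ⊗ 1`. Tensor powers are bracketed to the right. -/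
structure QuasiBialgebra (k H : Type u) [Field k] [Ring H] [Algebra k H] where
  comul : H →ₐ[k] H ⊗[k] H
  counit : H →ₐ[k] k
  assoc : (H ⊗[k] (H ⊗[k] H))ˣ
  counit_left : ∀ h, Algebra.TensorProduct.lid k H
    (Algebra.TensorProduct.map counit (AlgHom.id k H) (comul h)) = h
  counit_right : ∀ h, Algebra.TensorProduct.rid k k H
    (Algebra.TensorProduct.map (AlgHom.id k H) counit (comul h)) = h
  quasi_coassoc : ∀ h,
    Algebra.TensorProduct.map (AlgHom.id k H) comul (comul h) * (assoc : H ⊗[k] (H ⊗[k] H)) =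
      assoc * Algebra.TensorProduct.assoc k k k H H H
        (Algebra.TensorProduct.map comul (AlgHom.id k H) (comul h))
  pentagon :
    Algebra.TensorProduct.map (AlgHom.id k H)
        (Algebra.TensorProduct.map (AlgHom.id k H) comul) (assoc : H ⊗[k] (H ⊗[k] H)) *
      Algebra.TensorProduct.assoc k k k H H (H ⊗[k] H)
        (Algebra.TensorProduct.map comul (AlgHom.id k (H ⊗[k] H)) (assoc : H ⊗[k] (H ⊗[k] H))) =
    ((1 : H) ⊗ₜ[k] (assoc : H ⊗[k] (H ⊗[k] H))) *
      Algebra.TensorProduct.map (AlgHom.id k H)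
        ((Algebra.TensorProduct.assoc k k k H H H).toAlgHom.comp
          (Algebra.TensorProduct.map comul (AlgHom.id k H))) (assoc : H ⊗[k] (H ⊗[k] H)) *
      Algebra.TensorProduct.map (AlgHom.id k H)
        (Algebra.TensorProduct.assoc k k k H H H).toAlgHom
        (Algebra.TensorProduct.assoc k k k H (H ⊗[k] H) H
          ((assoc : H ⊗[k] (H ⊗[k] H)) ⊗ₜ[k] (1 : H)))
  assoc_counit :
    Algebra.TensorProduct.map (AlgHom.id k H)
      ((Algebra.TensorProduct.lid k H).toAlgHom.comp
        (Algebra.TensorProduct.map counit (AlgHom.id k H))) (assoc : H ⊗[k] (H ⊗[k] H)) = 1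

/-- A finite dimensional left module over the `k`-algebra `H`: a finite dimensional vector space
with the algebra homomorphism `H → End(V)` that gives the action. -/
structure FDMod (k H : Type u) [Field k] [Ring H] [Algebra k H] where
  carrier : Type u
  [addCommGroup : AddCommGroup carrier]
  [module : Module k carrier]
  [finite : FiniteDimensional k carrier]
  act : H →ₐ[k] Module.End k carrier

attribute [instance] FDMod.addCommGroup FDMod.module FDMod.finite

namespace FDMod

variable {k H : Type u} [Field k] [Ring H] [Algebra k H]

/-- The `H`-module structure on the underlying space. -/
abbrev toModule (M : FDMod k H) : Module H M.carrier :=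
  Module.compHom M.carrier M.act.toRingHom

/-- Simple `H`-modules. -/
def IsSimple (M : FDMod k H) : Prop :=
  @IsSimpleModule H _ M.carrier _ M.toModule

/-- Projective `H`-modules. -/
def IsProjective (M : FDMod k H) : Prop :=
  @Module.Projective H _ M.carrier _ M.toModule

/-- Isomorphism of `H`-modules: a linear bijection that commutes with the action. -/
def Iso (M N : FDMod k H) : Prop :=
  ∃ f : M.carrier ≃ₗ[k] N.carrier, ∀ h v, f (M.act h v) = N.act h (f v)

theorem Iso.refl (M : FDMod k H) : Iso M M := ⟨LinearEquiv.refl k _, fun _ _ => rfl⟩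

theorem Iso.symm {M N : FDMod k H} : Iso M N → Iso N M := by
  rintro ⟨f, hf⟩
  exact ⟨f.symm, fun h v => f.injective (by simp [hf])⟩

theorem Iso.trans {M N P : FDMod k H} : Iso M N → Iso N P → Iso M P := by
  rintro ⟨f, hf⟩ ⟨g, hg⟩
  exact ⟨f.trans g, fun h v => by simp [hf, hg]⟩

/-- The componentwise action on a direct sum. -/
def actProd {V W : Type u} [AddCommGroup V] [Module k V] [AddCommGroup W] [Module k W]
    (f : H →ₐ[k] Module.End k V) (g : H →ₐ[k] Module.End k W) : H →ₐ[k] Module.End k (V × W) :=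
  AlgHom.ofLinearMap
    { toFun := fun h => (f h).prodMap (g h)
      map_add' := fun a b => by ext <;> simp
      map_smul' := fun c a => by ext <;> simp }
    (by ext <;> simp) (fun a b => by ext <;> simp)

/-- The direct sum of two modules. -/
def sum (M N : FDMod k H) : FDMod k H where
  carrier := M.carrier × N.carrier
  act := actProd M.act N.act

/-- `A ⊗ B` acts on `V ⊗ W`, factor by factor. -/
def outer {A B V W : Type u} [Ring A] [Algebra k A] [Ring B] [Algebra k B]
    [AddCommGroup V] [Module k V] [AddCommGroup W] [Module k W]
    (f : A →ₐ[k] Module.End k V) (g : B →ₐ[k] Module.End k W) :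
    A ⊗[k] B →ₐ[k] Module.End k (V ⊗[k] W) :=
  (Module.endTensorEndAlgHom (R := k) (S := k) (A := k)).comp (Algebra.TensorProduct.map f g)

/-- The tensor product of two modules over a quasi-bialgebra, with action through `Δ`. -/
def tensor (B : QuasiBialgebra k H) (M N : FDMod k H) : FDMod k H where
  carrier := M.carrier ⊗[k] N.carrier
  act := (outer M.act N.act).comp B.comul

/-- The trivial module `k`, with action through `ε`. -/
def unit (B : QuasiBialgebra k H) : FDMod k H where
  carrier := k
  act := (Algebra.lmul k k).comp B.counit

section outer

variable {A B C V W X V' W' : Type u} [Ring A] [Algebra k A] [Ring B] [Algebra k B]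
  [Ring C] [Algebra k C]
  [AddCommGroup V] [Module k V] [AddCommGroup W] [Module k W] [AddCommGroup X] [Module k X]
  [AddCommGroup V'] [Module k V'] [AddCommGroup W'] [Module k W']

theorem outer_tmul (f : A →ₐ[k] Module.End k V) (g : B →ₐ[k] Module.End k W) (a : A) (b : B)
    (v : V) (w : W) : outer f g (a ⊗ₜ b) (v ⊗ₜ w) = f a v ⊗ₜ g b w := rfl

theorem outer_ext {L : Type u} [AddCommGroup L] [Module k L]
    (p q : A ⊗[k] B →ₗ[k] V ⊗[k] W →ₗ[k] L)
    (h : ∀ a b v w, p (a ⊗ₜ b) (v ⊗ₜ w) = q (a ⊗ₜ b) (v ⊗ₜ w)) (z : A ⊗[k] B) (x : V ⊗[k] W) :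
    p z x = q z x := by
  have : p = q := by
    apply TensorProduct.ext'
    intro a b
    apply TensorProduct.ext'
    intro v w
    exact h a b v w
  rw [this]

theorem outer_map (f : A →ₐ[k] Module.End k V) (g : B →ₐ[k] Module.End k W)
    (f' : A →ₐ[k] Module.End k V') (g' : B →ₐ[k] Module.End k W')
    (φ : V →ₗ[k] V') (ψ : W →ₗ[k] W') (hφ : ∀ a v, φ (f a v) = f' a (φ v))
    (hψ : ∀ b w, ψ (g b w) = g' b (ψ w)) (z : A ⊗[k] B) (x : V ⊗[k] W) :
    TensorProduct.map φ ψ (outer f g z x) = outer f' g' z (TensorProduct.map φ ψ x) := by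
  refine outer_ext ((LinearMap.compRight k (TensorProduct.map φ ψ)).comp (outer f g).toLinearMap)
    (((LinearMap.lcomp k _ (TensorProduct.map φ ψ))).comp (outer f' g').toLinearMap) ?_ z x
  intro a b v w
  simp [outer_tmul, hφ, hψ]

theorem outer_lid (ε : A →ₐ[k] k) (f : B →ₐ[k] Module.End k V) (z : A ⊗[k] B) (x : k ⊗[k] V) :
    TensorProduct.lid k V (outer ((Algebra.lmul k k).comp ε) f z x) =
      f (Algebra.TensorProduct.lid k B (Algebra.TensorProduct.map ε (AlgHom.id k B) z))
        (TensorProduct.lid k V x) := by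
  refine outer_ext ((LinearMap.compRight k (TensorProduct.lid k V).toLinearMap).comp
      (outer ((Algebra.lmul k k).comp ε) f).toLinearMap)
    (((LinearMap.lcomp k _ (TensorProduct.lid k V).toLinearMap)).comp
      (f.comp ((Algebra.TensorProduct.lid k B).toAlgHom.comp
        (Algebra.TensorProduct.map ε (AlgHom.id k B)))).toLinearMap) ?_ z x
  intro a b v w
  simp [outer_tmul, mul_smul]

theorem outer_rid (ε : B →ₐ[k] k) (f : A →ₐ[k] Module.End k V) (z : A ⊗[k] B) (x : V ⊗[k] k) :
    TensorProduct.rid k V (outer f ((Algebra.lmul k k).comp ε) z x) =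
      f (Algebra.TensorProduct.rid k k A (Algebra.TensorProduct.map (AlgHom.id k A) ε z))
        (TensorProduct.rid k V x) := by
  refine outer_ext ((LinearMap.compRight k (TensorProduct.rid k V).toLinearMap).comp
      (outer f ((Algebra.lmul k k).comp ε)).toLinearMap)
    (((LinearMap.lcomp k _ (TensorProduct.rid k V).toLinearMap)).comp
      (f.comp ((Algebra.TensorProduct.rid k k A).toAlgHom.comp
        (Algebra.TensorProduct.map (AlgHom.id k A) ε))).toLinearMap) ?_ z x
  intro a b v w
  simp [outer_tmul, smul_smul, mul_comm]

theorem outer_assoc (f : A →ₐ[k] Module.End k V) (g : B →ₐ[k] Module.End k W)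
    (p : C →ₐ[k] Module.End k X) (z : (A ⊗[k] B) ⊗[k] C) (x : (V ⊗[k] W) ⊗[k] X) :
    TensorProduct.assoc k V W X (outer (outer f g) p z x) =
      outer f (outer g p) (Algebra.TensorProduct.assoc k k k A B C z)
        (TensorProduct.assoc k V W X x) := by
  have : (LinearMap.compRight k (TensorProduct.assoc k V W X).toLinearMap).comp
      (outer (outer f g) p).toLinearMap =
    ((LinearMap.lcomp k _ (TensorProduct.assoc k V W X).toLinearMap)).comp
      ((outer f (outer g p)).comp
        (Algebra.TensorProduct.assoc k k k A B C).toAlgHom).toLinearMap := by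
    apply TensorProduct.ext_threefold
    intro a b c
    apply TensorProduct.ext_threefold
    intro v w x
    rfl
  exact congrArg (fun l => l z x) this

theorem outer_comp_left (Δ : C →ₐ[k] A) (f : A →ₐ[k] Module.End k V)
    (g : B →ₐ[k] Module.End k W) (z : C ⊗[k] B) :
    outer (f.comp Δ) g z = outer f g (Algebra.TensorProduct.map Δ (AlgHom.id k B) z) := by
  have : outer (f.comp Δ) g = (outer f g).comp (Algebra.TensorProduct.map Δ (AlgHom.id k B)) := by
    ext <;> rfl
  exact congrArg (fun l => l z) this

theorem outer_comp_right (Δ : C →ₐ[k] B) (f : A →ₐ[k] Module.End k V)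
    (g : B →ₐ[k] Module.End k W) (z : A ⊗[k] C) :
    outer f (g.comp Δ) z = outer f g (Algebra.TensorProduct.map (AlgHom.id k A) Δ z) := by
  have : outer f (g.comp Δ) = (outer f g).comp (Algebra.TensorProduct.map (AlgHom.id k A) Δ) := by
    ext <;> rfl
  exact congrArg (fun l => l z) this

theorem outer_prodLeft (f : H →ₐ[k] Module.End k V) (g : H →ₐ[k] Module.End k W)
    (p : B →ₐ[k] Module.End k X) (z : H ⊗[k] B) (x : (V × W) ⊗[k] X) :
    TensorProduct.prodLeft k k V W X (outer (actProd f g) p z x) =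
      ((outer f p z).prodMap (outer g p z)) (TensorProduct.prodLeft k k V W X x) := by
  refine outer_ext ((LinearMap.compRight k (TensorProduct.prodLeft k k V W X).toLinearMap).comp
      (outer (actProd f g) p).toLinearMap)
    (((LinearMap.lcomp k _ (TensorProduct.prodLeft k k V W X).toLinearMap)).comp
      (actProd (outer f p) (outer g p)).toLinearMap) ?_ z x
  rintro a b ⟨v₁, v₂⟩ w
  rfl

theorem outer_prodRight (f : H →ₐ[k] Module.End k V) (g : H →ₐ[k] Module.End k W)
    (p : B →ₐ[k] Module.End k X) (z : B ⊗[k] H) (x : X ⊗[k] (V × W)) :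
    TensorProduct.prodRight k k X V W (outer p (actProd f g) z x) =
      ((outer p f z).prodMap (outer p g z)) (TensorProduct.prodRight k k X V W x) := by
  refine outer_ext ((LinearMap.compRight k (TensorProduct.prodRight k k X V W).toLinearMap).comp
      (outer p (actProd f g)).toLinearMap)
    (((LinearMap.lcomp k _ (TensorProduct.prodRight k k X V W).toLinearMap)).comp
      (actProd (outer p f) (outer p g)).toLinearMap) ?_ z x
  rintro a b w ⟨v₁, v₂⟩
  rfl

end outer

theorem Iso.tensor (B : QuasiBialgebra k H) {M M' N N' : FDMod k H} (h₁ : Iso M M')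
    (h₂ : Iso N N') : Iso (tensor B M N) (tensor B M' N') := by
  obtain ⟨f, hf⟩ := h₁
  obtain ⟨g, hg⟩ := h₂
  exact ⟨TensorProduct.congr f g, fun h v =>
    outer_map M.act N.act M'.act N'.act f.toLinearMap g.toLinearMap hf hg (B.comul h) v⟩

theorem iso_unit_tensor (B : QuasiBialgebra k H) (M : FDMod k H) :
    Iso (FDMod.tensor B (unit B) M) M := by
  refine ⟨TensorProduct.lid k M.carrier, fun h v => ?_⟩
  have := outer_lid B.counit M.act (B.comul h) v
  rw [B.counit_left] at this
  exact this

theorem iso_tensor_unit (B : QuasiBialgebra k H) (M : FDMod k H) :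
    Iso (FDMod.tensor B M (unit B)) M := by
  refine ⟨TensorProduct.rid k M.carrier, fun h v => ?_⟩
  have := outer_rid B.counit M.act (B.comul h) v
  rw [B.counit_right] at this
  exact this

theorem iso_assoc (B : QuasiBialgebra k H) (M N P : FDMod k H) :
    Iso (FDMod.tensor B (FDMod.tensor B M N) P) (FDMod.tensor B M (FDMod.tensor B N P)) := by
  let π : H ⊗[k] (H ⊗[k] H) →ₐ[k] Module.End k (M.carrier ⊗[k] (N.carrier ⊗[k] P.carrier)) :=
    outer M.act (outer N.act P.act)
  let e : (M.carrier ⊗[k] (N.carrier ⊗[k] P.carrier)) ≃ₗ[k]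
      (M.carrier ⊗[k] (N.carrier ⊗[k] P.carrier)) :=
    LinearMap.GeneralLinearGroup.generalLinearEquiv k _ (Units.map (π : _ →* _) B.assoc)
  have key : ∀ (h : H) (v : (M.carrier ⊗[k] N.carrier) ⊗[k] P.carrier),
      π B.assoc (TensorProduct.assoc k M.carrier N.carrier P.carrier
        (outer ((outer M.act N.act).comp B.comul) P.act (B.comul h) v)) =
      outer M.act ((outer N.act P.act).comp B.comul) (B.comul h)
        (π B.assoc (TensorProduct.assoc k M.carrier N.carrier P.carrier v)) := by
    intro h v
    rw [outer_comp_left, outer_comp_right, outer_assoc]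
    change (π _ * π _) _ = (π _ * π _) _
    rw [← map_mul, ← map_mul, B.quasi_coassoc]
  exact ⟨(TensorProduct.assoc k M.carrier N.carrier P.carrier).trans e, key⟩

theorem iso_sum_tensor (B : QuasiBialgebra k H) (M N P : FDMod k H) :
    Iso (FDMod.tensor B (sum M N) P) (sum (FDMod.tensor B M P) (FDMod.tensor B N P)) :=
  ⟨TensorProduct.prodLeft k k M.carrier N.carrier P.carrier,
    fun h v => outer_prodLeft M.act N.act P.act (B.comul h) v⟩

theorem iso_tensor_sum (B : QuasiBialgebra k H) (M N P : FDMod k H) :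
    Iso (FDMod.tensor B P (sum M N)) (sum (FDMod.tensor B P M) (FDMod.tensor B P N)) :=
  ⟨TensorProduct.prodRight k k P.carrier M.carrier N.carrier,
    fun h v => outer_prodRight M.act N.act P.act (B.comul h) v⟩

end FDMod

namespace QuasiBialgebra

variable {k H : Type u} [Field k] [Ring H] [Algebra k H]

/-- The isomorphism relation on finite dimensional modules. -/
def isoSetoid (_B : QuasiBialgebra k H) : Setoid (FDMod k H) where
  r := FDMod.Iso
  iseqv := ⟨FDMod.Iso.refl, FDMod.Iso.symm, FDMod.Iso.trans⟩

/-- Isomorphism classes of finite dimensional modules. -/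
def IsoClass (B : QuasiBialgebra k H) : Type (u + 1) := Quotient B.isoSetoid

/-- The isomorphism class of a module. -/
def isoClass (B : QuasiBialgebra k H) (M : FDMod k H) : B.IsoClass := Quotient.mk _ M

theorem isoClass_surjective (B : QuasiBialgebra k H) : Function.Surjective B.isoClass :=
  Quotient.mk_surjective

/-- Isomorphism classes form a monoid under the tensor product. -/
instance (B : QuasiBialgebra k H) : Monoid B.IsoClass where
  mul := Quotient.map₂ (FDMod.tensor B) (fun _ _ h₁ _ _ h₂ => FDMod.Iso.tensor B h₁ h₂)
  one := B.isoClass (FDMod.unit B)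
  mul_assoc a b c := by
    induction a using Quotient.inductionOn
    induction b using Quotient.inductionOn
    induction c using Quotient.inductionOn
    exact Quotient.sound (FDMod.iso_assoc B _ _ _)
  one_mul a := by
    induction a using Quotient.inductionOn
    exact Quotient.sound (FDMod.iso_unit_tensor B _)
  mul_one a := by
    induction a using Quotient.inductionOn
    exact Quotient.sound (FDMod.iso_tensor_unit B _)

theorem isoClass_mul (B : QuasiBialgebra k H) (M N : FDMod k H) :
    B.isoClass M * B.isoClass N = B.isoClass (FDMod.tensor B M N) := rfl

/-- The elements `[U ⊕ V] - [U] - [V]` of the free abelian group on isomorphism classes. -/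
def greenRel (B : QuasiBialgebra k H) : Set (FreeAbelianGroup B.IsoClass) :=
  {x | ∃ U V : FDMod k H, x = FreeAbelianGroup.of (B.isoClass (FDMod.sum U V)) -
    FreeAbelianGroup.of (B.isoClass U) - FreeAbelianGroup.of (B.isoClass V)}

theorem greenRel_mul_left (B : QuasiBialgebra k H) (a x : FreeAbelianGroup B.IsoClass)
    (hx : x ∈ AddSubgroup.closure B.greenRel) : a * x ∈ AddSubgroup.closure B.greenRel := by
  induction hx using AddSubgroup.closure_induction with
  | zero => simp
  | add x y _ _ hx hy => rw [mul_add]; exact add_mem hx hy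
  | neg x _ hx => rw [mul_neg]; exact neg_mem hx
  | mem x hx =>
    obtain ⟨U, V, rfl⟩ := hx
    induction a using FreeAbelianGroup.induction_on with
    | zero => simp
    | neg a ha => rw [neg_mul]; exact neg_mem ha
    | add a b ha hb => rw [add_mul]; exact add_mem ha hb
    | of a =>
      obtain ⟨P, rfl⟩ := B.isoClass_surjective a
      refine AddSubgroup.subset_closure ⟨FDMod.tensor B P U, FDMod.tensor B P V, ?_⟩
      have h : B.isoClass (FDMod.tensor B P (FDMod.sum U V)) =
          B.isoClass (FDMod.sum (FDMod.tensor B P U) (FDMod.tensor B P V)) :=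
        Quotient.sound (FDMod.iso_tensor_sum B U V P)
      rw [← h, mul_sub, mul_sub, ← FreeAbelianGroup.of_mul, ← FreeAbelianGroup.of_mul,
        ← FreeAbelianGroup.of_mul, isoClass_mul, isoClass_mul, isoClass_mul]

theorem greenRel_mul_right (B : QuasiBialgebra k H) (a x : FreeAbelianGroup B.IsoClass)
    (hx : x ∈ AddSubgroup.closure B.greenRel) : x * a ∈ AddSubgroup.closure B.greenRel := by
  induction hx using AddSubgroup.closure_induction with
  | zero => simp
  | add x y _ _ hx hy => rw [add_mul]; exact add_mem hx hy
  | neg x _ hx => rw [neg_mul]; exact neg_mem hx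
  | mem x hx =>
    obtain ⟨U, V, rfl⟩ := hx
    induction a using FreeAbelianGroup.induction_on with
    | zero => simp
    | neg a ha => rw [mul_neg]; exact neg_mem ha
    | add a b ha hb => rw [mul_add]; exact add_mem ha hb
    | of a =>
      obtain ⟨P, rfl⟩ := B.isoClass_surjective a
      refine AddSubgroup.subset_closure ⟨FDMod.tensor B U P, FDMod.tensor B V P, ?_⟩
      have h : B.isoClass (FDMod.tensor B (FDMod.sum U V) P) =
          B.isoClass (FDMod.sum (FDMod.tensor B U P) (FDMod.tensor B V P)) :=
        Quotient.sound (FDMod.iso_sum_tensor B U V P)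
      rw [← h, sub_mul, sub_mul, ← FreeAbelianGroup.of_mul, ← FreeAbelianGroup.of_mul,
        ← FreeAbelianGroup.of_mul, isoClass_mul, isoClass_mul, isoClass_mul]

/-- The subgroup generated by the relations `[U ⊕ V] = [U] + [V]`; it is a two-sided ideal. -/
def greenIdeal (B : QuasiBialgebra k H) : Ideal (FreeAbelianGroup B.IsoClass) :=
  { AddSubgroup.closure B.greenRel with
    smul_mem' := fun a x hx => B.greenRel_mul_left a x hx }

instance (B : QuasiBialgebra k H) : B.greenIdeal.IsTwoSided :=
  ⟨fun {_} b h => B.greenRel_mul_right b _ h⟩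

/-- The Green ring `r(H)`: the abelian group generated by the isomorphism classes `[V]` modulo
`[U ⊕ V] = [U] + [V]`, with `[U][V] = [U ⊗ V]`. -/
abbrev GreenRing (B : QuasiBialgebra k H) : Type (u + 1) :=
  FreeAbelianGroup B.IsoClass ⧸ B.greenIdeal

/-- The class `[V]` in the Green ring. -/
def cls (B : QuasiBialgebra k H) (M : FDMod k H) : B.GreenRing :=
  Ideal.Quotient.mk B.greenIdeal (FreeAbelianGroup.of (B.isoClass M))

/-- The projective class ring `r_p(H)`: the subring of `r(H)` generated by the classes of the
projective modules and of the simple modules. -/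
def projClassRing (B : QuasiBialgebra k H) : Subring B.GreenRing :=
  Subring.closure {x | ∃ M : FDMod k H, (M.IsProjective ∨ M.IsSimple) ∧ x = B.cls M}

end QuasiBialgebra


/-! ### The algebra underlying the small quasi-quantum group -/

/-- Standing data: an odd integer `n > 2` and a primitive root of unity `ξ` of order `𝐦 = m²`,
where `m = n²`. -/
structure QData (k : Type u) [Field k] where
  n : ℕ
  two_lt : 2 < n
  odd : Odd n
  ξ : k
  prim : IsPrimitiveRoot ξ ((n ^ 2) ^ 2)

/-- The generators `E`, `F`, `K`, `K⁻¹`. -/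
inductive UGen
  | E | F | K | Kinv

/-- The defining relations of `U_q(𝔰𝔩₂) / (E^n, F^n, K^(n²) - 1)`, for a choice of four elements
of an algebra. -/
structure URel {k B : Type u} [Field k] [Ring B] [Algebra k B] (n : ℕ) (q : k)
    (g : UGen → B) : Prop where
  K_Kinv : g .K * g .Kinv = 1
  Kinv_K : g .Kinv * g .K = 1
  KE : g .K * g .E * g .Kinv = q ^ 2 • g .E
  KF : g .K * g .F * g .Kinv = (q ^ 2)⁻¹ • g .F
  EF : g .E * g .F - g .F * g .E = (q - q⁻¹)⁻¹ • (g .K - g .Kinv)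
  E_pow : g .E ^ n = 0
  F_pow : g .F ^ n = 0
  K_pow : g .K ^ (n ^ 2) = 1

namespace QData

variable {k : Type u} [Field k] (D : QData k)

/-- `m = n²`, the order of the cyclic group `G = ⟨K⟩`. -/
abbrev m : ℕ := D.n ^ 2

instance : NeZero D.n := ⟨by have := D.two_lt; omega⟩

/-- `𝐪 = ξ_m = ξ^m`, a primitive `m`-th root of unity. -/
def bq : k := D.ξ ^ D.m

/-- `q = 𝐪^n`, a primitive `n`-th root of unity. -/
def q : k := D.bq ^ D.n

/-- The defining relations, as a relation on the free algebra on `E`, `F`, `K`, `K⁻¹`. -/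
inductive Rel : FreeAlgebra k UGen → FreeAlgebra k UGen → Prop
  | K_Kinv : Rel (FreeAlgebra.ι k .K * FreeAlgebra.ι k .Kinv) 1
  | Kinv_K : Rel (FreeAlgebra.ι k .Kinv * FreeAlgebra.ι k .K) 1
  | KE : Rel (FreeAlgebra.ι k .K * FreeAlgebra.ι k .E * FreeAlgebra.ι k .Kinv)
      (D.q ^ 2 • FreeAlgebra.ι k .E)
  | KF : Rel (FreeAlgebra.ι k .K * FreeAlgebra.ι k .F * FreeAlgebra.ι k .Kinv)
      ((D.q ^ 2)⁻¹ • FreeAlgebra.ι k .F)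
  | EF : Rel (FreeAlgebra.ι k .E * FreeAlgebra.ι k .F - FreeAlgebra.ι k .F * FreeAlgebra.ι k .E)
      ((D.q - D.q⁻¹)⁻¹ • (FreeAlgebra.ι k .K - FreeAlgebra.ι k .Kinv))
  | E_pow : Rel (FreeAlgebra.ι k .E ^ D.n) 0
  | F_pow : Rel (FreeAlgebra.ι k .F ^ D.n) 0
  | K_pow : Rel (FreeAlgebra.ι k .K ^ (D.n ^ 2)) 1

/-- The algebra `Ũ_q = U_q(𝔰𝔩₂) / (E^n, F^n, K^(n²) - 1)`. -/
def U : Type u := RingQuot D.Rel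

instance : Ring D.U := inferInstanceAs (Ring (RingQuot D.Rel))

instance : Algebra k D.U := inferInstanceAs (Algebra k (RingQuot D.Rel))

/-- The quotient map from the free algebra. -/
def proj : FreeAlgebra k UGen →ₐ[k] D.U := RingQuot.mkAlgHom k D.Rel

theorem proj_surjective : Function.Surjective D.proj := RingQuot.mkAlgHom_surjective k D.Rel

/-- The generators as elements of the algebra. -/
def gen (x : UGen) : D.U := D.proj (FreeAlgebra.ι k x)

theorem gen_rel : URel D.n D.q D.gen := by
  have h : ∀ {x y}, D.Rel x y → D.proj x = D.proj y :=
    fun h => RingQuot.mkAlgHom_rel k h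
  constructor
  · simpa [gen] using h Rel.K_Kinv
  · simpa [gen] using h Rel.Kinv_K
  · simpa [gen] using h Rel.KE
  · simpa [gen] using h Rel.KF
  · simpa [gen] using h Rel.EF
  · simpa [gen] using h Rel.E_pow
  · simpa [gen] using h Rel.F_pow
  · simpa [gen] using h Rel.K_pow

theorem lift_rel {B : Type u} [Ring B] [Algebra k B] (g : UGen → B) (hg : URel D.n D.q g)
    ⦃x y : FreeAlgebra k UGen⦄ (h : D.Rel x y) :
    FreeAlgebra.lift k g x = FreeAlgebra.lift k g y := by
  cases h
  · simpa using hg.K_Kinv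
  · simpa using hg.Kinv_K
  · simpa using hg.KE
  · simpa using hg.KF
  · simpa using hg.EF
  · simpa using hg.E_pow
  · simpa using hg.F_pow
  · simpa using hg.K_pow

/-- The universal property of the presentation. -/
def lift {B : Type u} [Ring B] [Algebra k B] (g : UGen → B) (hg : URel D.n D.q g) :
    D.U →ₐ[k] B :=
  RingQuot.liftAlgHom k ⟨FreeAlgebra.lift k g, D.lift_rel g hg⟩

theorem lift_gen {B : Type u} [Ring B] [Algebra k B] (g : UGen → B) (hg : URel D.n D.q g)
    (x : UGen) : D.lift g hg (D.gen x) = g x :=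
  (RingQuot.liftAlgHom_mkAlgHom_apply k (FreeAlgebra.lift k g) (D.lift_rel g hg)
    (FreeAlgebra.ι k x)).trans (FreeAlgebra.lift_ι_apply g x)

/-- An induction principle: the generators generate. -/
theorem U_induction {p : D.U → Prop} (halg : ∀ c : k, p (algebraMap k D.U c))
    (hgen : ∀ x, p (D.gen x)) (hadd : ∀ a b, p a → p b → p (a + b))
    (hmul : ∀ a b, p a → p b → p (a * b)) (a : D.U) : p a := by
  obtain ⟨z, rfl⟩ := D.proj_surjective a
  induction z using FreeAlgebra.induction with
  | grade0 c => simpa using halg c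
  | grade1 x => exact hgen x
  | mul a b ha hb => rw [map_mul]; exact hmul _ _ ha hb
  | add a b ha hb => rw [map_add]; exact hadd _ _ ha hb

/-- The element `E`. -/
abbrev E : D.U := D.gen .E
/-- The element `F`. -/
abbrev F : D.U := D.gen .F
/-- The element `K`. -/
abbrev K : D.U := D.gen .K
/-- The element `K⁻¹`. -/
abbrev Kinv : D.U := D.gen .Kinv

/-! ### The quasi-bialgebra structure

The element `K^s` of `G`, `0 ≤ s < m`, is indexed by the class of `s` in `ℤ/m`. -/

/-- The idempotent `1_g = |G|⁻¹ ∑_h χ_g(h) h` of `kG`, for `g = K^s`, where `χ_g(K^r) = ξ_m^(sr)`. -/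
def idem (s : ZMod D.m) : D.U :=
  ((D.m : k)⁻¹) • ∑ r ∈ Finset.range D.m, D.bq ^ (s.val * r) • D.K ^ r

/-- `φ₁₁(K^s)`: the remainder of `s - 2n` modulo `m`, minus `s - 2n`. -/
def φ₁₁ (s : ZMod D.m) : ℤ := ((s.val : ℤ) - 2 * D.n) % D.m - ((s.val : ℤ) - 2 * D.n)

/-- `φ₂₁(K^s)`: the remainder of `s + 2n` modulo `m`, minus `s + 2n`. -/
def φ₂₁ (s : ZMod D.m) : ℤ := ((s.val : ℤ) + 2 * D.n) % D.m - ((s.val : ℤ) + 2 * D.n)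

/-- `Φ₁(K^s, K^r) = ξ^(n r φ₁₁(K^s))`. -/
def Φ₁ (s r : ZMod D.m) : k := D.ξ ^ ((D.n : ℤ) * r.val * D.φ₁₁ s)

/-- `Φ₂(K^s, K^r) = ξ^(n r φ₂₁(K^s))`. -/
def Φ₂ (s r : ZMod D.m) : k := D.ξ ^ ((D.n : ℤ) * r.val * D.φ₂₁ s)

/-- The `3`-cocycle `φ(K^s, K^t, K^r) = ξ_m^(n r [(s + t) / m])`. -/
def cocycle (s t r : ZMod D.m) : k := D.bq ^ (D.n * r.val * ((s.val + t.val) / D.m))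

/-- The values of the comultiplication on the generators:
`Δ(E) = ∑ Φ₁(f,g) E 1_f ⊗ 1_g + K ⊗ E`, `Δ(F) = ∑ Φ₂(f,g) χ_g(K) F 1_f ⊗ 1_g + 1 ⊗ F`,
and `K` is group-like. -/
def comulGen : UGen → D.U ⊗[k] D.U
  | .E => ∑ f : ZMod D.m, ∑ g : ZMod D.m, D.Φ₁ f g • ((D.E * D.idem f) ⊗ₜ[k] D.idem g)
      + D.K ⊗ₜ[k] D.E
  | .F => ∑ f : ZMod D.m, ∑ g : ZMod D.m,
      (D.Φ₂ f g * D.bq ^ g.val) • ((D.F * D.idem f) ⊗ₜ[k] D.idem g) + 1 ⊗ₜ[k] D.F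
  | .K => D.K ⊗ₜ[k] D.K
  | .Kinv => D.Kinv ⊗ₜ[k] D.Kinv

/-- The values of the counit on the generators. -/
def counitGen : UGen → k
  | .E => 0
  | .F => 0
  | .K => 1
  | .Kinv => 1

theorem m_ne_zero : D.m ≠ 0 := pow_ne_zero _ (NeZero.ne D.n)

theorem prim_bq : IsPrimitiveRoot D.bq D.m := by
  refine D.prim.pow (pow_pos (Nat.pos_of_ne_zero D.m_ne_zero) 2) ?_
  rw [sq, m]

theorem prim_q : IsPrimitiveRoot D.q D.n := by
  refine D.prim_bq.pow (Nat.pos_of_ne_zero D.m_ne_zero) ?_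
  rw [m, sq]

theorem bq_pow_m : D.bq ^ D.m = 1 := D.prim_bq.pow_eq_one

theorem q_pow_n : D.q ^ D.n = 1 := D.prim_q.pow_eq_one

theorem bq_ne_zero : D.bq ≠ 0 := D.prim_bq.ne_zero D.m_ne_zero

theorem q_ne_zero : D.q ≠ 0 := D.prim_q.ne_zero (NeZero.ne D.n)

theorem prim_q_sq : IsPrimitiveRoot (D.q ^ 2) D.n :=
  D.prim_q.pow_of_coprime 2 (Nat.coprime_two_left.mpr D.odd)

theorem q_sq_ne_one : D.q ^ 2 ≠ 1 :=
  D.prim_q_sq.ne_one (by have := D.two_lt; omega)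

theorem q_sub_inv_ne_zero : D.q - D.q⁻¹ ≠ 0 := by
  intro h
  apply D.q_sq_ne_one
  have := D.q_ne_zero
  field_simp at h
  linear_combination h

theorem m_cast_ne_zero : (D.m : k) ≠ 0 := by
  have : NeZero D.m := ⟨D.m_ne_zero⟩
  exact (D.prim_bq.neZero').out

/-- The character `s ↦ 𝐪^s` of `ℤ/m`. -/
def χ (s : ZMod D.m) : k := D.bq ^ s.val

theorem χ_natCast (a : ℕ) : D.χ (a : ZMod D.m) = D.bq ^ a := by
  rw [χ, ZMod.val_natCast]
  conv_rhs => rw [← Nat.mod_add_div a D.m, pow_add, pow_mul, D.bq_pow_m, one_pow, mul_one]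

theorem χ_add (s t : ZMod D.m) : D.χ (s + t) = D.χ s * D.χ t := by
  have h : s + t = ((s.val + t.val : ℕ) : ZMod D.m) := by
    simp
  rw [h, χ_natCast, pow_add]; rfl

theorem χ_zero : D.χ 0 = 1 := by simp [χ]

theorem χ_ne_zero (s : ZMod D.m) : D.χ s ≠ 0 := pow_ne_zero _ D.bq_ne_zero

theorem χ_neg (s : ZMod D.m) : D.χ (-s) = (D.χ s)⁻¹ := by
  apply eq_inv_of_mul_eq_one_left
  rw [← χ_add, neg_add_cancel, χ_zero]

theorem χ_sub (s t : ZMod D.m) : D.χ (s - t) = D.χ s * (D.χ t)⁻¹ := by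
  rw [sub_eq_add_neg, χ_add, χ_neg]

theorem χ_pow_m (s : ZMod D.m) : D.χ s ^ D.m = 1 := by
  rw [χ, ← pow_mul, mul_comm, pow_mul, D.bq_pow_m, one_pow]

theorem χ_inj {s t : ZMod D.m} (h : D.χ s = D.χ t) : s = t :=
  ZMod.val_injective _ (D.prim_bq.pow_inj (ZMod.val_lt s) (ZMod.val_lt t) h)

theorem χ_two_n : D.χ (2 * D.n) = D.q ^ 2 := by
  have : (2 * D.n : ZMod D.m) = ((D.n * 2 : ℕ) : ZMod D.m) := by push_cast; ring
  rw [this, χ_natCast, pow_mul]; rfl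

theorem idem_eq (s : ZMod D.m) :
    D.idem s = ((D.m : k)⁻¹) • ∑ r ∈ Finset.range D.m, D.χ s ^ r • D.K ^ r := by
  simp [idem, χ, pow_mul]

theorem K_mul_idem (s : ZMod D.m) : D.K * D.idem s = (D.χ s)⁻¹ • D.idem s := by
  have h : ∀ f : ℕ → D.U, f D.m = f 0 →
      ∑ r ∈ Finset.range D.m, f (r + 1) = ∑ r ∈ Finset.range D.m, f r := by
    intro f hf
    have h1 := Finset.sum_range_succ f D.m
    rw [Finset.sum_range_succ', hf] at h1
    exact add_right_cancel h1
  have h2 := h (fun r => D.χ s ^ r • D.K ^ r) (by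
    simp only [χ_pow_m, pow_zero]
    rw [show D.K ^ D.m = 1 from D.gen_rel.K_pow])
  rw [idem_eq, mul_smul_comm, smul_comm]
  congr 1
  conv_rhs => rw [← h2]
  rw [Finset.mul_sum, Finset.smul_sum]
  refine Finset.sum_congr rfl fun r _ => ?_
  rw [smul_smul, mul_smul_comm, pow_succ, pow_succ', mul_comm _ (D.χ s), inv_mul_cancel_left₀
    (D.χ_ne_zero s)]

theorem K_pow_mul_idem (s : ZMod D.m) (r : ℕ) :
    D.K ^ r * D.idem s = ((D.χ s)⁻¹) ^ r • D.idem s := by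
  induction r with
  | zero => simp
  | succ r ih => rw [pow_succ', mul_assoc, ih, mul_smul_comm, K_mul_idem, smul_smul, pow_succ]

theorem idem_mul_idem (s t : ZMod D.m) :
    D.idem s * D.idem t = if s = t then D.idem t else 0 := by
  conv_lhs => rw [idem_eq D s]
  rw [smul_mul_assoc, Finset.sum_mul]
  simp_rw [smul_mul_assoc, K_pow_mul_idem, smul_smul, ← mul_pow]
  rw [← Finset.sum_smul, smul_smul]
  split_ifs with h
  · subst h
    simp only [mul_inv_cancel₀ (D.χ_ne_zero s), one_pow, Finset.sum_const, Finset.card_range,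
      nsmul_eq_mul, mul_one, inv_mul_cancel₀ D.m_cast_ne_zero, one_smul]
  · have hx : D.χ s * (D.χ t)⁻¹ ≠ 1 := fun h' => h (D.χ_inj (by
      rwa [mul_inv_eq_one₀ (D.χ_ne_zero t)] at h'))
    have : ∑ r ∈ Finset.range D.m, (D.χ s * (D.χ t)⁻¹) ^ r = 0 := by
      rw [geom_sum_eq hx, ← χ_sub, χ_pow_m, sub_self, zero_div]
    rw [this, mul_zero, zero_smul]

theorem sum_idem : ∑ s, D.idem s = 1 := by
  simp_rw [idem_eq]
  rw [← Finset.smul_sum, Finset.sum_comm]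
  have : ∀ r ∈ Finset.range D.m, ∑ s : ZMod D.m, D.χ s ^ r • D.K ^ r =
      if r = 0 then (D.m : k) • 1 else 0 := by
    intro r hr
    rw [← Finset.sum_smul]
    split_ifs with h
    · subst h; simp [ZMod.card]
    · have h1 : ∑ s : ZMod D.m, D.χ s ^ r = ∑ a ∈ Finset.range D.m, (D.bq ^ r) ^ a := by
        refine Finset.sum_bij' (fun s _ => s.val) (fun a _ => (a : ZMod D.m)) ?_ ?_ ?_ ?_ ?_
        · intro s _; simpa using ZMod.val_lt s
        · simp
        · simp
        · intro a ha; exact ZMod.val_cast_of_lt (by simpa using ha)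
        · intro s _; rw [χ, ← pow_mul, ← pow_mul, mul_comm]
      have h2 : D.bq ^ r ≠ 1 := D.prim_bq.pow_ne_one_of_pos_of_lt h (by simpa using hr)
      rw [h1, geom_sum_eq h2, ← pow_mul, mul_comm r, pow_mul, D.bq_pow_m, one_pow, sub_self,
        zero_div, zero_smul]
  rw [Finset.sum_congr rfl this, Finset.sum_ite_eq' (Finset.range D.m) 0,
    if_pos (by simpa using Nat.pos_of_ne_zero D.m_ne_zero), smul_smul, inv_mul_cancel₀ D.m_cast_ne_zero, one_smul]

theorem KE : D.K * D.E = D.q ^ 2 • (D.E * D.K) := by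
  have h := congrArg (· * D.K) D.gen_rel.KE
  simp only [smul_mul_assoc, mul_assoc, D.gen_rel.Kinv_K, mul_one] at h
  exact h

theorem KF : D.K * D.F = (D.q ^ 2)⁻¹ • (D.F * D.K) := by
  have h := congrArg (· * D.K) D.gen_rel.KF
  simp only [smul_mul_assoc, mul_assoc, D.gen_rel.Kinv_K, mul_one] at h
  exact h

theorem idem_mul_E (s : ZMod D.m) : D.idem s * D.E = D.E * D.idem (s + 2 * D.n) := by
  have h : ∀ r : ℕ, D.K ^ r * D.E = (D.q ^ 2) ^ r • (D.E * D.K ^ r) := by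
    intro r
    induction r with
    | zero => simp
    | succ r ih =>
      rw [pow_succ, mul_assoc, KE, mul_smul_comm, ← mul_assoc, ih, smul_mul_assoc, smul_smul,
        mul_assoc, ← pow_succ, ← pow_succ']
  rw [idem_eq, idem_eq, smul_mul_assoc, mul_smul_comm, Finset.sum_mul, Finset.mul_sum]
  congr 1
  refine Finset.sum_congr rfl fun r _ => ?_
  rw [smul_mul_assoc, h, mul_smul_comm, smul_smul, χ_add, χ_two_n, mul_pow]

theorem idem_mul_F (s : ZMod D.m) : D.idem s * D.F = D.F * D.idem (s - 2 * D.n) := by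
  have h : ∀ r : ℕ, D.K ^ r * D.F = ((D.q ^ 2)⁻¹) ^ r • (D.F * D.K ^ r) := by
    intro r
    induction r with
    | zero => simp
    | succ r ih =>
      rw [pow_succ, mul_assoc, KF, mul_smul_comm, ← mul_assoc, ih, smul_mul_assoc, smul_smul,
        mul_assoc, ← pow_succ, ← pow_succ']
  rw [idem_eq, idem_eq, smul_mul_assoc, mul_smul_comm, Finset.sum_mul, Finset.mul_sum]
  congr 1
  refine Finset.sum_congr rfl fun r _ => ?_
  rw [smul_mul_assoc, h, mul_smul_comm, smul_smul, χ_sub, χ_two_n, mul_pow]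

end QData


set_option linter.unusedSectionVars false

/-! ### Diagonal elements -/

section diag

variable {k : Type u} [Field k] {A B A' B' : Type u} [Ring A] [Algebra k A] [Ring B] [Algebra k B]
  [Ring A'] [Algebra k A'] [Ring B'] [Algebra k B']
  {ι κ ι' κ' : Type} [Fintype ι] [Fintype κ] [Fintype ι'] [Fintype κ']
  [DecidableEq ι] [DecidableEq κ] [DecidableEq ι'] [DecidableEq κ']

/-- The combination `∑ f(i) e_i` of a family of elements. -/
def dg (e : ι → A) (f : ι → k) : A := ∑ i, f i • e i

/-- The family `e_i ⊗ e'_j`. -/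
def fam (k : Type u) [Field k] {A B : Type u} [Ring A] [Algebra k A] [Ring B] [Algebra k B]
    {ι κ : Type} (e : ι → A) (e' : κ → B) (p : ι × κ) : A ⊗[k] B := e p.1 ⊗ₜ[k] e' p.2

/-- Complete families of orthogonal idempotents. -/
structure IdemFam (e : ι → A) : Prop where
  mul : ∀ i j, e i * e j = if i = j then e j else 0
  sum : ∑ i, e i = 1

theorem IdemFam.fam {e : ι → A} {e' : κ → B} (h : IdemFam e) (h' : IdemFam e') :
    IdemFam (fam k e e') where
  mul := by
    rintro ⟨i, j⟩ ⟨i', j'⟩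
    simp only [_root_.fam, Algebra.TensorProduct.tmul_mul_tmul, h.mul, h'.mul, Prod.mk.injEq]
    by_cases h1 : i = i' <;> by_cases h2 : j = j' <;> simp [h1, h2]
  sum := by
    simp only [_root_.fam, Fintype.sum_prod_type, ← TensorProduct.tmul_sum,
      ← TensorProduct.sum_tmul, h.sum, h'.sum]
    rfl

theorem IdemFam.dg_mul {e : ι → A} (h : IdemFam e) (f g : ι → k) :
    dg e f * dg e g = dg e (f * g) := by
  simp only [dg, Finset.sum_mul, Finset.mul_sum, smul_mul_smul_comm, h.mul]
  refine Finset.sum_congr rfl fun i _ => ?_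
  rw [Finset.sum_eq_single i]
  · simp
  · intro j _ hj; rw [if_neg hj, smul_zero]
  · simp

theorem IdemFam.dg_one {e : ι → A} (h : IdemFam e) : dg e (1 : ι → k) = 1 := by
  simp [dg, h.sum]

theorem dg_smul (e : ι → A) (c : k) (f : ι → k) : dg e (c • f) = c • dg e f := by
  simp [dg, Finset.smul_sum, mul_smul]

theorem dg_sum {T : Type} (s : Finset T) (e : ι → A) (f : T → ι → k) :
    dg e (∑ t ∈ s, f t) = ∑ t ∈ s, dg e (f t) := by
  simp only [dg, Finset.sum_apply, Finset.sum_smul]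
  exact Finset.sum_comm

theorem dg_delta (e : ι → A) (i : ι) : dg e (fun j => if j = i then (1 : k) else 0) = e i := by
  simp [dg]

theorem dg_tmul (e : ι → A) (e' : κ → B) (f : ι → k) (g : κ → k) :
    dg e f ⊗ₜ[k] dg e' g = dg (fam k e e') (fun p => f p.1 * g p.2) := by
  simp only [dg, fam, Fintype.sum_prod_type, TensorProduct.sum_tmul, TensorProduct.tmul_sum,
    TensorProduct.smul_tmul_smul]
  exact Finset.sum_comm

/-- `x` shifts the family `e`. -/
def Sh (e : ι → A) (x : A) (σ : ι ≃ ι) : Prop := ∀ i, e (σ i) * x = x * e i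

theorem Sh.dg {e : ι → A} {x : A} {σ : ι ≃ ι} (h : Sh e x σ) (f : ι → k) :
    dg e f * x = x * dg e (fun i => f (σ i)) := by
  simp only [_root_.dg, Finset.sum_mul, Finset.mul_sum, smul_mul_assoc, mul_smul_comm]
  rw [← Equiv.sum_comp σ]
  exact Finset.sum_congr rfl fun i _ => by rw [h i]

theorem Sh.one (e : ι → A) : Sh e 1 (Equiv.refl ι) := fun i => by simp

theorem Sh.tmul {e : ι → A} {e' : κ → B} {x : A} {y : B} {σ : ι ≃ ι} {τ : κ ≃ κ} (h : Sh e x σ)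
    (h' : Sh e' y τ) : Sh (fam k e e') (x ⊗ₜ[k] y) (σ.prodCongr τ) := by
  rintro ⟨i, j⟩
  simp [fam, h i, h' j]

theorem IdemFam.move {e : ι → A} (he : IdemFam e) {y : A} {σ : ι ≃ ι} (h : Sh e y σ) (x : A)
    (f g : ι → k) : (x * _root_.dg e f) * (y * _root_.dg e g) =
      (x * y) * _root_.dg e (fun i => f (σ i) * g i) := by
  rw [mul_assoc, ← mul_assoc _ y, h.dg, mul_assoc, he.dg_mul, ← mul_assoc]
  rfl

theorem IdemFam.pow_eq_zero {e : ι → A} (he : IdemFam e) {x : A} {σ : ι ≃ ι} (h : Sh e x σ)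
    (f : ι → k) {n : ℕ} (hx : x ^ n = 0) : (x * _root_.dg e f) ^ n = 0 := by
  have key : ∀ j : ℕ, ∃ f' : ι → k, (x * _root_.dg e f) ^ j = x ^ j * _root_.dg e f' := by
    intro j
    induction j with
    | zero => exact ⟨1, by rw [pow_zero, pow_zero, one_mul, he.dg_one]⟩
    | succ j ih =>
      obtain ⟨f', hf⟩ := ih
      exact ⟨_, by rw [pow_succ, hf, he.move h, ← pow_succ]⟩
  obtain ⟨f', hf⟩ := key n
  rw [hf, hx, zero_mul]

/-- The linear map `l` transports diagonal elements along `g`. -/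
def Tr (l : A →ₗ[k] A') (e : ι → A) (e' : ι' → A') (g : ι' → ι) : Prop :=
  ∀ i, l (e i) = dg e' (fun j => if g j = i then (1 : k) else 0)

theorem Tr.dg {l : A →ₗ[k] A'} {e : ι → A} {e' : ι' → A'} {g : ι' → ι} (h : Tr l e e' g)
    (f : ι → k) : l (dg e f) = dg e' (fun j => f (g j)) := by
  have h1 : (fun j => f (g j)) = ∑ i, f i • (fun j => if g j = i then (1 : k) else 0) := by
    ext j; simp
  rw [h1, dg_sum]
  conv_lhs => rw [_root_.dg]
  rw [map_sum]
  exact Finset.sum_congr rfl fun i _ => by rw [map_smul, h i, dg_smul]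

theorem Tr.id (e : ι → A) : Tr (LinearMap.id : A →ₗ[k] A) e e (fun i => i) :=
  fun i => (dg_delta e i).symm

theorem Tr.comp {A'' : Type u} [Ring A''] [Algebra k A''] {ι'' : Type} [Fintype ι'']
    [DecidableEq ι''] {l : A →ₗ[k] A'} {l' : A' →ₗ[k] A''} {e : ι → A} {e' : ι' → A'}
    {e'' : ι'' → A''} {g : ι' → ι} {g' : ι'' → ι'} (h : Tr l e e' g) (h' : Tr l' e' e'' g') :
    Tr (l' ∘ₗ l) e e'' (fun j => g (g' j)) := by
  intro i
  rw [LinearMap.comp_apply, h i, h'.dg]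

theorem Tr.tensor {l : A →ₗ[k] A'} {l' : B →ₗ[k] B'} {e : ι → A} {e₁ : ι' → A'} {g : ι' → ι}
    {e' : κ → B} {e₁' : κ' → B'} {g' : κ' → κ} (h : Tr l e e₁ g) (h' : Tr l' e' e₁' g') :
    Tr (TensorProduct.map l l') (fam k e e') (fam k e₁ e₁') (fun p => (g p.1, g' p.2)) := by
  rintro ⟨i, j⟩
  rw [fam, TensorProduct.map_tmul, h i, h' j, dg_tmul]
  congr 1
  ext ⟨x, y⟩
  by_cases h1 : g x = i <;> by_cases h2 : g' y = j <;> simp [h1, h2]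

theorem Tr.assoc (e : ι → A) (e' : κ → B) (e₁ : ι' → A') :
    Tr (Algebra.TensorProduct.assoc k k k A B A').toLinearMap
      (fam k (fam k e e') e₁) (fam k e (fam k e' e₁)) (fun p => ((p.1, p.2.1), p.2.2)) := by
  rintro ⟨⟨i, j⟩, l⟩
  have : (fun p : ι × κ × ι' => if ((p.1, p.2.1), p.2.2) = ((i, j), l) then (1 : k) else 0) =
      fun p => if p = (i, j, l) then 1 else 0 := by
    ext ⟨x, y, z⟩
    simp [and_assoc]
  rw [this, dg_delta]
  simp [fam]

end diag

/-! ### The `q`-binomial formula at a root of unity -/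

section qbinomial

variable {k : Type u} [Field k] (ω : k)

/-- Gaussian binomial coefficients. -/
def gaussBin : ℕ → ℕ → k
  | _, 0 => 1
  | 0, _ + 1 => 0
  | N + 1, j + 1 => gaussBin N j + ω ^ (j + 1) * gaussBin N (j + 1)

theorem gaussBin_zero (N : ℕ) : gaussBin ω N 0 = 1 := by cases N <;> simp [gaussBin]

theorem gaussBin_gt (N j : ℕ) (h : N < j) : gaussBin ω N j = 0 := by
  induction N generalizing j with
  | zero => cases j with
    | zero => omega
    | succ j => simp [gaussBin]
  | succ N ih => cases j with
    | zero => omega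
    | succ j => simp [gaussBin, ih j (by omega), ih (j + 1) (by omega)]

theorem gaussBin_self (N : ℕ) : gaussBin ω N N = 1 := by
  induction N with
  | zero => simp [gaussBin]
  | succ N ih => simp [gaussBin, ih, gaussBin_gt ω N (N + 1) (by omega)]

theorem gaussBin_step (N j : ℕ) (h : j ≤ N) :
    (1 - ω ^ (N - j)) * gaussBin ω N j = (1 - ω ^ (j + 1)) * gaussBin ω N (j + 1) := by
  induction N generalizing j with
  | zero =>
    obtain rfl : j = 0 := by omega
    simp [gaussBin]
  | succ N ih =>
    cases j with
    | zero =>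
      have h0 := ih 0 (by omega)
      simp only [gaussBin_zero, Nat.sub_zero, zero_add, pow_one, mul_one] at h0
      simp only [gaussBin, gaussBin_zero, Nat.sub_zero, zero_add, mul_one, pow_succ]
      linear_combination ω * h0
    | succ j =>
      have h1 := ih j (by omega)
      obtain ⟨d, rfl⟩ := Nat.exists_eq_add_of_le (show j ≤ N by omega)
      rcases Nat.eq_zero_or_pos d with rfl | hd
      · simp [gaussBin_gt ω (j + 0 + 1) (j + 1 + 1) (by omega)]
      · obtain ⟨d, rfl⟩ := Nat.exists_eq_succ_of_ne_zero hd.ne'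
        have h2 := ih (j + 1) (by omega)
        rw [show j + (d + 1) - (j + 1) = d by omega] at h2
        rw [show j + (d + 1) - j = d + 1 by omega] at h1
        rw [show j + (d + 1) + 1 - (j + 1) = d + 1 by omega]
        rw [show gaussBin ω (j + (d + 1) + 1) (j + 1) = gaussBin ω (j + (d + 1)) j +
            ω ^ (j + 1) * gaussBin ω (j + (d + 1)) (j + 1) from rfl,
          show gaussBin ω (j + (d + 1) + 1) (j + 1 + 1) = gaussBin ω (j + (d + 1)) (j + 1) +
            ω ^ (j + 1 + 1) * gaussBin ω (j + (d + 1)) (j + 1 + 1) from rfl]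
        linear_combination h1 + ω ^ (j + 1 + 1) * h2

theorem gaussBin_root {n : ℕ} (hω : IsPrimitiveRoot ω n) (j : ℕ) (h0 : 0 < j) (hj : j < n) :
    gaussBin ω n j = 0 := by
  induction j with
  | zero => omega
  | succ j ih =>
    have h := gaussBin_step ω n j (by omega)
    have h1 : (1 - ω ^ (j + 1)) ≠ 0 := fun h' =>
      hω.pow_ne_one_of_pos_of_lt (Nat.succ_ne_zero j) hj (sub_eq_zero.mp h').symm
    have h2 : (1 - ω ^ (n - j)) * gaussBin ω n j = 0 := by
      rcases Nat.eq_zero_or_pos j with rfl | hj0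
      · simp [hω.pow_eq_one]
      · rw [ih hj0 (by omega), mul_zero]
    rw [h2] at h
    exact (mul_eq_zero.mp h.symm).resolve_left h1

theorem add_pow_gaussBin {A : Type u} [Ring A] [Algebra k A] (X Y : A) (h : Y * X = ω • (X * Y))
    (N : ℕ) :
    (X + Y) ^ N = ∑ j ∈ Finset.range (N + 1), gaussBin ω N j • (X ^ j * Y ^ (N - j)) := by
  have hY : ∀ j : ℕ, Y * X ^ j = ω ^ j • (X ^ j * Y) := by
    intro j
    induction j with
    | zero => simp
    | succ j ih =>
      rw [pow_succ, ← mul_assoc, ih, smul_mul_assoc, mul_assoc, h, mul_smul_comm, smul_smul,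
        ← mul_assoc, ← pow_succ]
  induction N with
  | zero => simp [gaussBin]
  | succ N ih =>
    have e1 : X * (X + Y) ^ N =
        ∑ j ∈ Finset.range (N + 1), gaussBin ω N j • (X ^ (j + 1) * Y ^ (N - j)) := by
      rw [ih, Finset.mul_sum]
      exact Finset.sum_congr rfl fun j _ => by rw [mul_smul_comm, ← mul_assoc, ← pow_succ']
    have e2 : Y * (X + Y) ^ N = ∑ j ∈ Finset.range (N + 1 + 1),
        (ω ^ j * gaussBin ω N j) • (X ^ j * Y ^ (N + 1 - j)) := by
      rw [Finset.sum_range_succ, gaussBin_gt ω N (N + 1) (by omega), mul_zero, zero_smul, add_zero,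
        ih, Finset.mul_sum]
      refine Finset.sum_congr rfl fun j hj => ?_
      rw [mul_smul_comm, ← mul_assoc, hY, smul_mul_assoc, smul_smul, mul_assoc, ← pow_succ',
        show N - j + 1 = N + 1 - j by have := Finset.mem_range.mp hj; omega, mul_comm (ω ^ j)]
    rw [pow_succ', add_mul, e1, e2, Finset.sum_range_succ' _ (N + 1),
      Finset.sum_range_succ' _ (N + 1), ← add_assoc, ← Finset.sum_add_distrib]
    congr 1
    · refine Finset.sum_congr rfl fun j _ => ?_
      rw [show N + 1 - (j + 1) = N - j by omega, ← add_smul]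
      rfl
    · simp [gaussBin_zero]

theorem add_pow_root {A : Type u} [Ring A] [Algebra k A] {n : ℕ} (hn : n ≠ 0)
    (hω : IsPrimitiveRoot ω n) (X Y : A) (h : Y * X = ω • (X * Y)) :
    (X + Y) ^ n = X ^ n + Y ^ n := by
  obtain ⟨N, rfl⟩ := Nat.exists_eq_succ_of_ne_zero hn
  rw [add_pow_gaussBin ω X Y h, Finset.sum_range_succ, Finset.sum_range_succ',
    Finset.sum_eq_zero, gaussBin_self, gaussBin_zero]
  · simp [add_comm]
  · intro j hj
    rw [gaussBin_root ω hω (j + 1) (by omega) (by have := Finset.mem_range.mp hj; omega),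
      zero_smul]

end qbinomial


namespace QData

variable {k : Type u} [Field k] (D : QData k)

/-- `s ↦ s - 2n` on `ℤ/m`. -/
def dn : ZMod D.m ≃ ZMod D.m := Equiv.subRight (2 * D.n : ZMod D.m)

/-- `s ↦ s + 2n` on `ℤ/m`. -/
def up : ZMod D.m ≃ ZMod D.m := Equiv.addRight (2 * D.n : ZMod D.m)

theorem dn_apply (s : ZMod D.m) : D.dn s = s - 2 * D.n := rfl
theorem up_apply (s : ZMod D.m) : D.up s = s + 2 * D.n := rfl
theorem up_dn (s : ZMod D.m) : D.up (D.dn s) = s := by simp [up_apply, dn_apply]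
theorem dn_up (s : ZMod D.m) : D.dn (D.up s) = s := by simp [up_apply, dn_apply]
theorem up_add (s t : ZMod D.m) : D.up s + t = D.up (s + t) := by simp only [up_apply]; ring
theorem add_up (s t : ZMod D.m) : s + D.up t = D.up (s + t) := by simp only [up_apply]; ring
theorem dn_add (s t : ZMod D.m) : D.dn s + t = D.dn (s + t) := by simp only [dn_apply]; ring
theorem add_dn (s t : ZMod D.m) : s + D.dn t = D.dn (s + t) := by simp only [dn_apply]; ring

theorem χ_up (s : ZMod D.m) : D.χ (D.up s) = D.q ^ 2 * D.χ s := by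
  rw [up_apply, χ_add, χ_two_n, mul_comm]

theorem χ_dn (s : ZMod D.m) : D.χ (D.dn s) = (D.q ^ 2)⁻¹ * D.χ s := by
  rw [dn_apply, χ_sub, χ_two_n, mul_comm]

/-- `s ↦ q^s`. -/
def L (s : ZMod D.m) : k := D.χ s ^ D.n

theorem L_ne_zero (s : ZMod D.m) : D.L s ≠ 0 := pow_ne_zero _ (D.χ_ne_zero s)
theorem L_zero : D.L 0 = 1 := by simp [L, χ_zero]
theorem L_add (s t : ZMod D.m) : D.L (s + t) = D.L s * D.L t := by simp [L, χ_add, mul_pow]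
theorem L_up (s : ZMod D.m) : D.L (D.up s) = D.L s := by
  rw [L, χ_up, mul_pow, D.prim_q_sq.pow_eq_one, one_mul, L]
theorem L_dn (s : ZMod D.m) : D.L (D.dn s) = D.L s := by
  conv_rhs => rw [← D.up_dn s, L_up]

/-- `1` if `s < 2n`, and `0` otherwise. -/
def lo (s : ZMod D.m) : ℕ := if s.val < 2 * D.n then 1 else 0

/-- The carry in the addition of `s` and `t`. -/
def carry (s t : ZMod D.m) : ℕ := (s.val + t.val) / D.m

theorem two_n_lt : 2 * D.n < D.m := by
  have := D.two_lt
  rw [m, sq]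
  exact Nat.mul_lt_mul_of_pos_right this (by omega)

theorem val_two_n : (2 * D.n : ZMod D.m).val = 2 * D.n := by
  have := ZMod.val_cast_of_lt D.two_n_lt
  push_cast at this
  exact this

theorem val_dn (s : ZMod D.m) : (D.dn s).val + 2 * D.n = s.val + D.m * D.lo s := by
  have h1 : s.val = ((D.dn s).val + 2 * D.n) % D.m := by
    conv_lhs => rw [← D.up_dn s]
    rw [up_apply, ZMod.val_add, val_two_n]
  have h2 := ZMod.val_lt (D.dn s)
  have h3 := D.two_n_lt
  generalize (D.dn s).val = u at h1 h2 ⊢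
  rcases Nat.lt_or_ge (u + 2 * D.n) D.m with h | h
  · rw [Nat.mod_eq_of_lt h] at h1
    rw [lo, if_neg (by omega)]; omega
  · rw [Nat.mod_eq_sub_mod h, Nat.mod_eq_of_lt (by omega)] at h1
    rw [lo, if_pos (by omega)]; omega

theorem val_carry (s t : ZMod D.m) : s.val + t.val = (s + t).val + D.m * D.carry s t := by
  rw [carry, ZMod.val_add, Nat.mod_add_div]

theorem carry_comm (s t : ZMod D.m) : D.carry s t = D.carry t s := by
  rw [carry, carry, add_comm]

theorem carry_dn (s t : ZMod D.m) :
    D.lo s + D.carry s t = D.carry (D.dn s) t + D.lo (s + t) := by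
  have h1 := D.val_dn s
  have h2 := D.val_carry s t
  have h3 := D.val_carry (D.dn s) t
  have h4 := D.val_dn (s + t)
  rw [dn_add] at h3
  apply Nat.eq_of_mul_eq_mul_left (Nat.pos_of_ne_zero D.m_ne_zero)
  rw [mul_add, mul_add]
  omega

theorem carry_assoc (a b c : ZMod D.m) :
    D.carry a b + D.carry (a + b) c = D.carry b c + D.carry a (b + c) := by
  have h1 := D.val_carry a b
  have h2 := D.val_carry (a + b) c
  have h3 := D.val_carry b c
  have h4 := D.val_carry a (b + c)
  rw [add_assoc] at h2
  apply Nat.eq_of_mul_eq_mul_left (Nat.pos_of_ne_zero D.m_ne_zero)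
  rw [mul_add, mul_add]
  omega

theorem cocycle_eq (s t r : ZMod D.m) : D.cocycle s t r = D.L r ^ D.carry s t := by
  rw [cocycle, L, χ, carry, ← pow_mul, ← pow_mul]
  congr 1; ring

theorem emod_dn (s : ZMod D.m) : D.φ₁₁ s = D.m * D.lo s := by
  have h : ((s.val : ℤ) - 2 * D.n) % D.m = (D.dn s).val := by
    have h1 : (s.val : ℤ) - 2 * D.n = (D.dn s).val + D.m * (-(D.lo s : ℤ)) := by
      have := D.val_dn s
      have h2 : (((D.dn s).val + 2 * D.n : ℕ) : ℤ) = ((s.val + D.m * D.lo s : ℕ) : ℤ) := by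
        rw [this]
      push_cast at h2 ⊢
      linarith
    rw [h1, Int.add_mul_emod_self_left, Int.emod_eq_of_lt (by positivity)
      (by exact_mod_cast ZMod.val_lt _)]
  have := D.val_dn s
  have h2 : (((D.dn s).val + 2 * D.n : ℕ) : ℤ) = ((s.val + D.m * D.lo s : ℕ) : ℤ) := by rw [this]
  rw [φ₁₁, h]
  push_cast at h2 ⊢
  linarith

theorem emod_up (s : ZMod D.m) : D.φ₂₁ s = -(D.m * D.lo (D.up s)) := by
  have h0 := D.val_dn (D.up s)
  rw [dn_up] at h0
  have h2 : ((s.val + 2 * D.n : ℕ) : ℤ) = (((D.up s).val + D.m * D.lo (D.up s) : ℕ) : ℤ) := by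
    rw [h0]
  push_cast at h2
  have h : ((s.val : ℤ) + 2 * D.n) % D.m = (D.up s).val := by
    have h1 : (s.val : ℤ) + 2 * D.n = (D.up s).val + D.m * (D.lo (D.up s) : ℤ) := by
      push_cast
      linarith
    rw [h1, Int.add_mul_emod_self_left, Int.emod_eq_of_lt (by positivity)
      (by exact_mod_cast ZMod.val_lt _)]
  rw [φ₂₁, h]
  push_cast
  linarith

theorem Φ₁_eq (s r : ZMod D.m) : D.Φ₁ s r = D.L r ^ D.lo s := by
  rw [Φ₁, emod_dn, L, χ, bq, ← pow_mul, ← pow_mul, ← pow_mul, ← zpow_natCast]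
  congr 1; push_cast; ring

theorem Φ₂_eq (s r : ZMod D.m) : D.Φ₂ s r = (D.L r ^ D.lo (D.up s))⁻¹ := by
  rw [Φ₂, emod_up, L, χ, bq, ← pow_mul, ← pow_mul, ← pow_mul, ← zpow_natCast, ← zpow_neg]
  congr 1; push_cast; ring

/-- The coefficients of `Δ(F)`. -/
def Ψ (s r : ZMod D.m) : k := D.Φ₂ s r * D.χ r

/-- The idempotent family of `U ⊗ U`. -/
abbrev e₂ : ZMod D.m × ZMod D.m → D.U ⊗[k] D.U := fam k D.idem D.idem

/-- The idempotent family of `U ⊗ U ⊗ U`. -/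
abbrev e₃ : ZMod D.m × ZMod D.m × ZMod D.m → D.U ⊗[k] (D.U ⊗[k] D.U) := fam k D.idem D.e₂

theorem idemFam : IdemFam D.idem := ⟨D.idem_mul_idem, D.sum_idem⟩

theorem idemFam₂ : IdemFam D.e₂ := D.idemFam.fam D.idemFam

theorem idemFam₃ : IdemFam D.e₃ := D.idemFam.fam D.idemFam₂

theorem shE : Sh D.idem D.E D.dn := fun i => by
  rw [dn_apply, idem_mul_E, sub_add_cancel]

theorem shF : Sh D.idem D.F D.up := fun i => by
  rw [up_apply, idem_mul_F, add_sub_cancel_right]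

theorem K_eq : D.K = dg D.idem (fun s => (D.χ s)⁻¹) := by
  conv_lhs => rw [← mul_one D.K, ← sum_idem, Finset.mul_sum]
  simp only [K_mul_idem, dg]

theorem Kinv_eq : D.Kinv = dg D.idem D.χ := by
  have h : dg (k := k) D.idem (fun s => (D.χ s)⁻¹) * dg D.idem D.χ = 1 := by
    rw [D.idemFam.dg_mul, ← D.idemFam.dg_one (k := k)]
    congr 1; ext s; simp [D.χ_ne_zero s]
  rw [← K_eq] at h
  calc D.Kinv = D.Kinv * (D.K * dg (k := k) D.idem D.χ) := by rw [h, mul_one]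
    _ = _ := by rw [← mul_assoc, D.gen_rel.Kinv_K, one_mul]

theorem one_eq : (1 : D.U) = dg D.idem (fun _ => (1 : k)) := D.idemFam.dg_one.symm

theorem diag₂_left (f : ZMod D.m → k) :
    dg D.idem f ⊗ₜ[k] (1 : D.U) = dg D.e₂ (fun p => f p.1) := by
  rw [one_eq, dg_tmul]; simp

theorem diag₂_right (f : ZMod D.m → k) :
    (1 : D.U) ⊗ₜ[k] dg D.idem f = dg D.e₂ (fun p => f p.2) := by
  rw [one_eq, dg_tmul]; simp

theorem comulGen_E : D.comulGen .E =
    (D.E ⊗ₜ[k] 1) * dg D.e₂ (fun p => D.Φ₁ p.1 p.2) +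
      (1 ⊗ₜ[k] D.E) * dg D.e₂ (fun p => (D.χ p.1)⁻¹) := by
  rw [comulGen, ← diag₂_left D (fun s => (D.χ s)⁻¹), ← K_eq]
  simp [dg, fam, Fintype.sum_prod_type, Finset.mul_sum]

theorem comulGen_F : D.comulGen .F =
    (D.F ⊗ₜ[k] 1) * dg D.e₂ (fun p => D.Ψ p.1 p.2) + 1 ⊗ₜ[k] D.F := by
  rw [comulGen]
  simp [dg, fam, Fintype.sum_prod_type, Finset.mul_sum, Ψ, χ]

theorem comulGen_K : D.comulGen .K = dg D.e₂ (fun p => (D.χ (p.1 + p.2))⁻¹) := by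
  rw [comulGen, K_eq, dg_tmul]
  simp [χ_add, mul_comm]

theorem comulGen_Kinv : D.comulGen .Kinv = dg D.e₂ (fun p => D.χ (p.1 + p.2)) := by
  rw [comulGen, Kinv_eq, dg_tmul]
  simp [χ_add]

theorem sh₂E1 (f : ZMod D.m → ZMod D.m → k) : dg D.e₂ (fun p => f p.1 p.2) * (D.E ⊗ₜ[k] 1) =
    (D.E ⊗ₜ[k] 1) * dg D.e₂ (fun p => f (D.dn p.1) p.2) :=
  (D.shE.tmul (Sh.one D.idem)).dg _

theorem sh₂E2 (f : ZMod D.m → ZMod D.m → k) : dg D.e₂ (fun p => f p.1 p.2) * (1 ⊗ₜ[k] D.E) =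
    (1 ⊗ₜ[k] D.E) * dg D.e₂ (fun p => f p.1 (D.dn p.2)) :=
  ((Sh.one D.idem).tmul D.shE).dg _

theorem sh₂F1 (f : ZMod D.m → ZMod D.m → k) : dg D.e₂ (fun p => f p.1 p.2) * (D.F ⊗ₜ[k] 1) =
    (D.F ⊗ₜ[k] 1) * dg D.e₂ (fun p => f (D.up p.1) p.2) :=
  (D.shF.tmul (Sh.one D.idem)).dg _

theorem sh₂F2 (f : ZMod D.m → ZMod D.m → k) : dg D.e₂ (fun p => f p.1 p.2) * (1 ⊗ₜ[k] D.F) =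
    (1 ⊗ₜ[k] D.F) * dg D.e₂ (fun p => f p.1 (D.up p.2)) :=
  ((Sh.one D.idem).tmul D.shF).dg _

theorem shE1 : Sh D.e₂ (D.E ⊗ₜ[k] (1 : D.U)) (D.dn.prodCongr (Equiv.refl _)) :=
  D.shE.tmul (Sh.one D.idem)

theorem shE2 : Sh D.e₂ ((1 : D.U) ⊗ₜ[k] D.E) ((Equiv.refl _).prodCongr D.dn) :=
  (Sh.one D.idem).tmul D.shE

theorem shF1 : Sh D.e₂ (D.F ⊗ₜ[k] (1 : D.U)) (D.up.prodCongr (Equiv.refl _)) :=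
  D.shF.tmul (Sh.one D.idem)

theorem shF2 : Sh D.e₂ ((1 : D.U) ⊗ₜ[k] D.F) ((Equiv.refl _).prodCongr D.up) :=
  (Sh.one D.idem).tmul D.shF

theorem tmul_one_pow (x : D.U) (h : x ^ D.n = 0) : (x ⊗ₜ[k] (1 : D.U)) ^ D.n = 0 := by
  rw [Algebra.TensorProduct.tmul_pow, h, TensorProduct.zero_tmul]

theorem one_tmul_pow (x : D.U) (h : x ^ D.n = 0) : ((1 : D.U) ⊗ₜ[k] x) ^ D.n = 0 := by
  rw [Algebra.TensorProduct.tmul_pow, h, TensorProduct.tmul_zero]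

theorem Ψ_Φ₁ (s r : ZMod D.m) : D.Φ₁ (D.up s) r * D.Ψ s r = D.χ r := by
  rw [Ψ, Φ₁_eq, Φ₂_eq, mul_inv_cancel_left₀ (pow_ne_zero _ (D.L_ne_zero r))]

theorem Ψ_Φ₁' (s r : ZMod D.m) : D.Ψ (D.dn s) r * D.Φ₁ s r = D.χ r := by
  conv_lhs => rw [← D.up_dn s, dn_up, mul_comm, Ψ_Φ₁]

theorem Φ₁_dn_right (s r : ZMod D.m) : D.Φ₁ s (D.dn r) = D.Φ₁ s r := by
  rw [Φ₁_eq, Φ₁_eq, L_dn]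

theorem Φ₁_up_right (s r : ZMod D.m) : D.Φ₁ s (D.up r) = D.Φ₁ s r := by
  rw [Φ₁_eq, Φ₁_eq, L_up]

theorem Ψ_dn_right (s r : ZMod D.m) : D.Ψ s (D.dn r) = (D.q ^ 2)⁻¹ * D.Ψ s r := by
  rw [Ψ, Ψ, Φ₂_eq, Φ₂_eq, L_dn, χ_dn]; ring

theorem Ψ_up_right (s r : ZMod D.m) : D.Ψ s (D.up r) = D.q ^ 2 * D.Ψ s r := by
  rw [Ψ, Ψ, Φ₂_eq, Φ₂_eq, L_up, χ_up]; ring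

theorem dg₂_smul (c : k) (f : ZMod D.m → ZMod D.m → k) :
    dg D.e₂ (fun p => c * f p.1 p.2) = c • dg D.e₂ (fun p => f p.1 p.2) :=
  dg_smul D.e₂ c (fun p => f p.1 p.2)

theorem comulGen_K_mul_Kinv : D.comulGen .K * D.comulGen .Kinv = 1 := by
  rw [comulGen, comulGen, Algebra.TensorProduct.tmul_mul_tmul, D.gen_rel.K_Kinv]; rfl

theorem comulGen_Kinv_mul_K : D.comulGen .Kinv * D.comulGen .K = 1 := by
  rw [comulGen, comulGen, Algebra.TensorProduct.tmul_mul_tmul, D.gen_rel.Kinv_K]; rfl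

theorem comulGen_KE : D.comulGen .K * D.comulGen .E =
    D.q ^ 2 • (D.comulGen .E * D.comulGen .K) := by
  have hX : ∀ f : ZMod D.m × ZMod D.m → k,
      D.comulGen .K * ((D.E ⊗ₜ[k] 1) * dg D.e₂ f) =
        D.q ^ 2 • (((D.E ⊗ₜ[k] 1) * dg D.e₂ f) * D.comulGen .K) := by
    intro f
    rw [comulGen_K, ← mul_assoc, sh₂E1 D (fun a b => (D.χ (a + b))⁻¹), mul_assoc, mul_assoc,
      D.idemFam₂.dg_mul, D.idemFam₂.dg_mul, ← mul_smul_comm, ← dg_smul]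
    congr 2; ext p
    simp [dn_add, χ_dn]; ring
  have hY : ∀ f : ZMod D.m × ZMod D.m → k,
      D.comulGen .K * ((1 ⊗ₜ[k] D.E) * dg D.e₂ f) =
        D.q ^ 2 • (((1 ⊗ₜ[k] D.E) * dg D.e₂ f) * D.comulGen .K) := by
    intro f
    rw [comulGen_K, ← mul_assoc, sh₂E2 D (fun a b => (D.χ (a + b))⁻¹), mul_assoc, mul_assoc,
      D.idemFam₂.dg_mul, D.idemFam₂.dg_mul, ← mul_smul_comm, ← dg_smul]
    congr 2; ext p
    simp [add_dn, χ_dn]; ring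
  rw [comulGen_E, mul_add, hX, hY, ← smul_add, add_mul]

theorem comulGen_KF : D.comulGen .K * D.comulGen .F =
    (D.q ^ 2)⁻¹ • (D.comulGen .F * D.comulGen .K) := by
  have hX : ∀ f : ZMod D.m × ZMod D.m → k,
      D.comulGen .K * ((D.F ⊗ₜ[k] 1) * dg D.e₂ f) =
        (D.q ^ 2)⁻¹ • (((D.F ⊗ₜ[k] 1) * dg D.e₂ f) * D.comulGen .K) := by
    intro f
    rw [comulGen_K, ← mul_assoc, sh₂F1 D (fun a b => (D.χ (a + b))⁻¹), mul_assoc, mul_assoc,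
      D.idemFam₂.dg_mul, D.idemFam₂.dg_mul, ← mul_smul_comm, ← dg_smul]
    congr 2; ext p
    simp [up_add, χ_up]; ring
  have hY : D.comulGen .K * (1 ⊗ₜ[k] D.F) = (D.q ^ 2)⁻¹ • ((1 ⊗ₜ[k] D.F) * D.comulGen .K) := by
    rw [comulGen_K, sh₂F2 D (fun a b => (D.χ (a + b))⁻¹), ← mul_smul_comm, ← dg_smul]
    congr 2; ext p
    simp [add_up, χ_up]; ring
  rw [comulGen_F, mul_add, hX, hY, ← smul_add, add_mul]

theorem comulGen_EF : D.comulGen .E * D.comulGen .F - D.comulGen .F * D.comulGen .E =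
    (D.q - D.q⁻¹)⁻¹ • (D.comulGen .K - D.comulGen .Kinv) := by
  have XZ : ((D.E ⊗ₜ[k] 1) * dg D.e₂ (fun p => D.Φ₁ p.1 p.2)) *
      ((D.F ⊗ₜ[k] 1) * dg D.e₂ (fun p => D.Ψ p.1 p.2)) =
      ((D.E * D.F) ⊗ₜ[k] 1) * (1 ⊗ₜ[k] D.Kinv) := by
    rw [D.idemFam₂.move D.shF1, Kinv_eq, diag₂_right]
    simp [Ψ_Φ₁]
  have ZX : ((D.F ⊗ₜ[k] 1) * dg D.e₂ (fun p => D.Ψ p.1 p.2)) *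
      ((D.E ⊗ₜ[k] 1) * dg D.e₂ (fun p => D.Φ₁ p.1 p.2)) =
      ((D.F * D.E) ⊗ₜ[k] 1) * (1 ⊗ₜ[k] D.Kinv) := by
    rw [D.idemFam₂.move D.shE1, Kinv_eq, diag₂_right]
    simp [Ψ_Φ₁']
  have XW : ((D.E ⊗ₜ[k] 1) * dg D.e₂ (fun p => D.Φ₁ p.1 p.2)) * (1 ⊗ₜ[k] D.F) =
      (1 ⊗ₜ[k] D.F) * ((D.E ⊗ₜ[k] 1) * dg D.e₂ (fun p => D.Φ₁ p.1 p.2)) := by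
    rw [mul_assoc, sh₂F2]
    simp [Φ₁_up_right, ← mul_assoc]
  have YZ : ((1 ⊗ₜ[k] D.E) * dg D.e₂ (fun p => (D.χ p.1)⁻¹)) *
      ((D.F ⊗ₜ[k] 1) * dg D.e₂ (fun p => D.Ψ p.1 p.2)) =
      ((D.F ⊗ₜ[k] 1) * dg D.e₂ (fun p => D.Ψ p.1 p.2)) *
        ((1 ⊗ₜ[k] D.E) * dg D.e₂ (fun p => (D.χ p.1)⁻¹)) := by
    rw [D.idemFam₂.move D.shF1, D.idemFam₂.move D.shE2]
    congr 1
    · simp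
    · congr 1; ext p
      simp [χ_up, Ψ_dn_right]; ring
  have YW : ((1 ⊗ₜ[k] D.E) * dg D.e₂ (fun p => (D.χ p.1)⁻¹)) * (1 ⊗ₜ[k] D.F) =
      (D.K ⊗ₜ[k] 1) * (1 ⊗ₜ[k] (D.E * D.F)) := by
    rw [← diag₂_left D (fun s => (D.χ s)⁻¹), ← K_eq]
    simp
  have WY : (1 ⊗ₜ[k] D.F) * ((1 ⊗ₜ[k] D.E) * dg D.e₂ (fun p => (D.χ p.1)⁻¹)) =
      (D.K ⊗ₜ[k] 1) * (1 ⊗ₜ[k] (D.F * D.E)) := by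
    rw [← diag₂_left D (fun s => (D.χ s)⁻¹), ← K_eq]
    simp
  have h1 : (D.E * D.F) = D.F * D.E + (D.q - D.q⁻¹)⁻¹ • (D.K - D.Kinv) := by
    rw [← D.gen_rel.EF]; abel
  rw [comulGen_E, comulGen_F, add_mul, mul_add, mul_add, add_mul, mul_add, mul_add,
    XZ, ZX, XW, YZ, YW, WY]
  simp only [comulGen, Algebra.TensorProduct.tmul_mul_tmul, mul_one, one_mul]
  rw [h1]
  simp only [TensorProduct.add_tmul, TensorProduct.tmul_add, ← TensorProduct.smul_tmul',
    TensorProduct.tmul_smul, TensorProduct.sub_tmul, TensorProduct.tmul_sub, smul_sub]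
  abel

theorem comulGen_E_pow : D.comulGen .E ^ D.n = 0 := by
  have hc : ((1 ⊗ₜ[k] D.E) * dg D.e₂ (fun p => (D.χ p.1)⁻¹)) *
      ((D.E ⊗ₜ[k] 1) * dg D.e₂ (fun p => D.Φ₁ p.1 p.2)) =
      D.q ^ 2 • (((D.E ⊗ₜ[k] 1) * dg D.e₂ (fun p => D.Φ₁ p.1 p.2)) *
        ((1 ⊗ₜ[k] D.E) * dg D.e₂ (fun p => (D.χ p.1)⁻¹))) := by
    rw [D.idemFam₂.move D.shE1, D.idemFam₂.move D.shE2,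
      ← mul_smul_comm, ← dg_smul]
    congr 1
    · simp
    · congr 1; ext p
      simp [χ_dn, Φ₁_dn_right]; ring
  rw [comulGen_E, add_pow_root _ (NeZero.ne D.n) D.prim_q_sq _ _ hc]
  rw [D.idemFam₂.pow_eq_zero D.shE1 _ (D.tmul_one_pow _ D.gen_rel.E_pow),
    D.idemFam₂.pow_eq_zero D.shE2 _ (D.one_tmul_pow _ D.gen_rel.E_pow), add_zero]

theorem comulGen_F_pow : D.comulGen .F ^ D.n = 0 := by
  have hc : ((D.F ⊗ₜ[k] 1) * dg D.e₂ (fun p => D.Ψ p.1 p.2)) * (1 ⊗ₜ[k] D.F) =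
      D.q ^ 2 • ((1 ⊗ₜ[k] D.F) * ((D.F ⊗ₜ[k] 1) * dg D.e₂ (fun p => D.Ψ p.1 p.2))) := by
    rw [mul_assoc, sh₂F2, ← mul_assoc, ← mul_assoc, ← mul_smul_comm, ← dg_smul]
    congr 1
    · simp
    · congr 1; ext p
      simp [Ψ_up_right]
  rw [comulGen_F, add_comm, add_pow_root _ (NeZero.ne D.n) D.prim_q_sq _ _ hc]
  rw [D.idemFam₂.pow_eq_zero D.shF1 _ (D.tmul_one_pow _ D.gen_rel.F_pow),
    D.one_tmul_pow _ D.gen_rel.F_pow, add_zero]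

/-- The values on generators satisfy the relations, so that `Δ` is well defined. -/
theorem comulGen_rel : URel D.n D.q D.comulGen where
  K_Kinv := D.comulGen_K_mul_Kinv
  Kinv_K := D.comulGen_Kinv_mul_K
  KE := by
    rw [comulGen_KE, smul_mul_assoc, mul_assoc, comulGen_K_mul_Kinv, mul_one]
  KF := by
    rw [comulGen_KF, smul_mul_assoc, mul_assoc, comulGen_K_mul_Kinv, mul_one]
  EF := D.comulGen_EF
  E_pow := D.comulGen_E_pow
  F_pow := D.comulGen_F_pow
  K_pow := by
    rw [comulGen, Algebra.TensorProduct.tmul_pow, D.gen_rel.K_pow]; rfl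

theorem counitGen_rel : URel (B := k) D.n D.q (counitGen (k := k)) where
  K_Kinv := by simp [counitGen]
  Kinv_K := by simp [counitGen]
  KE := by simp [counitGen]
  KF := by simp [counitGen]
  EF := by simp [counitGen]
  E_pow := by simp [counitGen, NeZero.ne D.n]
  F_pow := by simp [counitGen, NeZero.ne D.n]
  K_pow := by simp [counitGen]

/-- The comultiplication `Δ`. -/
def comul : D.U →ₐ[k] D.U ⊗[k] D.U := D.lift D.comulGen D.comulGen_rel

/-- The counit `ε`. -/
def counit : D.U →ₐ[k] k := D.lift counitGen D.counitGen_rel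

end QData

namespace QData

variable {k : Type u} [Field k] (D : QData k)

theorem comul_gen (x : UGen) : D.comul (D.gen x) = D.comulGen x := D.lift_gen _ _ x

theorem counit_gen (x : UGen) : D.counit (D.gen x) = counitGen x := D.lift_gen _ _ x

theorem χ_orth (s t : ZMod D.m) :
    ((D.m : k)⁻¹) * ∑ r ∈ Finset.range D.m, D.χ s ^ r * ((D.χ t)⁻¹) ^ r =
      if t = s then 1 else 0 := by
  simp_rw [← mul_pow]
  split_ifs with h
  · subst h
    simp only [mul_inv_cancel₀ (D.χ_ne_zero t), one_pow, Finset.sum_const, Finset.card_range,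
      nsmul_eq_mul, mul_one, inv_mul_cancel₀ D.m_cast_ne_zero]
  · have hx : D.χ s * (D.χ t)⁻¹ ≠ 1 := fun h' => h (D.χ_inj (by
      rwa [mul_inv_eq_one₀ (D.χ_ne_zero t)] at h')).symm
    rw [geom_sum_eq hx, ← χ_sub, χ_pow_m, sub_self, zero_div, mul_zero]

theorem comul_K_pow (r : ℕ) :
    D.comul D.K ^ r = dg D.e₂ (fun p => ((D.χ (p.1 + p.2))⁻¹) ^ r) := by
  induction r with
  | zero =>
    simp only [pow_zero]
    exact (D.idemFam₂.dg_one (k := k)).symm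
  | succ r ih =>
    rw [pow_succ, ih, comul_gen, comulGen_K, D.idemFam₂.dg_mul]
    congr 1; ext p
    simp only [Pi.mul_apply, pow_succ]

theorem trΔ : Tr D.comul.toLinearMap D.idem D.e₂ (fun p => p.1 + p.2) := by
  intro s
  rw [idem_eq]
  simp only [AlgHom.toLinearMap_apply, map_smul, map_sum, map_pow]
  simp_rw [comul_K_pow, ← dg_smul]
  rw [← dg_sum, ← dg_smul]
  congr 1
  ext p
  simp only [Pi.smul_apply, Finset.sum_apply, smul_eq_mul]
  exact D.χ_orth s (p.1 + p.2)

theorem counit_idem (s : ZMod D.m) : D.counit (D.idem s) = if s = 0 then 1 else 0 := by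
  have h := D.χ_orth s 0
  rw [idem_eq]
  simp only [map_smul, map_sum, map_pow, counit_gen, counitGen, one_pow, smul_eq_mul, mul_one]
  simp only [χ_zero, inv_one, one_pow, mul_one] at h
  rw [h]
  simp [eq_comm]

/-- The algebra homomorphism `id ⊗ Δ`. -/
abbrev ΔR : D.U ⊗[k] D.U →ₐ[k] D.U ⊗[k] (D.U ⊗[k] D.U) :=
  Algebra.TensorProduct.map (AlgHom.id k D.U) D.comul

/-- The algebra homomorphism `Δ ⊗ id`, rebracketed. -/
abbrev ΔL : D.U ⊗[k] D.U →ₐ[k] D.U ⊗[k] (D.U ⊗[k] D.U) :=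
  (Algebra.TensorProduct.assoc k k k D.U D.U D.U).toAlgHom.comp
    (Algebra.TensorProduct.map D.comul (AlgHom.id k D.U))

theorem ΔR_dg (f : ZMod D.m × ZMod D.m → k) :
    D.ΔR (dg D.e₂ f) = dg D.e₃ (fun p => f (p.1, p.2.1 + p.2.2)) :=
  ((Tr.id D.idem).tensor D.trΔ).dg f

theorem ΔL_dg (f : ZMod D.m × ZMod D.m → k) :
    D.ΔL (dg D.e₂ f) = dg D.e₃ (fun p => f (p.1 + p.2.1, p.2.2)) :=
  ((D.trΔ.tensor (Tr.id D.idem)).comp (Tr.assoc D.idem D.idem D.idem)).dg f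

theorem diag₃_right (f : ZMod D.m × ZMod D.m → k) :
    (1 : D.U) ⊗ₜ[k] dg D.e₂ f = dg D.e₃ (fun p => f p.2) := by
  rw [one_eq, dg_tmul]; simp

theorem diag₃_left (f : ZMod D.m × ZMod D.m → k) :
    Algebra.TensorProduct.assoc k k k D.U D.U D.U (dg D.e₂ f ⊗ₜ[k] (1 : D.U)) =
      dg D.e₃ (fun p => f (p.1, p.2.1)) := by
  rw [one_eq, dg_tmul]
  have := (Tr.assoc (k := k) D.idem D.idem D.idem).dg
    (fun p : (ZMod D.m × ZMod D.m) × ZMod D.m => f p.1 * 1)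
  simpa using this

/-- `E ⊗ 1 ⊗ 1` and `F ⊗ 1 ⊗ 1`. -/
abbrev in₁ (x : D.U) : D.U ⊗[k] (D.U ⊗[k] D.U) := x ⊗ₜ[k] 1
/-- `1 ⊗ E ⊗ 1` and `1 ⊗ F ⊗ 1`. -/
abbrev in₂ (x : D.U) : D.U ⊗[k] (D.U ⊗[k] D.U) := 1 ⊗ₜ[k] (x ⊗ₜ[k] 1)
/-- `1 ⊗ 1 ⊗ E` and `1 ⊗ 1 ⊗ F`. -/
abbrev in₃ (x : D.U) : D.U ⊗[k] (D.U ⊗[k] D.U) := 1 ⊗ₜ[k] (1 ⊗ₜ[k] x)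

theorem ΔR_left (x : D.U) : D.ΔR (x ⊗ₜ[k] 1) = D.in₁ x := by
  simp [ΔR]

theorem ΔR_right (x : D.U) : D.ΔR (1 ⊗ₜ[k] x) = 1 ⊗ₜ[k] D.comul x := by
  simp [ΔR]

theorem ΔL_right (x : D.U) : D.ΔL (1 ⊗ₜ[k] x) = D.in₃ x := by
  simp [ΔL, Algebra.TensorProduct.one_def]

theorem ΔL_left (x : D.U) : D.ΔL (x ⊗ₜ[k] 1) =
    Algebra.TensorProduct.assoc k k k D.U D.U D.U (D.comul x ⊗ₜ[k] (1 : D.U)) := by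
  simp [ΔL]

theorem ins_right (x y : D.U ⊗[k] D.U) :
    (1 : D.U) ⊗ₜ[k] (x * y) = (1 ⊗ₜ[k] x) * (1 ⊗ₜ[k] y : D.U ⊗[k] (D.U ⊗[k] D.U)) := by
  simp

theorem ins_left (x y : D.U ⊗[k] D.U) :
    Algebra.TensorProduct.assoc k k k D.U D.U D.U ((x * y) ⊗ₜ[k] (1 : D.U)) =
    Algebra.TensorProduct.assoc k k k D.U D.U D.U (x ⊗ₜ[k] (1 : D.U)) *
      Algebra.TensorProduct.assoc k k k D.U D.U D.U (y ⊗ₜ[k] (1 : D.U)) := by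
  rw [← map_mul]; simp

theorem ΔRE : D.ΔR (D.comul D.E) =
    D.in₁ D.E * dg D.e₃ (fun p => D.Φ₁ p.1 (p.2.1 + p.2.2)) +
    (D.in₂ D.E * dg D.e₃ (fun p => D.Φ₁ p.2.1 p.2.2 * (D.χ p.1)⁻¹) +
    D.in₃ D.E * dg D.e₃ (fun p => (D.χ p.2.1)⁻¹ * (D.χ p.1)⁻¹)) := by
  rw [comul_gen, comulGen_E, map_add, map_mul, map_mul, ΔR_dg, ΔR_dg, ΔR_left, ΔR_right,
    comul_gen, comulGen_E, TensorProduct.tmul_add, ins_right, ins_right, diag₃_right, diag₃_right,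
    add_mul, mul_assoc, mul_assoc, D.idemFam₃.dg_mul, D.idemFam₃.dg_mul]
  rfl

theorem ΔRF : D.ΔR (D.comul D.F) =
    D.in₁ D.F * dg D.e₃ (fun p => D.Ψ p.1 (p.2.1 + p.2.2)) +
    (D.in₂ D.F * dg D.e₃ (fun p => D.Ψ p.2.1 p.2.2) + D.in₃ D.F) := by
  rw [comul_gen, comulGen_F, map_add, map_mul, ΔR_dg, ΔR_left, ΔR_right,
    comul_gen, comulGen_F, TensorProduct.tmul_add, ins_right, diag₃_right]

theorem ΔLE : D.ΔL (D.comul D.E) =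
    D.in₁ D.E * dg D.e₃ (fun p => D.Φ₁ p.1 p.2.1 * D.Φ₁ (p.1 + p.2.1) p.2.2) +
    (D.in₂ D.E * dg D.e₃ (fun p => (D.χ p.1)⁻¹ * D.Φ₁ (p.1 + p.2.1) p.2.2) +
    D.in₃ D.E * dg D.e₃ (fun p => (D.χ (p.1 + p.2.1))⁻¹)) := by
  rw [comul_gen, comulGen_E, map_add, map_mul, map_mul, ΔL_dg, ΔL_dg, ΔL_left, ΔL_right,
    comul_gen, comulGen_E, TensorProduct.add_tmul, map_add, ins_left, ins_left, diag₃_left,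
    diag₃_left, add_mul, mul_assoc, mul_assoc, D.idemFam₃.dg_mul, D.idemFam₃.dg_mul, add_assoc]
  rfl

theorem ΔLF : D.ΔL (D.comul D.F) =
    D.in₁ D.F * dg D.e₃ (fun p => D.Ψ p.1 p.2.1 * D.Ψ (p.1 + p.2.1) p.2.2) +
    (D.in₂ D.F * dg D.e₃ (fun p => D.Ψ (p.1 + p.2.1) p.2.2) + D.in₃ D.F) := by
  rw [comul_gen, comulGen_F, map_add, map_mul, ΔL_dg, ΔL_left, ΔL_right,
    comul_gen, comulGen_F, TensorProduct.add_tmul, map_add, ins_left, diag₃_left, add_mul,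
    mul_assoc, D.idemFam₃.dg_mul, add_assoc]
  rfl

theorem sh₁ {x : D.U} {σ : ZMod D.m ≃ ZMod D.m} (h : Sh D.idem x σ) :
    Sh D.e₃ (D.in₁ x) (σ.prodCongr (Equiv.refl _)) :=
  h.tmul (Sh.one D.e₂)

theorem sh₂ {x : D.U} {σ : ZMod D.m ≃ ZMod D.m} (h : Sh D.idem x σ) :
    Sh D.e₃ (D.in₂ x) ((Equiv.refl _).prodCongr (σ.prodCongr (Equiv.refl _))) :=
  (Sh.one D.idem).tmul (h.tmul (Sh.one D.idem))

theorem sh₃ {x : D.U} {σ : ZMod D.m ≃ ZMod D.m} (h : Sh D.idem x σ) :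
    Sh D.e₃ (D.in₃ x) ((Equiv.refl _).prodCongr ((Equiv.refl _).prodCongr σ)) :=
  (Sh.one D.idem).tmul ((Sh.one D.idem).tmul h)

/-- The associator `Φ = ∑ φ(f,g,h) 1_f ⊗ 1_g ⊗ 1_h`. -/
def assocElt : D.U ⊗[k] (D.U ⊗[k] D.U) := dg D.e₃ (fun p => D.cocycle p.1 p.2.1 p.2.2)

/-- The inverse of the associator. -/
def assocInv : D.U ⊗[k] (D.U ⊗[k] D.U) := dg D.e₃ (fun p => (D.cocycle p.1 p.2.1 p.2.2)⁻¹)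

theorem cocycle_ne_zero (a b c : ZMod D.m) : D.cocycle a b c ≠ 0 := by
  rw [cocycle_eq]; exact pow_ne_zero _ (D.L_ne_zero c)

/-- The associator as a unit. -/
def assocUnit : (D.U ⊗[k] (D.U ⊗[k] D.U))ˣ where
  val := D.assocElt
  inv := D.assocInv
  val_inv := by
    rw [assocElt, assocInv, D.idemFam₃.dg_mul, ← D.idemFam₃.dg_one (k := k)]
    congr 1; ext p; simp [D.cocycle_ne_zero]
  inv_val := by
    rw [assocElt, assocInv, D.idemFam₃.dg_mul, ← D.idemFam₃.dg_one (k := k)]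
    congr 1; ext p; simp [D.cocycle_ne_zero]

theorem carry_dn_right (s t : ZMod D.m) :
    D.lo t + D.carry s t = D.carry s (D.dn t) + D.lo (s + t) := by
  rw [carry_comm D s t, carry_comm D s (D.dn t), carry_dn, add_comm s t]

/-- Moving a diagonal element past a shifting factor on both sides. -/
theorem move₃ {x : D.U ⊗[k] (D.U ⊗[k] D.U)} {σ} (h : Sh D.e₃ x σ)
    (φ f g : ZMod D.m × ZMod D.m × ZMod D.m → k) (e : ∀ p, f p * φ p = φ (σ p) * g p) :
    x * dg D.e₃ f * dg D.e₃ φ = dg D.e₃ φ * (x * dg D.e₃ g) := by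
  rw [mul_assoc, D.idemFam₃.dg_mul, ← mul_assoc, h.dg, mul_assoc, D.idemFam₃.dg_mul]
  congr 2; ext p; exact e p

theorem coassoc_E : D.ΔR (D.comul D.E) * D.assocElt = D.assocElt * D.ΔL (D.comul D.E) := by
  rw [ΔRE, ΔLE, add_mul, add_mul, mul_add, mul_add, assocElt]
  refine congrArg₂ _ (D.move₃ (D.sh₁ D.shE) _ _ _ ?_) (congrArg₂ _
    (D.move₃ (D.sh₂ D.shE) _ _ _ ?_) (D.move₃ (D.sh₃ D.shE) _ _ _ ?_))
  · rintro ⟨a, b, c⟩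
    have h := congrArg (D.L c ^ ·) (D.carry_dn a b)
    simp only [pow_add] at h
    simp only [Φ₁_eq, cocycle_eq, L_add, mul_pow, Equiv.prodCongr_apply, Prod.map]
    simp only [Equiv.refl_apply]
    linear_combination D.L b ^ D.lo a * h
  · rintro ⟨a, b, c⟩
    have h := congrArg (D.L c ^ ·) (D.carry_dn_right a b)
    simp only [pow_add] at h
    simp only [Φ₁_eq, cocycle_eq, Equiv.prodCongr_apply, Prod.map]
    simp only [Equiv.refl_apply]
    linear_combination (D.χ a)⁻¹ * h
  · rintro ⟨a, b, c⟩
    simp only [cocycle_eq, Equiv.prodCongr_apply, Prod.map, L_dn, χ_add, mul_inv]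
    simp only [Equiv.refl_apply]
    ring

theorem coassoc_F : D.ΔR (D.comul D.F) * D.assocElt = D.assocElt * D.ΔL (D.comul D.F) := by
  rw [ΔRF, ΔLF, add_mul, add_mul, mul_add, mul_add, assocElt]
  refine congrArg₂ _ (D.move₃ (D.sh₁ D.shF) _ _ _ ?_) (congrArg₂ _
    (D.move₃ (D.sh₂ D.shF) _ _ _ ?_) ?_)
  · rintro ⟨a, b, c⟩
    have h := congrArg (D.L c ^ ·) (D.carry_dn (D.up a) b)
    simp only [pow_add, dn_up, up_add] at h
    simp only [Ψ, Φ₂_eq, cocycle_eq, L_add, χ_add, mul_pow, Equiv.prodCongr_apply, Prod.map]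
    simp only [Equiv.refl_apply]
    have h1 := pow_ne_zero (D.lo (D.up a)) (D.L_ne_zero c)
    have h2 := pow_ne_zero (D.lo (D.up (a + b))) (D.L_ne_zero c)
    have h3 := pow_ne_zero (D.lo (D.up a)) (D.L_ne_zero b)
    field_simp
    linear_combination -(D.χ b * D.χ c) * h
  · rintro ⟨a, b, c⟩
    have h := congrArg (D.L c ^ ·) (D.carry_dn_right a (D.up b))
    simp only [pow_add, dn_up, add_up] at h
    simp only [Ψ, Φ₂_eq, cocycle_eq, Equiv.prodCongr_apply, Prod.map]
    simp only [Equiv.refl_apply]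
    have h1 := pow_ne_zero (D.lo (D.up b)) (D.L_ne_zero c)
    have h2 := pow_ne_zero (D.lo (D.up (a + b))) (D.L_ne_zero c)
    field_simp
    linear_combination -D.χ c * h
  · rw [(D.sh₃ D.shF).dg]
    congr 2; ext ⟨a, b, c⟩
    simp [cocycle_eq, L_up]

theorem coassoc_diag (f : ZMod D.m → k) :
    D.ΔR (dg D.e₂ (fun p => f (p.1 + p.2))) * D.assocElt =
      D.assocElt * D.ΔL (dg D.e₂ (fun p => f (p.1 + p.2))) := by
  rw [ΔR_dg, ΔL_dg, assocElt, D.idemFam₃.dg_mul, D.idemFam₃.dg_mul]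
  congr 1; ext ⟨a, b, c⟩
  simp [add_assoc, mul_comm]

theorem coassoc (h : D.U) : D.ΔR (D.comul h) * D.assocElt = D.assocElt * D.ΔL (D.comul h) := by
  induction h using D.U_induction with
  | halg c => simp only [AlgHom.commutes]; exact (Algebra.commutes _ _)
  | hgen x =>
    cases x with
    | E => exact D.coassoc_E
    | F => exact D.coassoc_F
    | K => rw [comul_gen, comulGen_K]; exact D.coassoc_diag (fun s => (D.χ s)⁻¹)
    | Kinv => rw [comul_gen, comulGen_Kinv]; exact D.coassoc_diag D.χ
  | hadd a b ha hb => simp only [map_add, add_mul, mul_add, ha, hb]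
  | hmul a b ha hb => simp only [map_mul]; rw [mul_assoc, hb, ← mul_assoc, ha, mul_assoc]

/-- The linear map `ε ⊗ id`, followed by the identification `k ⊗ A = A`. -/
abbrev εL (A : Type u) [Ring A] [Algebra k A] : D.U ⊗[k] A →ₐ[k] A :=
  (Algebra.TensorProduct.lid k A).toAlgHom.comp (Algebra.TensorProduct.map D.counit (AlgHom.id k A))

/-- The linear map `id ⊗ ε`, followed by the identification `A ⊗ k = A`. -/
abbrev εR : D.U ⊗[k] D.U →ₐ[k] D.U :=
  (Algebra.TensorProduct.rid k k D.U).toAlgHom.comp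
    (Algebra.TensorProduct.map (AlgHom.id k D.U) D.counit)

theorem trεL {A : Type u} [Ring A] [Algebra k A] {ι : Type} [Fintype ι] [DecidableEq ι]
    (e : ι → A) : Tr (D.εL A).toLinearMap (fam k D.idem e) e (fun i => (0, i)) := by
  rintro ⟨s, i⟩
  by_cases h : s = 0
  · subst h
    simpa [fam, counit_idem] using (dg_delta (k := k) e i).symm
  · have h' : ¬ (0 = s) := fun h' => h h'.symm
    simp [fam, counit_idem, h, h', dg]

theorem trεR : Tr D.εR.toLinearMap D.e₂ D.idem (fun i => (i, 0)) := by
  rintro ⟨i, s⟩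
  by_cases h : s = 0
  · subst h
    simpa [fam, counit_idem] using (dg_delta (k := k) D.idem i).symm
  · have h' : ¬ (0 = s) := fun h' => h h'.symm
    simp [fam, counit_idem, h, h', dg]

theorem lo_zero : D.lo 0 = 1 := by
  rw [lo, if_pos]
  have := D.two_lt
  rw [ZMod.val_zero]; omega

theorem counit_left (h : D.U) : D.εL D.U (D.comul h) = h := by
  induction h using D.U_induction with
  | halg c => simp only [AlgHom.commutes]
  | hgen x =>
    rw [comul_gen]
    cases x with
    | E =>
      rw [comulGen_E, map_add, map_mul, map_mul]
      rw [show D.εL D.U (dg D.e₂ fun p => (D.χ p.1)⁻¹) = 1 by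
        rw [← AlgHom.toLinearMap_apply, (D.trεL D.idem).dg, D.one_eq]
        simp [χ_zero]]
      simp [counit_gen, counitGen]
    | F =>
      rw [comulGen_F, map_add, map_mul]
      simp [counit_gen, counitGen]
    | K => simp [comulGen, counit_gen, counitGen]
    | Kinv => simp [comulGen, counit_gen, counitGen]
  | hadd a b ha hb => rw [map_add, map_add, ha, hb]
  | hmul a b ha hb => rw [map_mul, map_mul, ha, hb]

theorem counit_right (h : D.U) : D.εR (D.comul h) = h := by
  induction h using D.U_induction with
  | halg c => simp only [AlgHom.commutes]
  | hgen x =>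
    rw [comul_gen]
    cases x with
    | E =>
      rw [comulGen_E, map_add, map_mul, map_mul]
      rw [show D.εR (dg D.e₂ fun p => D.Φ₁ p.1 p.2) = 1 by
        rw [← AlgHom.toLinearMap_apply, D.trεR.dg, D.one_eq]
        simp [Φ₁_eq, L_zero]]
      simp [counit_gen, counitGen]
    | F =>
      rw [comulGen_F, map_add, map_mul]
      rw [show D.εR (dg D.e₂ fun p => D.Ψ p.1 p.2) = 1 by
        rw [← AlgHom.toLinearMap_apply, D.trεR.dg, D.one_eq]
        simp [Ψ, Φ₂_eq, L_zero, χ_zero]]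
      simp [counit_gen, counitGen]
    | K => simp [comulGen, counit_gen, counitGen]
    | Kinv => simp [comulGen, counit_gen, counitGen]
  | hadd a b ha hb => rw [map_add, map_add, ha, hb]
  | hmul a b ha hb => rw [map_mul, map_mul, ha, hb]

theorem carry_zero_left (s : ZMod D.m) : D.carry 0 s = 0 := by
  rw [carry, ZMod.val_zero, zero_add, Nat.div_eq_of_lt (ZMod.val_lt s)]

theorem carry_zero_right (s : ZMod D.m) : D.carry s 0 = 0 := by rw [carry_comm, carry_zero_left]

theorem assoc_counit : Algebra.TensorProduct.map (AlgHom.id k D.U) (D.εL D.U) D.assocElt = 1 := by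
  have := ((Tr.id D.idem).tensor (D.trεL D.idem)).dg
    (fun p : ZMod D.m × ZMod D.m × ZMod D.m => D.cocycle p.1 p.2.1 p.2.2)
  refine this.trans ?_
  rw [← D.idemFam₂.dg_one (k := k)]
  congr 1; ext p
  simp [cocycle_eq, carry_zero_right]

theorem pentagon :
    Algebra.TensorProduct.map (AlgHom.id k D.U) D.ΔR D.assocElt *
      Algebra.TensorProduct.assoc k k k D.U D.U (D.U ⊗[k] D.U)
        (Algebra.TensorProduct.map D.comul (AlgHom.id k (D.U ⊗[k] D.U)) D.assocElt) =
    ((1 : D.U) ⊗ₜ[k] D.assocElt) *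
      Algebra.TensorProduct.map (AlgHom.id k D.U) D.ΔL D.assocElt *
      Algebra.TensorProduct.map (AlgHom.id k D.U)
        (Algebra.TensorProduct.assoc k k k D.U D.U D.U).toAlgHom
        (Algebra.TensorProduct.assoc k k k D.U (D.U ⊗[k] D.U) D.U
          (D.assocElt ⊗ₜ[k] (1 : D.U))) := by
  have h4 : IdemFam (fam k D.idem D.e₃) := D.idemFam.fam D.idemFam₃
  have e1 := ((Tr.id D.idem).tensor ((Tr.id D.idem).tensor D.trΔ)).dg
    (fun p : ZMod D.m × ZMod D.m × ZMod D.m => D.cocycle p.1 p.2.1 p.2.2)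
  have e2 := ((D.trΔ.tensor (Tr.id D.e₂)).comp (Tr.assoc D.idem D.idem D.e₂)).dg
    (fun p : ZMod D.m × ZMod D.m × ZMod D.m => D.cocycle p.1 p.2.1 p.2.2)
  have e3 : (1 : D.U) ⊗ₜ[k] D.assocElt = dg (fam k D.idem D.e₃)
      (fun p => D.cocycle p.2.1 p.2.2.1 p.2.2.2) := by
    rw [one_eq, assocElt, dg_tmul]; simp
  have e4 := ((Tr.id D.idem).tensor ((D.trΔ.tensor (Tr.id D.idem)).comp
    (Tr.assoc D.idem D.idem D.idem))).dg
    (fun p : ZMod D.m × ZMod D.m × ZMod D.m => D.cocycle p.1 p.2.1 p.2.2)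
  have e5 := ((Tr.assoc (k := k) D.idem D.e₂ D.idem).comp ((Tr.id D.idem).tensor
    (Tr.assoc D.idem D.idem D.idem))).dg
    (fun p : (ZMod D.m × ZMod D.m × ZMod D.m) × ZMod D.m =>
      D.cocycle p.1.1 p.1.2.1 p.1.2.2 * 1)
  have e6 : D.assocElt ⊗ₜ[k] (1 : D.U) = dg (fam k D.e₃ D.idem)
      (fun p => D.cocycle p.1.1 p.1.2.1 p.1.2.2 * 1) := by
    rw [one_eq, assocElt, dg_tmul]
  rw [← e6] at e5
  refine (congrArg₂ (· * ·) e1 e2).trans (Eq.trans ?_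
    (congrArg₂ (· * ·) (congrArg₂ (· * ·) e3 e4) e5).symm)
  dsimp only
  rw [h4.dg_mul, h4.dg_mul, h4.dg_mul]
  congr 1; ext ⟨a, b, c, d⟩
  have h := congrArg (D.L d ^ ·) (D.carry_assoc a b c)
  simp only [pow_add] at h
  simp only [Pi.mul_apply, cocycle_eq, L_add, mul_pow]
  linear_combination (D.L c ^ D.carry a b) * h

/-- The small quasi-quantum group `Ũ_q` as a quasi-bialgebra. -/
def quasi : QuasiBialgebra k D.U where
  comul := D.comul
  counit := D.counit
  assoc := D.assocUnit
  counit_left := D.counit_left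
  counit_right := D.counit_right
  quasi_coassoc := D.coassoc
  pentagon := D.pentagon
  assoc_counit := D.assoc_counit

end QData

/-! ### The simple modules `V₂` and `𝐕(t, r)` -/

namespace QData

variable {k : Type u} [Field k] (D : QData k)

/-- The matrix with `v_j ↦ v_(j+1)` (and `v_(d-1) ↦ 0`), for the basis `v_0, …, v_(d-1)`. -/
def matE (k : Type u) [Field k] (d : ℕ) : Matrix (Fin d) (Fin d) k :=
  Matrix.of fun i j => if i.val = j.val + 1 then 1 else 0

/-- The matrix with `v_j ↦ γ_j v_(j-1)` (and `v_0 ↦ 0`). -/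
def matF {k : Type u} [Field k] (d : ℕ) (γ : ℕ → k) : Matrix (Fin d) (Fin d) k :=
  Matrix.of fun i j => if i.val + 1 = j.val then γ j.val else 0

/-- The matrix with `v_j ↦ λ q^(2j) v_j`. -/
def matK (d : ℕ) (lam : k) : Matrix (Fin d) (Fin d) k :=
  Matrix.diagonal fun j => lam * D.q ^ (2 * j.val)

/-- The inverse of `matK`. -/
def matKinv (d : ℕ) (lam : k) : Matrix (Fin d) (Fin d) k :=
  Matrix.diagonal fun j => (lam * D.q ^ (2 * j.val))⁻¹

/-- The matrices by which the generators act. -/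
def mats (d : ℕ) (lam : k) (γ : ℕ → k) : UGen → Matrix (Fin d) (Fin d) k
  | .E => matE k d
  | .F => matF d γ
  | .K => D.matK d lam
  | .Kinv => D.matKinv d lam

theorem matE_mul_matF (d : ℕ) (γ : ℕ → k) (h0 : γ 0 = 0) :
    matE k d * matF d γ = Matrix.diagonal fun j : Fin d => γ j.val := by
  ext i j
  rw [Matrix.mul_apply, Matrix.diagonal_apply]
  simp only [matE, matF, Matrix.of_apply]
  rcases Nat.eq_zero_or_pos i.val with hi | hi
  · rw [Finset.sum_eq_zero]
    · split_ifs with h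
      · rw [hi, h0]
      · rfl
    · intro l _
      rw [if_neg (by omega), zero_mul]
  · rw [Finset.sum_eq_single (⟨i.val - 1, by omega⟩ : Fin d)]
    · simp only [Nat.sub_add_cancel hi, if_true, one_mul]
      by_cases h : i = j
      · subst h; simp
      · rw [if_neg h, if_neg (fun h' => h (Fin.ext h'))]
    · intro l _ hl
      rw [if_neg (fun h => hl (Fin.ext (by simp only; omega))), zero_mul]
    · simp

theorem matF_mul_matE (d : ℕ) (γ : ℕ → k) (h0 : γ d = 0) :
    matF d γ * matE k d = Matrix.diagonal fun j : Fin d => γ (j.val + 1) := by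
  ext i j
  rw [Matrix.mul_apply, Matrix.diagonal_apply]
  simp only [matE, matF, Matrix.of_apply]
  by_cases hi : i.val + 1 < d
  · rw [Finset.sum_eq_single (⟨i.val + 1, hi⟩ : Fin d)]
    · by_cases h : i = j
      · subst h; simp
      · rw [if_neg h, if_neg (c := _ = j.val + 1)
          (fun h' => h (Fin.ext (by simpa using h'))), mul_zero]
    · intro l _ hl
      rw [if_neg (fun h => hl (Fin.ext (by simp only; omega))), zero_mul]
    · simp
  · rw [Finset.sum_eq_zero]
    · split_ifs with h
      · rw [show i.val + 1 = d by omega, h0]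
      · rfl
    · intro l _
      rw [if_neg (by omega), zero_mul]

theorem matE_pow (d N : ℕ) :
    matE k d ^ N = Matrix.of fun i j => if i.val = j.val + N then 1 else 0 := by
  induction N with
  | zero =>
    ext i j
    simp [Matrix.one_apply, Fin.ext_iff]
  | succ N ih =>
    ext i j
    rw [pow_succ', ih, Matrix.mul_apply]
    simp only [matE, Matrix.of_apply]
    by_cases h : i.val = j.val + (N + 1)
    · rw [if_pos h, Finset.sum_eq_single (⟨i.val - 1, by omega⟩ : Fin d)]
      · rw [if_pos (by simp only; omega), if_pos (by simp only; omega), one_mul]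
      · intro l _ hl
        rw [if_neg (fun h => hl (Fin.ext (by simp only; omega))), zero_mul]
      · simp
    · rw [if_neg h]
      refine Finset.sum_eq_zero fun l _ => ?_
      by_cases h1 : i.val = l.val + 1
      · rw [if_neg (c := l.val = _) (by omega), mul_zero]
      · rw [if_neg h1, zero_mul]

theorem matF_pow (d N : ℕ) (γ : ℕ → k) (i j : Fin d) (h : i.val + N ≠ j.val) :
    (matF d γ ^ N) i j = 0 := by
  induction N generalizing i with
  | zero => rw [pow_zero, Matrix.one_apply_ne (fun h' => h (by simp [h']))]
  | succ N ih =>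
    rw [pow_succ', Matrix.mul_apply]
    refine Finset.sum_eq_zero fun l _ => ?_
    by_cases h1 : i.val + 1 = l.val
    · rw [ih l (by omega), mul_zero]
    · simp [matF, h1]

theorem mats_rel (d : ℕ) (hd : d ≤ D.n) (lam : k) (γ : ℕ → k) (hl0 : lam ≠ 0)
    (hl : lam ^ D.n ^ 2 = 1) (h0 : γ 0 = 0) (h1 : γ d = 0)
    (h : ∀ j < d, γ j - γ (j + 1) =
      (D.q - D.q⁻¹)⁻¹ * (lam * D.q ^ (2 * j) - (lam * D.q ^ (2 * j))⁻¹)) :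
    URel D.n D.q (D.mats d lam γ) := by
  have hq := D.q_ne_zero
  constructor
  · simp only [mats, matK, matKinv, Matrix.diagonal_mul_diagonal]
    rw [← Matrix.diagonal_one]; congr 1; ext j
    exact mul_inv_cancel₀ (mul_ne_zero hl0 (pow_ne_zero _ hq))
  · simp only [mats, matK, matKinv, Matrix.diagonal_mul_diagonal]
    rw [← Matrix.diagonal_one]; congr 1; ext j
    exact inv_mul_cancel₀ (mul_ne_zero hl0 (pow_ne_zero _ hq))
  · ext i j
    simp only [mats, matK, matKinv, Matrix.diagonal_mul, Matrix.mul_diagonal, Matrix.smul_apply,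
      matE, Matrix.of_apply, smul_eq_mul]
    split_ifs with hij
    · rw [hij]; field_simp; ring
    · simp
  · ext i j
    simp only [mats, matK, matKinv, Matrix.diagonal_mul, Matrix.mul_diagonal, Matrix.smul_apply,
      matF, Matrix.of_apply, smul_eq_mul]
    split_ifs with hij
    · rw [← hij]; field_simp; ring
    · simp
  · simp only [mats, matE_mul_matF d γ h0, matF_mul_matE d γ h1, matK, matKinv,
      Matrix.diagonal_sub]
    rw [← Matrix.diagonal_smul]
    congr 1; ext j
    exact h j.val j.isLt
  · simp only [mats, matE_pow]
    ext i j
    rw [Matrix.of_apply, if_neg (by omega)]; rfl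
  · ext i j
    exact matF_pow d D.n γ i j (by omega)
  · simp only [mats, matK, Matrix.diagonal_pow]
    rw [← Matrix.diagonal_one]; congr 1; ext j
    simp only [Pi.pow_apply, mul_pow, hl, one_mul]
    rw [← pow_mul, show 2 * j.val * D.n ^ 2 = D.n * (2 * j.val * D.n) by ring, pow_mul,
      D.q_pow_n, one_pow]

/-- The module with basis `v_0, …, v_(d-1)` and `E v_j = v_(j+1)`, `F v_j = γ_j v_(j-1)`,
`K v_j = λ q^(2j) v_j`. -/
def chain (d : ℕ) (lam : k) (γ : ℕ → k) (h : URel D.n D.q (D.mats d lam γ)) : FDMod k D.U where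
  carrier := Fin d → k
  act := (Matrix.toLinAlgEquiv' : Matrix (Fin d) (Fin d) k ≃ₐ[k] _).toAlgHom.comp (D.lift _ h)

theorem chain_gen (d : ℕ) (lam : k) (γ : ℕ → k) (h : URel D.n D.q (D.mats d lam γ)) (x : UGen)
    (v : Fin d → k) : (D.chain d lam γ h).act (D.gen x) v = (D.mats d lam γ x).mulVec v := by
  change Matrix.toLinAlgEquiv' (D.lift _ h (D.gen x)) v = _
  rw [lift_gen]; rfl

theorem V₂_rel :
    URel D.n D.q (D.mats 2 D.q⁻¹ (fun j => if j = 1 then 1 else 0)) := by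
  have hq := D.q_ne_zero
  have hq1 := D.q_sub_inv_ne_zero
  refine D.mats_rel 2 D.two_lt.le _ _ (inv_ne_zero hq) ?_ (by simp) (by simp) ?_
  · rw [inv_pow, sq, pow_mul, D.q_pow_n, one_pow, inv_one]
  · intro j hj
    have e : D.q⁻¹ * D.q ^ 2 = D.q := by field_simp
    rcases (show j = 0 ∨ j = 1 by omega) with rfl | rfl
    · rw [mul_zero, pow_zero, mul_one, inv_inv, ← neg_sub D.q, mul_neg, inv_mul_cancel₀ hq1]
      simp
    · rw [mul_one, e, inv_mul_cancel₀ hq1]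
      simp

/-- The simple module `V₂` of dimension `2`: with basis `m₁, m₂`,
`E m₁ = m₂`, `E m₂ = 0`, `F m₁ = 0`, `F m₂ = m₁`, `K m₁ = q⁻¹ m₁`, `K m₂ = q m₂`. -/
def V₂ : FDMod k D.U := D.chain 2 D.q⁻¹ (fun j => if j = 1 then 1 else 0) D.V₂_rel

/-- The scalars `γ_j` of the module `𝐕(t, r)`. -/
def γ (t r j : ℕ) : k :=
  (D.q - D.q⁻¹)⁻¹ *
    ((D.bq ^ t)⁻¹ * (((D.q ^ (2 * r))⁻¹ - (D.q ^ (2 * (r + j)))⁻¹) / (1 - (D.q ^ 2)⁻¹)) -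
      D.bq ^ t * ((D.q ^ (2 * r) - D.q ^ (2 * (r + j))) / (1 - D.q ^ 2)))

theorem VV_rel (t r : ℕ) :
    URel D.n D.q (D.mats D.n (D.bq ^ t * D.q ^ (2 * r)) (D.γ t r)) := by
  have hq := D.q_ne_zero
  have hb := pow_ne_zero t D.bq_ne_zero
  have h1 : 1 - D.q ^ 2 ≠ 0 := fun h => D.q_sq_ne_one (sub_eq_zero.mp h).symm
  have h2 : 1 - (D.q ^ 2)⁻¹ ≠ 0 := fun h =>
    D.q_sq_ne_one (inv_eq_one.mp (sub_eq_zero.mp h).symm)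
  have hn : D.q ^ (2 * (r + D.n)) = D.q ^ (2 * r) := by
    rw [mul_add, pow_add, mul_comm 2 D.n, pow_mul D.q D.n, D.q_pow_n, one_pow, mul_one]
  refine D.mats_rel D.n le_rfl _ _ (mul_ne_zero hb (pow_ne_zero _ hq)) ?_ ?_ ?_ ?_
  · rw [mul_pow, ← pow_mul, mul_comm t, pow_mul, show D.bq ^ D.n ^ 2 = 1 from D.bq_pow_m,
      one_pow, one_mul, ← pow_mul, show 2 * r * D.n ^ 2 = D.n * (2 * r * D.n) by ring, pow_mul,
      D.q_pow_n, one_pow]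
  · simp [γ]
  · simp [γ, hn]
  · intro j _
    rw [γ, γ, ← mul_sub]
    congr 1
    have e1 : D.q ^ (2 * (r + (j + 1))) = D.q ^ (2 * (r + j)) * D.q ^ 2 := by
      rw [← pow_add]; congr 1
    have e2 : D.bq ^ t * D.q ^ (2 * r) * D.q ^ (2 * j) = D.bq ^ t * D.q ^ (2 * (r + j)) := by
      rw [mul_assoc, ← pow_add, mul_add]
    rw [e1, e2]
    have hP := pow_ne_zero (2 * (r + j)) hq
    generalize D.q ^ (2 * (r + j)) = P at hP ⊢
    have a1 : ((D.q ^ (2 * r))⁻¹ - P⁻¹) / (1 - (D.q ^ 2)⁻¹) -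
        ((D.q ^ (2 * r))⁻¹ - (P * D.q ^ 2)⁻¹) / (1 - (D.q ^ 2)⁻¹) = -P⁻¹ := by
      rw [← sub_div, div_eq_iff h2, mul_inv]; ring
    have a2 : (D.q ^ (2 * r) - P) / (1 - D.q ^ 2) -
        (D.q ^ (2 * r) - P * D.q ^ 2) / (1 - D.q ^ 2) = -P := by
      rw [← sub_div, div_eq_iff h1]; ring
    rw [mul_inv]
    linear_combination (D.bq ^ t)⁻¹ * a1 - D.bq ^ t * a2

/-- The simple module `𝐕(t, r)` of dimension `n`: with basis `v_1, …, v_n` (here indexed from `0`),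
`E v_i = v_(i+1)`, `F v_i = γ_(i-1) v_(i-1)`, `K v_i = 𝐪^t q^(2(r+i-1)) v_i`. -/
def VV (t r : ℕ) : FDMod k D.U :=
  D.chain D.n (D.bq ^ t * D.q ^ (2 * r)) (D.γ t r) (D.VV_rel t r)

end QData

/-! ### The polynomial presentation -/

namespace PCR

/-- The index set `{1, …, n - 1}`. -/
abbrev Idx (n : ℕ) : Type := Finset.Icc 1 (n - 1)

/-- The set of variables `X' = {y, x_t, ε_t | 1 ≤ t ≤ n - 1}`. -/
inductive Var (n : ℕ) : Type
  | y : Var n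
  | x (t : Idx n) : Var n
  | ε (t : Idx n) : Var n

/-- The polynomial ring `ℤ[X']`. -/
abbrev Poly (n : ℕ) : Type := MvPolynomial (Var n) ℤ

/-- The number `N/(N-i) * (N-i choose i)`, which is an integer for `2i ≤ N`, `N > 0`. -/
def lucas (N i : ℕ) : ℤ := ((N * (N - i).choose i / (N - i) : ℕ) : ℤ)

theorem lucas_dvd (N i : ℕ) (h : 2 * i ≤ N) : (N - i) ∣ N * (N - i).choose i := by
  obtain ⟨M, rfl⟩ := Nat.exists_eq_add_of_le' (show i ≤ N by omega)
  rw [Nat.add_sub_cancel]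
  cases i with
  | zero => simp
  | succ i =>
    cases M with
    | zero => omega
    | succ M =>
      rw [add_mul]
      refine dvd_add (Dvd.intro _ rfl) ?_
      refine ⟨M.choose i, ?_⟩
      rw [mul_comm (i + 1), ← Nat.add_one_mul_choose_eq]

/-- The defining property of `lucas`. -/
theorem lucas_spec (N i : ℕ) (h : 2 * i ≤ N) (hN : 0 < N) :
    (lucas N i : ℚ) = (N : ℚ) / ((N : ℚ) - i) * ((N - i).choose i : ℚ) := by
  have hd := lucas_dvd N i h
  have h0 : ((N - i : ℕ) : ℚ) ≠ 0 := by
    exact_mod_cast (show N - i ≠ 0 by omega)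
  have hc : ((N - i : ℕ) : ℚ) = (N : ℚ) - i := Nat.cast_sub (by omega)
  rw [lucas, Int.cast_natCast, Nat.cast_div hd h0, Nat.cast_mul, ← hc]
  ring

/-- The variables, as polynomials. -/
abbrev y (n : ℕ) : Poly n := MvPolynomial.X Var.y
/-- The variables, as polynomials. -/
abbrev x {n : ℕ} (t : Idx n) : Poly n := MvPolynomial.X (Var.x t)
/-- The variables, as polynomials. -/
abbrev ε {n : ℕ} (t : Idx n) : Poly n := MvPolynomial.X (Var.ε t)

/-- `f₁(y) = ∑_{i=0}^{(n-1)/2} (-1)^i (n-1-i choose i) y^(n-1-2i)`. -/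
def f₁ (n : ℕ) : Poly n :=
  ∑ i ∈ Finset.Icc 0 ((n - 1) / 2), (-1) ^ i * ((n - 1 - i).choose i : Poly n) * y n ^ (n - 1 - 2 * i)

/-- `f₂(y) = ∑_{i=0}^{(n-1)/2} (-1)^i n/(n-i) (n-i choose i) y^(n-2i) - 2`. -/
def f₂ (n : ℕ) : Poly n :=
  ∑ i ∈ Finset.Icc 0 ((n - 1) / 2), (-1) ^ i * (lucas n i : Poly n) * y n ^ (n - 2 * i) - 2

/-- `f₄(y) = ∑_{i=1}^{(n-1)/2} (-1)^(i-1) (n-i-1 choose i-1) y^(n-2i)`. -/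
def f₄ (n : ℕ) : Poly n :=
  ∑ i ∈ Finset.Icc 1 ((n - 1) / 2),
    (-1) ^ (i - 1) * ((n - i - 1).choose (i - 1) : Poly n) * y n ^ (n - 2 * i)

/-- `g₁(y) = ∑_{i=0}^{[(n+1)/4]} (-1)^i (n+1)/(n+1-2i) ((n+1)/2-i choose i) y^((n+1)/2-2i)`. -/
def g₁ (n : ℕ) : Poly n :=
  ∑ i ∈ Finset.Icc 0 ((n + 1) / 4),
    (-1) ^ i * (lucas ((n + 1) / 2) i : Poly n) * y n ^ ((n + 1) / 2 - 2 * i)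

/-- `g₂(y) = ∑_{i=0}^{[(n-1)/4]} (-1)^i (n-1)/(n-1-2i) ((n-1)/2-i choose i) y^((n-1)/2-2i)`. -/
def g₂ (n : ℕ) : Poly n :=
  ∑ i ∈ Finset.Icc 0 ((n - 1) / 4),
    (-1) ^ i * (lucas ((n - 1) / 2) i : Poly n) * y n ^ ((n - 1) / 2 - 2 * i)

/-- `g₃(y) = ∑_{2 ≤ i ≤ (n-1)/2} (-1)^i (n-2-i choose i-2) y^(n-2i) + y² - 1`. -/
def g₃ (n : ℕ) : Poly n :=
  ∑ i ∈ Finset.Icc 2 ((n - 1) / 2),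
    (-1) ^ i * ((n - 2 - i).choose (i - 2) : Poly n) * y n ^ (n - 2 * i) + y n ^ 2 - 1

/-- `g₄(y) = ∑_{k=1}^{(n-1)/2} ∑_{i=0}^{[(n-1-2k)/4]} (-1)^i (k+2i)/(k+i) (k+i choose i) y^k
+ ∑_{1 ≤ i ≤ [(n-1)/4]} (-1)^i 2 + 1`. -/
def g₄ (n : ℕ) : Poly n :=
  ∑ k ∈ Finset.Icc 1 ((n - 1) / 2), ∑ i ∈ Finset.Icc 0 ((n - 1 - 2 * k) / 4),
      (-1) ^ i * (lucas (k + 2 * i) i : Poly n) * y n ^ k +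
    ∑ i ∈ Finset.Icc 1 ((n - 1) / 4), (-1) ^ i * 2 + 1

/-- The generators of the ideal `J`. -/
inductive Rel (n : ℕ) : Poly n → Prop
  | yy : Rel n (f₁ n * f₂ n)
  | yx (t : Idx n) : Rel n ((g₁ n - g₂ n) * x t)
  | xε (t : Idx n) : Rel n (g₄ n * (x t - ε t))
  | xx_xε (t t' : Idx n) : Rel n (x t * x t' - x t * ε t')
  | xx_εε (t t' : Idx n) (h : t.val + t'.val ≠ n) : Rel n (x t * x t' - ε t * ε t')
  | xx_lt (t t' s : Idx n) (h : t.val + t'.val = s.val) : Rel n (x t * x t' - g₄ n * x s)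
  | xx_gt (t t' s : Idx n) (h : t.val + t'.val = s.val + n) : Rel n (x t * x t' - g₄ n * x s)
  | xx_eq (t t' : Idx n) (h : t.val + t'.val = n) : Rel n (x t * x t' - (f₄ n + 1) * f₁ n)
  | εε_eq (t t' : Idx n) (h : t.val + t'.val = n) : Rel n (ε t * ε t' - g₃ n * f₁ n)

/-- The ideal `J` of `ℤ[X']`. -/
def J (n : ℕ) : Ideal (Poly n) := Ideal.span {p | Rel n p}

end PCR

end

/-! Since `K` acts diagonalisably, every module splits into weight spaces, and its structure is
governed by the operator `EF` on each of them. On weight `s` one has `F^r E^r = ∏ (EF + gam s i)`,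
the product over `1 ≤ i ≤ r`. For `r = n` the left side vanishes, so `EF` satisfies a polynomial
equation in which the root `0` has multiplicity at most two. Hence a polynomial in `EF` projects
onto the vectors killed by `(EF)²`; combined with the weight idempotent it gives `e s`. The left
ideal `P s` generated by `e s` is projective and has dimension at most `2n` (`InZ.smul_mem`). The
simple modules are the `S s`, one for each of the `n²` weights, of dimension `ell s`
(`exists_equiv_S`).

Tensor products are computed by one counting argument. If one factor is an `n`-dimensional simple
module, the product is generated, modulo the image of `E`, by a single string of weight vectors
(`strung_left`, `strung_right`). Its simple quotients can be read off from the string, so a sum of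
modules `P s` maps onto it, and the bounds on the dimensions of the `P s` make this map an
isomorphism (`Strung.cls_eq`). The only other product needed is the Clebsch-Gordan rule for the
two-dimensional simple module (`cS_mul_of_ell_eq_two`).

In the Green ring, write `y` for the class of `V₂` and `st` for that of the `n`-dimensional module
`S n`. The simple modules whose weight is a multiple of `n` are `S_d(y)` for the Chebyshev
polynomials `S_d` (`ay_S`); the nonsimple `P s` are `C_d(y) st` (`cP_eq`); and `C_j(y)` sends the
class of any other simple module of weight `b` to the sum of those of weights `b - nj` and `b + nj`
(`ay_C_mul_typ`). The polynomials of the presentation are Chebyshev expressions too, and the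
relations in `J` become identities between such products (`toGreen_eq_zero_of_rel`).

The relations reduce every monomial to the `n² + n - 1` elements of `PCR.fam` (`PCR.span_fam`). On
the other side, the `n²` simple classes and the `n - 1` nonsimple projective classes are linearly
independent, because the ranks of `e s` and of `EF · e s` separate them
(`linearIndependent_simpleProj`). The quotient maps onto the projective class ring
(`projClassRing_le`), so the image of `PCR.fam` is a spanning set no larger than an independent one.
It is therefore a basis, and the map is injective. -/

noncomputable section

set_option linter.unusedSectionVars false

/-! ### Finite dimensional modules and their classes in the Green ring. -/

namespace FDMod

variable {k H : Type u} [Field k] [Ring H] [Algebra k H]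

instance instModule (M : FDMod k H) : Module H M.carrier := M.toModule

theorem smul_def (M : FDMod k H) (h : H) (v : M.carrier) : h • v = M.act h v := rfl

instance (M : FDMod k H) : IsScalarTower k H M.carrier :=
  ⟨fun c h v => by simp [smul_def]⟩

/-- A finite dimensional module, from the type class data. -/
def of (X : Type u) [AddCommGroup X] [Module k X] [Module H X] [IsScalarTower k H X]
    [FiniteDimensional k X] : FDMod k H where
  carrier := X
  act := Algebra.lsmul k k X

theorem iso_iff {M N : FDMod k H} : Iso M N ↔ Nonempty (M.carrier ≃ₗ[H] N.carrier) := by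
  constructor
  · rintro ⟨f, hf⟩
    exact ⟨{ f with map_smul' := hf }⟩
  · rintro ⟨f⟩
    exact ⟨f.restrictScalars k, fun h v => f.map_smul h v⟩

end FDMod

namespace QuasiBialgebra

variable {k H : Type u} [Field k] [Ring H] [Algebra k H] (B : QuasiBialgebra k H)

theorem cls_eq_of_iso {M N : FDMod k H} (h : FDMod.Iso M N) : B.cls M = B.cls N := by
  have : B.isoClass M = B.isoClass N := Quotient.sound h
  rw [cls, cls, this]

theorem cls_eq_of_equiv {M N : FDMod k H} (f : M.carrier ≃ₗ[H] N.carrier) : B.cls M = B.cls N :=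
  B.cls_eq_of_iso (FDMod.iso_iff.mpr ⟨f⟩)

theorem cls_sum (M N : FDMod k H) : B.cls (FDMod.sum M N) = B.cls M + B.cls N := by
  rw [cls, cls, cls, ← map_add, ← sub_eq_zero, ← map_sub, Ideal.Quotient.eq_zero_iff_mem,
    ← sub_sub]
  exact AddSubgroup.subset_closure ⟨M, N, rfl⟩

theorem cls_mul (M N : FDMod k H) : B.cls M * B.cls N = B.cls (FDMod.tensor B M N) := by
  rw [cls, cls, cls, ← map_mul, ← FreeAbelianGroup.of_mul, isoClass_mul]

theorem one_eq_cls : (1 : B.GreenRing) = B.cls (FDMod.unit B) := rfl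

/-- A zero module satisfies `M ⊕ M ≅ M`, so its class equals its own double. -/
theorem cls_eq_zero_of_subsingleton (M : FDMod k H) [Subsingleton M.carrier] : B.cls M = 0 := by
  have h : FDMod.Iso (FDMod.sum M M) M := by
    have : Subsingleton (FDMod.sum M M).carrier :=
      inferInstanceAs (Subsingleton (M.carrier × M.carrier))
    exact ⟨LinearEquiv.ofLinearMap (LinearMap.fst k M.carrier M.carrier) 0
      (Subsingleton.elim _ _) (LinearMap.ext fun _ => Subsingleton.elim (α := M.carrier × M.carrier) _ _),
      fun h v => Subsingleton.elim (α := M.carrier) _ _⟩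
  have := B.cls_eq_of_iso h
  rwa [cls_sum, add_eq_left] at this

end QuasiBialgebra

/-! ### Weights and the scalars along a string. -/

namespace QData

variable {k : Type u} [Field k] (D : QData k)
  {X : Type u} [AddCommGroup X] [Module k X] [Module D.U X] [IsScalarTower k D.U X]

/-! ### Weight spaces -/

/-- The idempotent `idem s` projects onto the eigenvalue `χ(-s)` of `K`; this sign is why weight `s`
always goes with `idem (-s)`. -/
theorem idem_smul_of_weight {s : ZMod D.m} {x : X} (h : D.K • x = D.χ s • x) :
    D.idem (-s) • x = x := by
  have hr : ∀ r : ℕ, D.K ^ r • x = D.χ s ^ r • x := by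
    intro r
    induction r with
    | zero => simp
    | succ r ih => rw [pow_succ', mul_smul, ih, smul_comm, h, smul_smul, pow_succ]
  rw [idem_eq, smul_assoc, Finset.sum_smul]
  simp_rw [smul_assoc, hr, smul_smul, χ_neg, ← mul_pow, inv_mul_cancel₀ (D.χ_ne_zero s)]
  simp only [one_pow, one_smul]
  rw [Finset.sum_const, Finset.card_range, ← Nat.cast_smul_eq_nsmul k, smul_smul,
    inv_mul_cancel₀ D.m_cast_ne_zero, one_smul]

theorem idem_smul_of_weight_ne {s t : ZMod D.m} {x : X} (h : D.K • x = D.χ s • x) (hst : s ≠ t) :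
    D.idem (-t) • x = 0 := by
  rw [← D.idem_smul_of_weight h, ← mul_smul, idem_mul_idem, if_neg, zero_smul]
  exact fun h => hst (neg_injective h).symm

theorem K_smul_idem_smul (s : ZMod D.m) (x : X) :
    D.K • D.idem (-s) • x = D.χ s • D.idem (-s) • x := by
  rw [← mul_smul, K_mul_idem, χ_neg, inv_inv, smul_assoc]

theorem idem_mul_EF (s : ZMod D.m) : D.idem s * (D.E * D.F) = (D.E * D.F) * D.idem s := by
  rw [← mul_assoc, idem_mul_E, mul_assoc, idem_mul_F, add_sub_cancel_right, mul_assoc]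

theorem K_mul_EF : D.K * (D.E * D.F) = (D.E * D.F) * D.K := by
  rw [← mul_assoc, KE, smul_mul_assoc, mul_assoc, KF, mul_smul_comm, smul_smul,
    mul_inv_cancel₀ (pow_ne_zero _ D.q_ne_zero), one_smul, mul_assoc]

theorem K_E_smul {s : ZMod D.m} {x : X} (h : D.K • x = D.χ s • x) :
    D.K • D.E • x = D.χ (s + 2 * D.n) • D.E • x := by
  rw [← mul_smul, KE, smul_assoc, mul_smul, h, smul_comm D.E, smul_smul, χ_add, χ_two_n, mul_comm]

theorem K_F_smul {s : ZMod D.m} {x : X} (h : D.K • x = D.χ s • x) :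
    D.K • D.F • x = D.χ (s - 2 * D.n) • D.F • x := by
  rw [← mul_smul, KF, smul_assoc, mul_smul, h, smul_comm D.F, smul_smul, χ_sub, χ_two_n, mul_comm]

theorem K_E_pow_smul {s : ZMod D.m} {x : X} (h : D.K • x = D.χ s • x) (i : ℕ) :
    D.K • D.E ^ i • x = D.χ (s + 2 * D.n * i) • D.E ^ i • x := by
  induction i with
  | zero => simpa using h
  | succ i ih =>
    rw [pow_succ', mul_smul, D.K_E_smul ih]
    congr 2; push_cast; ring

theorem K_F_pow_smul {s : ZMod D.m} {x : X} (h : D.K • x = D.χ s • x) (i : ℕ) :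
    D.K • D.F ^ i • x = D.χ (s - 2 * D.n * i) • D.F ^ i • x := by
  induction i with
  | zero => simpa using h
  | succ i ih =>
    rw [pow_succ', mul_smul, D.K_F_smul ih]
    congr 2; push_cast; ring

theorem Kinv_smul {s : ZMod D.m} {x : X} (h : D.K • x = D.χ s • x) :
    D.Kinv • x = (D.χ s)⁻¹ • x := by
  have h1 : D.Kinv • D.K • x = x := by rw [← mul_smul, D.gen_rel.Kinv_K, one_smul]
  rw [h, smul_comm] at h1
  rw [← h1, smul_smul, inv_mul_cancel₀ (D.χ_ne_zero s), one_smul, h1]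

theorem K_pow_m : D.K ^ D.m = 1 := D.gen_rel.K_pow

theorem E_pow_n_smul (x : X) : D.E ^ D.n • x = 0 := by rw [D.gen_rel.E_pow, zero_smul]

theorem F_pow_n_smul (x : X) : D.F ^ D.n • x = 0 := by rw [D.gen_rel.F_pow, zero_smul]

/-- With this, stability of a subspace and linearity of a map need to be tested on `E`, `F`, `K`
only. -/
theorem Kinv_eq_pow : D.Kinv = D.K ^ (D.m - 1) := by
  have h : D.K ^ (D.m - 1) * D.K = 1 := by
    rw [← pow_succ, Nat.sub_add_cancel (Nat.pos_of_ne_zero D.m_ne_zero), K_pow_m]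
  calc D.Kinv = D.K ^ (D.m - 1) * D.K * D.Kinv := by rw [h, one_mul]
    _ = _ := by rw [mul_assoc, D.gen_rel.K_Kinv, mul_one]

/-- A subspace stable under the generators `E`, `F`, `K` is stable under `U`. -/
theorem smul_mem_of_gen (S : Submodule k X) (hE : ∀ x ∈ S, D.E • x ∈ S)
    (hF : ∀ x ∈ S, D.F • x ∈ S) (hK : ∀ x ∈ S, D.K • x ∈ S) (u : D.U) {x : X} (hx : x ∈ S) :
    u • x ∈ S := by
  have hKp : ∀ r : ℕ, ∀ x ∈ S, D.K ^ r • x ∈ S := by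
    intro r
    induction r with
    | zero => simp
    | succ r ih => intro x hx; rw [pow_succ', mul_smul]; exact hK _ (ih x hx)
  have : ∀ x ∈ S, u • x ∈ S := by
    induction u using D.U_induction with
    | halg c => intro x hx; rw [algebraMap_smul]; exact S.smul_mem c hx
    | hgen g =>
      cases g
      · exact hE
      · exact hF
      · exact hK
      · intro x hx
        change D.Kinv • x ∈ S
        rw [Kinv_eq_pow]; exact hKp _ x hx
    | hadd a b ha hb => intro x hx; rw [add_smul]; exact S.add_mem (ha x hx) (hb x hx)
    | hmul a b ha hb => intro x hx; rw [mul_smul]; exact ha _ (hb x hx)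
  exact this x hx

/-- A linear map that commutes with `E`, `F`, `K` is `U`-linear. -/
theorem map_smul_of_gen {Y : Type u} [AddCommGroup Y] [Module k Y] [Module D.U Y]
    [IsScalarTower k D.U Y] (f : X →ₗ[k] Y) (hE : ∀ x, f (D.E • x) = D.E • f x)
    (hF : ∀ x, f (D.F • x) = D.F • f x) (hK : ∀ x, f (D.K • x) = D.K • f x) (u : D.U) (x : X) :
    f (u • x) = u • f x := by
  have hKp : ∀ r : ℕ, ∀ x, f (D.K ^ r • x) = D.K ^ r • f x := by
    intro r
    induction r with
    | zero => simp
    | succ r ih => intro x; rw [pow_succ', mul_smul, hK, ih, mul_smul]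
  have : ∀ x, f (u • x) = u • f x := by
    induction u using D.U_induction with
    | halg c => intro x; rw [algebraMap_smul, algebraMap_smul, map_smul]
    | hgen g =>
      cases g
      · exact hE
      · exact hF
      · exact hK
      · intro x
        change f (D.Kinv • x) = D.Kinv • f x
        rw [Kinv_eq_pow]; exact hKp _ x
    | hadd a b ha hb => intro x; rw [add_smul, map_add, ha, hb, add_smul]
    | hmul a b ha hb => intro x; rw [mul_smul, ha, hb, mul_smul]
  exact this x

theorem exists_weight {x : X} (hx : x ≠ 0) : ∃ s, D.idem (-s) • x ≠ 0 := by
  by_contra! h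
  apply hx
  rw [← one_smul D.U x, ← D.sum_idem, Finset.sum_smul]
  refine Finset.sum_eq_zero fun s _ => ?_
  have := h (-s)
  rwa [neg_neg] at this

/-! ### The scalars `γ_j` -/

theorem χ_two_n_mul (j : ℕ) : D.χ (2 * D.n * j) = D.q ^ (2 * j) := by
  have : (2 * D.n * j : ZMod D.m) = ((D.n * (2 * j) : ℕ) : ZMod D.m) := by push_cast; ring
  rw [this, χ_natCast, pow_mul]; rfl

theorem two_n_mul_n : (2 * D.n * D.n : ZMod D.m) = 0 := by
  have : (2 * D.n * D.n : ZMod D.m) = ((D.m : ℕ) : ZMod D.m) * 2 := by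
    rw [m]; push_cast; ring
  rw [this, ZMod.natCast_self, zero_mul]

/-- The scalar by which `EF` acts on `E^j v`, for `F v = 0` and `v` of weight `s`. -/
def gam (s : ZMod D.m) (j : ℕ) : k :=
  ((D.q - D.q⁻¹) ^ 2)⁻¹ * ((1 - D.q ^ (2 * j)) *
    (D.χ s * D.q⁻¹ - (D.χ s)⁻¹ * D.q * (D.q ^ (2 * j))⁻¹))

theorem gam_zero (s : ZMod D.m) : D.gam s 0 = 0 := by simp [gam]

theorem q_pow_two_n : D.q ^ (2 * D.n) = 1 := by
  rw [mul_comm, pow_mul, D.q_pow_n, one_pow]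

theorem gam_n (s : ZMod D.m) : D.gam s D.n = 0 := by simp [gam, q_pow_two_n]

/-- The right side is the scalar of `EF - FE` on the weight `s + 2nj`, so commutators along a string
telescope to values of `gam`. -/
theorem gam_sub_gam_succ (s : ZMod D.m) (j : ℕ) : D.gam s j - D.gam s (j + 1) =
    (D.q - D.q⁻¹)⁻¹ * (D.χ (s + 2 * D.n * j) - (D.χ (s + 2 * D.n * j))⁻¹) := by
  have h1 := D.χ_ne_zero s
  have h2 := D.q_ne_zero
  have h3 := D.q_sub_inv_ne_zero
  have h4 := pow_ne_zero (2 * j) h2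
  rw [χ_add, χ_two_n_mul, gam, gam, mul_add 2 j 1, pow_add, ← mul_sub, sq (D.q - D.q⁻¹), mul_inv,
    mul_assoc]
  congr 1
  rw [inv_mul_eq_iff_eq_mul₀ h3]
  generalize D.q ^ (2 * j) = Q at h4 ⊢
  field_simp
  ring

/-- For `n` odd, `q²` still has order `n`, so `1 - q^(2j)` is nonzero in this range and only the
second factor of `gam` can vanish. -/
theorem gam_eq_zero_iff (s : ZMod D.m) {j : ℕ} (h0 : 0 < j) (hj : j < D.n) :
    D.gam s j = 0 ↔ D.χ s ^ 2 * D.q ^ (2 * j) = D.q ^ 2 := by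
  have h1 := D.χ_ne_zero s
  have h2 := D.q_ne_zero
  have h3 := D.q_sub_inv_ne_zero
  have h4 := pow_ne_zero (2 * j) h2
  have h5 : 1 - D.q ^ (2 * j) ≠ 0 := by
    intro h
    rw [pow_mul] at h
    exact D.prim_q_sq.pow_ne_one_of_pos_of_lt h0.ne' hj (sub_eq_zero.mp h).symm
  rw [gam, mul_eq_zero, mul_eq_zero, or_iff_right (inv_ne_zero (pow_ne_zero _ h3)),
    or_iff_right h5, sub_eq_zero]
  generalize D.q ^ (2 * j) = Q at h4 ⊢
  field_simp

theorem exists_ell (s : ZMod D.m) : ∃ j, 0 < j ∧ D.gam s j = 0 :=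
  ⟨D.n, Nat.pos_of_ne_zero (NeZero.ne _), D.gam_n s⟩

open Classical in
/-- The dimension of the simple module of lowest weight `s`. -/
def ell (s : ZMod D.m) : ℕ := Nat.find (D.exists_ell s)

theorem ell_pos (s : ZMod D.m) : 0 < D.ell s := by
  classical exact (Nat.find_spec (D.exists_ell s)).1

theorem gam_ell (s : ZMod D.m) : D.gam s (D.ell s) = 0 := by
  classical exact (Nat.find_spec (D.exists_ell s)).2

theorem n_pos : 0 < D.n := Nat.pos_of_ne_zero (NeZero.ne _)

theorem ell_le (s : ZMod D.m) : D.ell s ≤ D.n := by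
  classical exact Nat.find_min' (D.exists_ell s) ⟨D.n_pos, D.gam_n s⟩

/-- Two zeros strictly between `0` and `n` would give equal powers of `q²` with distinct exponents
below its order. -/
theorem gam_ne_zero (s : ZMod D.m) {j : ℕ} (h0 : 0 < j) (hj : j < D.n) (hl : j ≠ D.ell s) :
    D.gam s j ≠ 0 := by
  classical
  intro h
  have hle : D.ell s ≤ j := Nat.find_min' (D.exists_ell s) ⟨h0, h⟩
  have h1 := (D.gam_eq_zero_iff s h0 hj).mp h
  have h2 := (D.gam_eq_zero_iff s (D.ell_pos s) (hle.trans_lt hj)).mp (D.gam_ell s)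
  have h3 := mul_left_cancel₀ (pow_ne_zero 2 (D.χ_ne_zero s)) (h1.trans h2.symm)
  rw [pow_mul, pow_mul] at h3
  exact hl (D.prim_q_sq.pow_inj hj (hle.trans_lt hj) h3)

theorem gam_ne_zero_of_lt (s : ZMod D.m) {j : ℕ} (h0 : 0 < j) (hj : j < D.ell s) :
    D.gam s j ≠ 0 := D.gam_ne_zero s h0 (hj.trans_le (D.ell_le s)) hj.ne

/-- At `j = n` the criterion `gam_eq_zero_iff` is not available, since `gam s n` vanishes for every
`s`. There the equation reads `χ(s)² = q²` and excludes a smaller zero. -/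
theorem ell_eq (s : ZMod D.m) {j : ℕ} (h0 : 0 < j) (hj : j ≤ D.n)
    (h : D.χ s ^ 2 * D.q ^ (2 * j) = D.q ^ 2) : D.ell s = j := by
  rcases hj.lt_or_eq with hj | rfl
  · by_contra hne
    exact D.gam_ne_zero s h0 hj (Ne.symm hne) ((D.gam_eq_zero_iff s h0 hj).mpr h)
  · by_contra hne
    have hlt := lt_of_le_of_ne (D.ell_le s) hne
    have h1 := (D.gam_eq_zero_iff s (D.ell_pos s) hlt).mp (D.gam_ell s)
    rw [q_pow_two_n, mul_one] at h
    rw [h] at h1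
    have h2 : D.q ^ (2 * D.ell s) = 1 :=
      mul_left_cancel₀ (pow_ne_zero 2 D.q_ne_zero) (by rw [h1, mul_one])
    rw [pow_mul] at h2
    exact D.prim_q_sq.pow_ne_one_of_pos_of_lt (D.ell_pos s).ne' hlt h2

theorem χ_sq_of_ell_lt {s : ZMod D.m} (h : D.ell s < D.n) :
    D.χ s ^ 2 * D.q ^ (2 * D.ell s) = D.q ^ 2 :=
  (D.gam_eq_zero_iff s (D.ell_pos s) h).mp (D.gam_ell s)

/-- The weight just above the string of `S s` is linked to `s`: its simple module has the
complementary dimension. This pairing drives the dimension count in `Strung.cls_eq`. -/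
theorem ell_add_ell {s : ZMod D.m} (h : D.ell s < D.n) :
    D.ell (s + 2 * D.n * D.ell s) = D.n - D.ell s := by
  refine D.ell_eq _ (by omega) (by omega) ?_
  have h1 := D.χ_sq_of_ell_lt h
  have h2 : D.q ^ (2 * D.ell s) * D.q ^ (2 * (D.n - D.ell s)) = 1 := by
    rw [← pow_add, ← mul_add, Nat.add_sub_cancel' h.le, q_pow_two_n]
  rw [χ_add, χ_two_n_mul]
  linear_combination (D.χ s ^ 2 * D.q ^ (2 * D.ell s)) * h2 + h1

end QData
end

/-! ### Vectors killed by `(EF)²` and the projectors onto them. -/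

noncomputable section

set_option linter.unusedSectionVars false

namespace QData

open Polynomial

variable {k : Type u} [Field k] (D : QData k)
  {X : Type u} [AddCommGroup X] [Module k X] [Module D.U X] [IsScalarTower k D.U X]

/-! ### The operator `EF` on weight spaces -/

/-- The element `EF`. -/
abbrev EF : D.U := D.E * D.F

theorem EF_smul (x : X) : D.EF • x = D.E • D.F • x := mul_smul _ _ _

theorem E_F_smul {s : ZMod D.m} {x : X} (h : D.K • x = D.χ s • x) :
    D.E • D.F • x = D.F • D.E • x + ((D.q - D.q⁻¹)⁻¹ * (D.χ s - (D.χ s)⁻¹)) • x := by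
  have h1 := congrArg (· • x) D.gen_rel.EF
  rw [smul_assoc, sub_smul (D.gen .K), show D.gen .K • x = _ from h,
    show D.gen .Kinv • x = _ from D.Kinv_smul h, ← sub_smul (D.χ s), smul_smul, sub_smul, mul_smul (D.gen .E), mul_smul (D.gen .F)] at h1
  rw [← h1]; abel

theorem K_EF_smul {s : ZMod D.m} {x : X} (h : D.K • x = D.χ s • x) :
    D.K • D.EF • x = D.χ s • D.EF • x := by
  rw [← mul_smul, K_mul_EF, mul_smul, h, smul_comm]

/-- Moving `F` past each `E` costs a commutator scalar, and these scalars telescope by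
`gam_sub_gam_succ`. -/
theorem F_E_pow_smul {s : ZMod D.m} {x : X} (h : D.K • x = D.χ s • x) (j : ℕ) :
    D.F • D.E ^ (j + 1) • x = D.E ^ j • (D.EF • x + D.gam s (j + 1) • x) := by
  induction j with
  | zero =>
    have h1 := D.E_F_smul h
    have h2 := D.gam_sub_gam_succ s 0
    rw [gam_zero, Nat.cast_zero, mul_zero, add_zero, zero_sub, zero_add] at h2
    rw [← h2] at h1
    rw [zero_add, pow_one, pow_zero, one_smul, EF_smul, h1, neg_smul]
    abel
  | succ j ih =>
    have h1 := D.E_F_smul (D.K_E_pow_smul h (j + 1))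
    have h2 := D.gam_sub_gam_succ s (j + 1)
    rw [← h2, ih] at h1
    rw [pow_succ' D.E (j + 1), mul_smul, eq_sub_of_add_eq h1.symm, ← mul_smul D.E (D.E ^ j),
      ← pow_succ', smul_add, smul_add, smul_comm (D.E ^ (j + 1)) (D.gam s (j + 1)),
      smul_comm (D.E ^ (j + 1)) (D.gam s (j + 1 + 1)), sub_smul]
    abel

/-- The mirror image of `F_E_pow_smul`. Since `2n · n = 0` in `ℤ/m`, going down `j` steps reaches
the weight obtained by going up `n - j` steps, so the same scalars occur, read backwards from `gam s
n = 0`. -/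
theorem E_F_pow_smul {s : ZMod D.m} {x : X} (h : D.K • x = D.χ s • x) (j : ℕ) (hj : j ≤ D.n) :
    D.E • D.F ^ (j + 1) • x = D.F ^ j • (D.EF • x + D.gam s (D.n - j) • x) := by
  induction j with
  | zero => simp [gam_n, EF_smul]
  | succ j ih =>
    have h1 := D.E_F_smul (D.K_F_pow_smul h (j + 1))
    have h2 := D.gam_sub_gam_succ s (D.n - (j + 1))
    have h3 : s + 2 * D.n * ((D.n - (j + 1) : ℕ) : ZMod D.m) =
        s - 2 * D.n * ((j + 1 : ℕ) : ZMod D.m) := by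
      rw [Nat.cast_sub hj, mul_sub, two_n_mul_n, zero_sub, sub_eq_add_neg]
    rw [h3, show D.n - (j + 1) + 1 = D.n - j by omega] at h2
    rw [← h2, ih (by omega)] at h1
    rw [pow_succ' D.F (j + 1), mul_smul, h1, ← mul_smul D.F (D.F ^ j),
      ← pow_succ', smul_add, smul_add, smul_comm (D.F ^ (j + 1)) (D.gam s (D.n - j)),
      smul_comm (D.F ^ (j + 1)) (D.gam s (D.n - (j + 1))), sub_smul]
    abel

theorem commute_aeval_EF {a : D.U} (h : Commute a D.EF) (p : k[X]) :
    Commute a (aeval D.EF p) := by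
  induction p using Polynomial.induction_on' with
  | add p q hp hq => rw [map_add]; exact hp.add_right hq
  | monomial n c =>
    rw [aeval_monomial]
    exact (show Commute a (algebraMap k D.U c) from (Algebra.commutes c a).symm).mul_right
      (h.pow_right n)

theorem K_aeval_smul (p : k[X]) {s : ZMod D.m} {x : X} (h : D.K • x = D.χ s • x) :
    D.K • aeval D.EF p • x = D.χ s • aeval D.EF p • x := by
  rw [← mul_smul, (D.commute_aeval_EF D.K_mul_EF p).eq, mul_smul, h, smul_comm]

/-- `∏_{1 ≤ j ≤ r} (T + γ_j)`. -/
def pol (s : ZMod D.m) (r : ℕ) : k[X] := ∏ i ∈ Finset.range r, (Polynomial.X + C (D.gam s (i + 1)))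

theorem F_pow_E_pow_smul {s : ZMod D.m} (r : ℕ) : ∀ {x : X}, D.K • x = D.χ s • x →
    D.F ^ r • D.E ^ r • x = aeval D.EF (D.pol s r) • x := by
  induction r with
  | zero => intro x _; simp [pol]
  | succ r ih =>
    intro x h
    have h1 : D.EF • x + D.gam s (r + 1) • x =
        aeval D.EF (Polynomial.X + C (D.gam s (r + 1))) • x := by
      rw [map_add, aeval_X, aeval_C, add_smul, algebraMap_smul]
    rw [pow_succ D.F, mul_smul, D.F_E_pow_smul h, h1, ih (D.K_aeval_smul _ h), ← mul_smul,
      ← map_mul, pol, pol, Finset.prod_range_succ]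

/-- The product of the factors `T + γ_j` with `γ_j ≠ 0`. -/
def polQ (s : ZMod D.m) : k[X] := open Classical in
  ∏ i ∈ (Finset.range D.n).filter (fun i => D.gam s (i + 1) ≠ 0),
    (Polynomial.X + C (D.gam s (i + 1)))

theorem isCoprime_X_add_C {c : k} (hc : c ≠ 0) :
    IsCoprime (Polynomial.X ^ 2 : k[X]) (Polynomial.X + C c) := by
  refine IsCoprime.pow_left ⟨-C c⁻¹, C c⁻¹, ?_⟩
  rw [mul_add, ← C_mul, inv_mul_cancel₀ hc, C_1]
  ring

theorem isCoprime_polQ (s : ZMod D.m) : IsCoprime (Polynomial.X ^ 2) (D.polQ s) := by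
  classical
  exact IsCoprime.prod_right fun i hi => isCoprime_X_add_C (Finset.mem_filter.mp hi).2

theorem isCoprime_pol (s : ZMod D.m) {r : ℕ} (hr : r < D.ell s) :
    IsCoprime (Polynomial.X ^ 2) (D.pol s r) :=
  IsCoprime.prod_right fun i hi => isCoprime_X_add_C
    (D.gam_ne_zero_of_lt s (Nat.succ_pos i) (by have := Finset.mem_range.mp hi; omega))

/-- Among `gam s 1, …, gam s n` only those with index `ell s` or `n` vanish, so `X` divides the
product at most twice. -/
theorem pol_dvd (s : ZMod D.m) : D.pol s D.n ∣ Polynomial.X ^ 2 * D.polQ s := by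
  classical
  have h1 : D.pol s D.n = (∏ i ∈ (Finset.range D.n).filter (fun i => ¬ D.gam s (i + 1) ≠ 0),
      (Polynomial.X + C (D.gam s (i + 1)))) * D.polQ s := by
    rw [pol, polQ, mul_comm, Finset.prod_filter_mul_prod_filter_not]
  have h2 : (∏ i ∈ (Finset.range D.n).filter (fun i => ¬ D.gam s (i + 1) ≠ 0),
      (Polynomial.X + C (D.gam s (i + 1)))) = Polynomial.X ^
        ((Finset.range D.n).filter (fun i => ¬ D.gam s (i + 1) ≠ 0)).card := by
    refine Finset.prod_eq_pow_card fun i hi => ?_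
    rw [not_not.mp (Finset.mem_filter.mp hi).2, C_0, add_zero]
  rw [h1, h2]
  refine mul_dvd_mul_right (pow_dvd_pow _ ?_) _
  have h3 : (Finset.range D.n).filter (fun i => ¬ D.gam s (i + 1) ≠ 0) ⊆
      {D.ell s - 1, D.n - 1} := by
    intro i hi
    obtain ⟨h4, h5⟩ := Finset.mem_filter.mp hi
    have h4 := Finset.mem_range.mp h4
    rw [Finset.mem_insert, Finset.mem_singleton]
    by_contra! h6
    exact h5 (D.gam_ne_zero s (Nat.succ_pos i) (by omega) (by omega))
  exact (Finset.card_le_card h3).trans Finset.card_le_two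

/-- The polynomial `pol s n` at `EF` is `F^n E^n` on this weight space, which is zero. -/
theorem aeval_sq_polQ_smul {s : ZMod D.m} {x : X} (h : D.K • x = D.χ s • x) :
    aeval D.EF (Polynomial.X ^ 2 * D.polQ s) • x = 0 := by
  obtain ⟨c, hc⟩ := D.pol_dvd s
  rw [hc, mul_comm, map_mul, mul_smul, ← D.F_pow_E_pow_smul D.n h, F_pow_n_smul, smul_zero]

/-- Vectors of weight `s` killed by `(EF)²`. -/
structure InZ (s : ZMod D.m) (x : X) : Prop where
  wt : D.K • x = D.χ s • x
  sq : D.EF • D.EF • x = 0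

variable {D} in
theorem InZ.aeval_X_sq {s : ZMod D.m} {x : X} (h : D.InZ s x) :
    aeval D.EF (Polynomial.X ^ 2 : k[X]) • x = 0 := by
  rw [map_pow, aeval_X, _root_.sq, mul_smul, h.sq]

theorem inZ_of_aeval {s : ZMod D.m} {x : X} (h : D.K • x = D.χ s • x)
    (h' : aeval D.EF (Polynomial.X ^ 2 : k[X]) • x = 0) : D.InZ s x :=
  ⟨h, by rwa [map_pow, aeval_X, sq, mul_smul] at h'⟩

variable {D} in
-- On the vectors of `InZ` the square of `EF` is zero, so by Bézout a polynomial in `EF` coprime to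
-- `X²` acts there invertibly.
theorem InZ.exists_aeval {s : ZMod D.m} {x : X} (h : D.InZ s x) {p : k[X]}
    (hp : IsCoprime (Polynomial.X ^ 2) p) : ∃ y, D.InZ s y ∧ x = aeval D.EF p • y := by
  obtain ⟨a, b, hab⟩ := hp
  refine ⟨aeval D.EF b • x, D.inZ_of_aeval (D.K_aeval_smul b h.wt) ?_, ?_⟩
  · rw [← mul_smul, ← map_mul, mul_comm, map_mul, mul_smul, h.aeval_X_sq, smul_zero]
  · have := congrArg (fun p => aeval D.EF p • x) hab
    simp only [map_add, add_smul, map_mul, mul_smul, h.aeval_X_sq, smul_zero, zero_add,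
      map_one, one_smul] at this
    rw [← mul_smul, ← map_mul, mul_comm, map_mul, mul_smul, this]

variable {D} in
theorem InZ.eq_zero_of_aeval {s : ZMod D.m} {x : X} (h : D.InZ s x) {p : k[X]}
    (hp : IsCoprime (Polynomial.X ^ 2) p) (h0 : aeval D.EF p • x = 0) : x = 0 := by
  obtain ⟨a, b, hab⟩ := hp
  have := congrArg (fun p => aeval D.EF p • x) hab
  simpa only [map_add, add_smul, map_mul, mul_smul, h.aeval_X_sq, smul_zero, zero_add,
      map_one, one_smul, h0, eq_comm] using this

variable {D} in
-- The factors `EF + gam s i` with `i < ell s` are invertible on `InZ`, and their product is `F^(ell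
-- s - 1) E^(ell s - 1)`. So `x` lies in the image of `F^(ell s - 1)`, and `F^n = 0` finishes.
theorem InZ.F_pow {s : ZMod D.m} {x : X} (h : D.InZ s x) : D.F ^ (D.n - D.ell s + 1) • x = 0 := by
  have h0 := D.ell_pos s
  have h1 := D.ell_le s
  obtain ⟨y, hy, rfl⟩ := h.exists_aeval (D.isCoprime_pol s (Nat.sub_one_lt h0.ne'))
  rw [← D.F_pow_E_pow_smul _ hy.wt, ← mul_smul, ← pow_add,
    show D.n - D.ell s + 1 + (D.ell s - 1) = D.n by omega, F_pow_n_smul]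

/-- When `EF` kills `z`, applying `E` to `F^(j+1) z` gives `gam s (n - j)` times `F^j z`. This
scalar is nonzero for `0 < j < n - ell s`, so vanishing descends from the exponent `n - ell s` to
the exponent `1`. -/
theorem F_smul_eq_zero {s : ZMod D.m} {z : X} (hz : D.K • z = D.χ s • z) (h0 : D.EF • z = 0)
    (h : D.F ^ (D.n - D.ell s) • z = 0) : D.F • z = 0 := by
  have h1 := D.ell_le s
  have key : ∀ i j : ℕ, 0 < j → j + i = D.n - D.ell s → D.F ^ j • z = 0 := by
    intro i
    induction i with
    | zero => intro j _ hj; rwa [show j = D.n - D.ell s by omega]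
    | succ i ih =>
      intro j hj0 hj
      have h2 := D.E_F_pow_smul hz j (by omega)
      rw [ih (j + 1) (by omega) (by omega), smul_zero, h0, zero_add, smul_comm] at h2
      exact (smul_eq_zero.mp h2.symm).resolve_left
        (D.gam_ne_zero s (by omega) (by omega) (by have := D.ell_pos s; omega))
  rcases Nat.eq_zero_or_pos (D.n - D.ell s) with h2 | h2
  · rw [h2, pow_zero, one_smul] at h
    rw [h, smul_zero]
  · simpa using key (D.n - D.ell s - 1) 1 one_pos (by omega)

variable {D} in
-- The factor with index `ell s` is `EF` itself, because `gam` vanishes there. So `EF x` lies in the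
-- image of `F^(ell s)`, is killed by `F^(n - ell s)`, and `F_smul_eq_zero` applies.
theorem InZ.F_EF {s : ZMod D.m} {x : X} (h : D.InZ s x) : D.F • D.EF • x = 0 := by
  refine D.F_smul_eq_zero (D.K_EF_smul h.wt) h.sq ?_
  have h0 := D.ell_pos s
  have h1 := D.ell_le s
  obtain ⟨y, hy, rfl⟩ := h.exists_aeval (D.isCoprime_pol s (Nat.sub_one_lt h0.ne'))
  have h2 : D.EF • aeval D.EF (D.pol s (D.ell s - 1)) • y = D.F ^ D.ell s • D.E ^ D.ell s • y := by
    have h3 : D.pol s (D.ell s) = Polynomial.X * D.pol s (D.ell s - 1) := by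
      have h4 := D.gam_ell s
      obtain ⟨r, hr⟩ := Nat.exists_eq_succ_of_ne_zero h0.ne'
      rw [hr] at h4 ⊢
      rw [pol, Finset.prod_range_succ, h4, C_0, add_zero, mul_comm]
      rfl
    rw [D.F_pow_E_pow_smul _ hy.wt, h3, map_mul, aeval_X, mul_smul D.EF]
  rw [h2, ← mul_smul, ← pow_add, Nat.sub_add_cancel h1, F_pow_n_smul]

variable {D} in
theorem InZ.F_eq_zero {s : ZMod D.m} {x : X} (h : D.InZ s x) (hl : D.ell s = D.n) :
    D.F • x = 0 := by
  simpa [hl] using h.F_pow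

variable {D} in
-- Each further power of `F` is undone by one `E` up to the scalar `gam s (n - j)`, which is nonzero
-- as long as `n - j` exceeds `ell s`. Taking `j` maximal expresses `F x` through the bottom vector
-- `F^(n - ell s) x`.
theorem InZ.exists_F_eq {s : ZMod D.m} {x : X} (h : D.InZ s x) (j : ℕ)
    (hj : j + D.ell s < D.n) : ∃ c : k, D.F • x = c • D.E ^ j • D.F ^ (j + 1) • x := by
  induction j with
  | zero => exact ⟨1, by simp⟩
  | succ j ih =>
    obtain ⟨c, hc⟩ := ih (by omega)
    have h1 := D.E_F_pow_smul h.wt (j + 1) (by omega)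
    have h3 : D.F ^ (j + 1) • D.EF • x = 0 := by rw [pow_succ, mul_smul, h.F_EF, smul_zero]
    rw [smul_add, h3, zero_add, smul_comm (D.F ^ (j + 1)) (D.gam s _)] at h1
    have h2 := D.gam_ne_zero s (j := D.n - (j + 1)) (by omega) (by omega) (by omega)
    refine ⟨c * (D.gam s (D.n - (j + 1)))⁻¹, ?_⟩
    rw [pow_succ D.E, mul_smul (D.E ^ j), h1, smul_comm (D.E ^ j) (_ : k),
      smul_smul, mul_assoc, inv_mul_cancel₀ h2, mul_one, hc]

/-! ### The projectors onto the spaces of `InZ` -/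

/-- Such a `g` is `1` modulo `X²` and `0` modulo `polQ s`, so `g(EF)` is the projector onto the
generalised kernel of `EF`. -/
theorem exists_polE (s : ZMod D.m) : ∃ g a b : k[X],
    g = b * D.polQ s ∧ a * Polynomial.X ^ 2 + g = 1 := by
  obtain ⟨a, b, hab⟩ := D.isCoprime_polQ s
  exact ⟨_, a, b, rfl, hab⟩

/-- The polynomial that gives the projector onto the generalized kernel of `EF`. -/
def polE (s : ZMod D.m) : k[X] := (D.exists_polE s).choose

/-- The idempotent that projects onto the vectors of weight `s` killed by `(EF)²`. -/
def e (s : ZMod D.m) : D.U := aeval D.EF (D.polE s) * D.idem (-s)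

theorem e_smul (s : ZMod D.m) (x : X) :
    D.e s • x = aeval D.EF (D.polE s) • D.idem (-s) • x := mul_smul _ _ _

theorem inZ_e_smul (s : ZMod D.m) (x : X) : D.InZ s (D.e s • x) := by
  obtain ⟨a, b, hg, _⟩ := (D.exists_polE s).choose_spec
  have hw := D.K_smul_idem_smul s x
  rw [e_smul]
  refine D.inZ_of_aeval (D.K_aeval_smul _ hw) ?_
  rw [polE, hg, ← mul_smul, ← map_mul, show Polynomial.X ^ 2 * (b * D.polQ s) =
    b * (Polynomial.X ^ 2 * D.polQ s) by ring, map_mul, mul_smul, D.aeval_sq_polQ_smul hw, smul_zero]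

variable {D} in
theorem InZ.e_smul {s : ZMod D.m} {x : X} (h : D.InZ s x) : D.e s • x = x := by
  obtain ⟨a, b, _, hg⟩ := (D.exists_polE s).choose_spec
  rw [D.e_smul, D.idem_smul_of_weight h.wt]
  have := congrArg (fun p => aeval D.EF p • x) hg
  rw [polE]
  simpa only [map_add, add_smul, map_mul, mul_smul, h.aeval_X_sq, smul_zero, zero_add,
      map_one, one_smul] using this

theorem inZ_e (s : ZMod D.m) : D.InZ s (D.e s) := by
  have := D.inZ_e_smul s (1 : D.U)
  simpa using this

/-- `EF` acts by zero on `e_s p`, for an eigenvector `p` of `K` and `EF`. -/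
theorem EF_e_smul_eq_zero (s : ZMod D.m) {b : ZMod D.m} {p : X} (h : D.K • p = D.χ b • p) {c : k}
    (hc : D.EF • p = c • p) : D.EF • D.e s • p = 0 := by
  by_cases hb : b = s
  · subst hb
    have h1 : ∀ g : k[X], aeval D.EF g • p = g.eval c • p := by
      intro g
      induction g using Polynomial.induction_on' with
      | add f g hf hg => rw [map_add, add_smul, hf, hg, eval_add, add_smul]
      | monomial N a =>
        have : D.EF ^ N • p = c ^ N • p := by
          induction N with
          | zero => simp
          | succ N ih => rw [pow_succ, mul_smul, hc, smul_comm, ih, smul_smul, pow_succ']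
        rw [aeval_monomial, eval_monomial, mul_smul, this, algebraMap_smul, smul_smul]
    -- On an eigenvector, `e b` is the scalar `g(c)`. That `(EF)²` kills the image says `c² g(c) p =
    -- 0`, and then already `c g(c) p = 0`.
    have h2 := (D.inZ_e_smul b p).sq
    rw [e_smul, D.idem_smul_of_weight h, h1, smul_comm D.EF (_ : k), hc, smul_comm D.EF (_ : k),
      smul_comm D.EF (_ : k), hc, smul_smul, smul_smul] at h2
    rw [e_smul, D.idem_smul_of_weight h, h1, smul_comm D.EF (_ : k), hc, smul_smul]
    rcases smul_eq_zero.mp h2 with h3 | h3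
    · rcases mul_eq_zero.mp h3 with h4 | h4
      · rcases mul_eq_zero.mp h4 with h5 | h5 <;> simp [h5]
      · simp [h4]
    · simp [h3]
  · rw [e_smul, D.idem_smul_of_weight_ne h hb, smul_zero, smul_zero]

end QData
end

/-! ### Chain modules and the classification of the simple modules. -/

noncomputable section

set_option linter.unusedSectionVars false

namespace FDMod

variable {k H : Type u} [Field k] [Ring H] [Algebra k H]

/-- The underlying module of `FDMod.of X` is `X`. -/
def ofEquiv (X : Type u) [AddCommGroup X] [Module k X] [Module H X] [IsScalarTower k H X]
    [FiniteDimensional k X] : X ≃ₗ[H] (of (k := k) (H := H) X).carrier :=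
  { LinearEquiv.refl k X with map_smul' := fun _ _ => rfl }

theorem sum_smul (M N : FDMod k H) (h : H) (a : M.carrier) (b : N.carrier) :
    (h • (show (sum M N).carrier from (a, b)) : (sum M N).carrier) = (h • a, h • b) := rfl

/-- This is the finite direct sum with the sum of the given maps, recorded only through what is
needed later: its class, its dimension, and a range containing all the given ranges. -/
theorem exists_cover {B : QuasiBialgebra k H} {X : FDMod k H} {ι : Type*} (s : Finset ι)
    (A : ι → FDMod k H) (f : ∀ i, (A i).carrier →ₗ[H] X.carrier) :
    ∃ Q : FDMod k H, B.cls Q = ∑ i ∈ s, B.cls (A i) ∧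
      Module.finrank k Q.carrier = ∑ i ∈ s, Module.finrank k (A i).carrier ∧
      ∃ g : Q.carrier →ₗ[H] X.carrier, ∀ i ∈ s, LinearMap.range (f i) ≤ LinearMap.range g := by
  classical
  induction s using Finset.induction_on with
  | empty =>
    let Q : FDMod k H := of (k := k) (H := H) PUnit.{u + 1}
    have : Subsingleton Q.carrier := inferInstanceAs (Subsingleton PUnit.{u + 1})
    exact ⟨Q, by rw [B.cls_eq_zero_of_subsingleton]; simp, by simp [Module.finrank_zero_of_subsingleton],
      0, by simp⟩
  | insert i s hi ih =>
    obtain ⟨Q, h1, h2, g, hg⟩ := ih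
    refine ⟨sum (A i) Q, ?_, ?_, ?_⟩
    · rw [B.cls_sum, h1, Finset.sum_insert hi]
    · rw [Finset.sum_insert hi, ← h2]
      exact Module.finrank_prod
    · let g' : (sum (A i) Q).carrier →ₗ[H] X.carrier :=
        { toFun := fun p => f i p.1 + g p.2
          map_add' := fun p p' => by
            change f i (p.1 + p'.1) + g (p.2 + p'.2) = _
            rw [map_add, map_add]; abel
          map_smul' := fun h p => by
            change f i (h • p.1) + g (h • p.2) = h • (f i p.1 + g p.2)
            rw [map_smul, map_smul, smul_add] }
      refine ⟨g', fun j hj => ?_⟩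
      rcases Finset.mem_insert.mp hj with rfl | hj
      · rintro _ ⟨x, rfl⟩
        exact ⟨(x, 0), show f j x + g 0 = _ by rw [map_zero, add_zero]⟩
      · rintro _ ⟨x, rfl⟩
        obtain ⟨y, hy⟩ := hg j hj ⟨x, rfl⟩
        exact ⟨(0, y), show f i 0 + g y = _ by rw [map_zero, zero_add, hy]⟩

/-- The isomorphisms with tensor products below are obtained in this way: a surjection together with
an upper bound on the dimension of its source. -/
theorem cls_eq_of_surjective (B : QuasiBialgebra k H) {M N : FDMod k H}
    (f : M.carrier →ₗ[H] N.carrier) (hf : Function.Surjective f)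
    (hd : Module.finrank k M.carrier ≤ Module.finrank k N.carrier) : B.cls M = B.cls N := by
  let f' : M.carrier →ₗ[k] N.carrier := f.restrictScalars k
  have hd' : Module.finrank k M.carrier = Module.finrank k N.carrier :=
    le_antisymm hd (LinearMap.finrank_le_finrank_of_surjective (f := f') hf)
  have hi : Function.Injective f :=
    (LinearMap.injective_iff_surjective_of_finrank_eq_finrank (f := f') hd').mpr hf
  exact B.cls_eq_of_equiv (LinearEquiv.ofBijective f ⟨hi, hf⟩)

end FDMod

namespace QData

variable {k : Type u} [Field k] (D : QData k)
  {X : Type u} [AddCommGroup X] [Module k X] [Module D.U X] [IsScalarTower k D.U X]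

/-! ### Modules with a chain basis -/

section chain

/-- The vector `v_j`, which is zero for `j ≥ d`. -/
def bv (k : Type u) [Field k] (d j : ℕ) : Fin d → k := fun i => if i.val = j then 1 else 0

/-- The `j`-th coordinate, which is zero for `j ≥ d`. -/
def nth {k : Type u} [Field k] {d : ℕ} (v : Fin d → k) (j : ℕ) : k :=
  if h : j < d then v ⟨j, h⟩ else 0

theorem bv_eq_zero {d j : ℕ} (h : d ≤ j) : bv k d j = 0 := by
  ext i
  rw [bv, if_neg (by omega)]; rfl

theorem bv_ne_zero {d j : ℕ} (h : j < d) : bv k d j ≠ 0 := by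
  intro h'
  simpa [bv] using congrFun h' ⟨j, h⟩

theorem nth_ext {d : ℕ} {v w : Fin d → k} (h : ∀ j < d, nth v j = nth w j) : v = w := by
  ext j
  simpa [nth] using h j.val j.isLt

theorem nth_smul {d : ℕ} (c : k) (v : Fin d → k) (j : ℕ) : nth (c • v) j = c * nth v j := by
  rw [nth, nth]; split_ifs <;> simp

theorem nth_add {d : ℕ} (v w : Fin d → k) (j : ℕ) : nth (v + w) j = nth v j + nth w j := by
  rw [nth, nth, nth]; split_ifs <;> simp

theorem nth_bv {d i j : ℕ} (h : j < d) : nth (bv k d i) j = if j = i then 1 else 0 := by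
  rw [nth, dif_pos h, bv]

variable {d : ℕ} {lam : k} {γ : ℕ → k} (h : URel D.n D.q (D.mats d lam γ))

theorem chain_E_bv (j : ℕ) :
    (D.E • (show (D.chain d lam γ h).carrier from bv k d j) : (D.chain d lam γ h).carrier) =
      bv k d (j + 1) := by
  refine (D.chain_gen d lam γ h .E _).trans ?_
  refine funext fun (i : Fin d) => ?_
  simp only [mats, matE, Matrix.mulVec, dotProduct, Matrix.of_apply, bv]
  rcases lt_or_ge j d with hj | hj
  · rw [Finset.sum_eq_single ⟨j, hj⟩]
    · simp
    · intro l _ hl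
      rw [if_neg (c := l.val = j) (fun h' => hl (Fin.ext h')), mul_zero]
    · simp
  · rw [Finset.sum_eq_zero, if_neg (by omega)]
    intro l _
    rw [if_neg (c := l.val = j) (by omega), mul_zero]

theorem chain_F_bv_succ (j : ℕ) (hj : j + 1 < d) :
    (D.F • (show (D.chain d lam γ h).carrier from bv k d (j + 1)) : (D.chain d lam γ h).carrier) =
      γ (j + 1) • bv k d j := by
  refine (D.chain_gen d lam γ h .F _).trans ?_
  refine funext fun (i : Fin d) => ?_
  simp only [mats, matF, Matrix.mulVec, dotProduct, Matrix.of_apply, bv, Pi.smul_apply]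
  rw [Finset.sum_eq_single ⟨j + 1, hj⟩]
  · simp
  · intro l _ hl
    rw [if_neg (c := l.val = j + 1) (fun h' => hl (Fin.ext h')), mul_zero]
  · simp

theorem chain_F_bv_zero :
    (D.F • (show (D.chain d lam γ h).carrier from bv k d 0) : (D.chain d lam γ h).carrier) = 0 := by
  refine (D.chain_gen d lam γ h .F _).trans ?_
  refine funext fun (i : Fin d) => ?_
  simp only [mats, matF, Matrix.mulVec, dotProduct, Matrix.of_apply, bv]
  refine Finset.sum_eq_zero fun l _ => ?_
  by_cases hl : l.val = 0
  · rw [if_neg (by omega), zero_mul]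
  · rw [if_neg hl, mul_zero]

theorem chain_K_bv (j : ℕ) :
    (D.K • (show (D.chain d lam γ h).carrier from bv k d j) : (D.chain d lam γ h).carrier) =
      (lam * D.q ^ (2 * j)) • bv k d j := by
  refine (D.chain_gen d lam γ h .K _).trans ?_
  refine funext fun (i : Fin d) => ?_
  simp only [mats, matK, Matrix.mulVec_diagonal, bv, Pi.smul_apply]
  split_ifs with hi
  · rw [hi]; rfl
  · simp

/-- This identifies the modules `V₂` and `VV t r` with modules `S s` by comparing parameters. Only
the scalars with index below `d` enter the matrices. -/
theorem chain_congr {d' : ℕ} {lam' : k} {γ' : ℕ → k} (h' : URel D.n D.q (D.mats d' lam' γ'))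
    (hd : d = d') (hl : lam = lam') (hγ : ∀ j < d, γ j = γ' j) :
    D.chain d lam γ h = D.chain d' lam' γ' h' := by
  subst hd hl
  have h1 : D.mats d lam γ = D.mats d lam γ' := by
    ext g i j
    cases g
    · rfl
    · simp only [mats, matF, Matrix.of_apply]
      rw [hγ j.val j.isLt]
    · rfl
    · rfl
  have h2 : ∀ (g g' : UGen → Matrix (Fin d) (Fin d) k) (hg : URel D.n D.q g)
      (hg' : URel D.n D.q g'), g = g' → D.lift g hg = D.lift g' hg' := by
    rintro g _ hg hg' rfl; rfl
  rw [chain, chain, h2 _ _ h h' h1]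

end chain

/-! ### The simple modules -/

theorem S_rel (s : ZMod D.m) : URel D.n D.q (D.mats (D.ell s) (D.χ s) (D.gam s)) := by
  refine D.mats_rel _ (D.ell_le s) _ _ (D.χ_ne_zero s) (D.χ_pow_m s) (D.gam_zero s) (D.gam_ell s) ?_
  intro j _
  rw [gam_sub_gam_succ, χ_add, χ_two_n_mul]

/-- The simple module of lowest weight `s`. -/
def S (s : ZMod D.m) : FDMod k D.U := D.chain (D.ell s) (D.χ s) (D.gam s) (D.S_rel s)

/-- The basis vectors of `S s`; `lv s j = 0` for `j ≥ ell s`. -/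
def lv (s : ZMod D.m) (j : ℕ) : (D.S s).carrier := bv k (D.ell s) j

/-- The coordinates on `S s`. -/
def lc (s : ZMod D.m) (j : ℕ) : (D.S s).carrier →ₗ[k] k where
  toFun v := nth (d := D.ell s) v j
  map_add' v w := nth_add (d := D.ell s) v w j
  map_smul' c v := nth_smul (d := D.ell s) c v j

theorem finrank_S (s : ZMod D.m) : Module.finrank k (D.S s).carrier = D.ell s :=
  (Module.finrank_fin_fun k : Module.finrank k (Fin (D.ell s) → k) = _)

theorem lv_eq_zero (s : ZMod D.m) {j : ℕ} (h : D.ell s ≤ j) : D.lv s j = 0 := bv_eq_zero h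

theorem lv_ne_zero (s : ZMod D.m) {j : ℕ} (h : j < D.ell s) : D.lv s j ≠ 0 := bv_ne_zero h

theorem lc_lv (s : ZMod D.m) {i j : ℕ} (h : j < D.ell s) :
    D.lc s j (D.lv s i) = if j = i then 1 else 0 := nth_bv h

theorem S_ext (s : ZMod D.m) {v w : (D.S s).carrier} (h : ∀ j < D.ell s, D.lc s j v = D.lc s j w) :
    v = w := nth_ext (d := D.ell s) h

theorem eq_sum_lv (s : ZMod D.m) (v : (D.S s).carrier) :
    v = ∑ i ∈ Finset.range (D.ell s), D.lc s i v • D.lv s i := by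
  apply D.S_ext
  intro j hj
  rw [map_sum, Finset.sum_eq_single j]
  · rw [map_smul, D.lc_lv s hj, if_pos rfl, smul_eq_mul, mul_one]
  · intro i _ hij
    rw [map_smul, D.lc_lv s hj, if_neg hij.symm, smul_zero]
  · intro h; exact absurd (Finset.mem_range.mpr hj) h

theorem S_hom_ext (s : ZMod D.m) {Y : Type*} [AddCommGroup Y] [Module k Y]
    {f g : (D.S s).carrier →ₗ[k] Y} (h : ∀ j, f (D.lv s j) = g (D.lv s j)) : f = g := by
  ext v
  rw [D.eq_sum_lv s v, map_sum, map_sum]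
  exact Finset.sum_congr rfl fun i _ => by rw [map_smul, map_smul, h]

theorem E_lv (s : ZMod D.m) (j : ℕ) : D.E • D.lv s j = D.lv s (j + 1) := D.chain_E_bv _ j

theorem F_lv_zero (s : ZMod D.m) : D.F • D.lv s 0 = 0 := D.chain_F_bv_zero _

theorem F_lv_succ (s : ZMod D.m) (j : ℕ) (hj : j < D.ell s) :
    D.F • D.lv s (j + 1) = D.gam s (j + 1) • D.lv s j := by
  rcases Nat.lt_or_ge (j + 1) (D.ell s) with h | h
  · exact D.chain_F_bv_succ _ j h
  · rw [D.lv_eq_zero s h, show j + 1 = D.ell s by omega, gam_ell, zero_smul, smul_zero]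

theorem K_lv (s : ZMod D.m) (j : ℕ) : D.K • D.lv s j = D.χ (s + 2 * D.n * j) • D.lv s j := by
  rw [χ_add, χ_two_n_mul]
  exact D.chain_K_bv _ j

theorem E_pow_lv (s : ZMod D.m) (i j : ℕ) : D.E ^ i • D.lv s j = D.lv s (j + i) := by
  induction i with
  | zero => simp
  | succ i ih => rw [pow_succ', mul_smul, ih, E_lv, add_assoc]

/-- The action of an algebra element as a linear map. -/
abbrev lsm (X : Type u) [AddCommGroup X] [Module k X] [Module D.U X] [IsScalarTower k D.U X]
    (u : D.U) : X →ₗ[k] X := Algebra.lsmul k k X u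

/-- `E` raises indices, so the lowest coordinate factors through the quotient by the image of `E`;
in `Strung.surjective` this reduces everything to the string. -/
theorem lc_zero_E (s : ZMod D.m) (v : (D.S s).carrier) : D.lc s 0 (D.E • v) = 0 := by
  refine LinearMap.congr_fun (D.S_hom_ext s (f := D.lc s 0 ∘ₗ D.lsm _ D.E) (g := 0) fun j => ?_) v
  change D.lc s 0 (D.E • D.lv s j) = 0
  rw [E_lv, D.lc_lv s (D.ell_pos s), if_neg (Nat.succ_ne_zero j).symm]

theorem lc_F (s : ZMod D.m) {i : ℕ} (hi : i < D.ell s) (v : (D.S s).carrier) :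
    D.lc s i (D.F • v) = D.gam s (i + 1) * D.lc s (i + 1) v := by
  refine LinearMap.congr_fun (D.S_hom_ext s (f := D.lc s i ∘ₗ D.lsm _ D.F)
    (g := D.gam s (i + 1) • D.lc s (i + 1)) fun j => ?_) v
  change D.lc s i (D.F • D.lv s j) = D.gam s (i + 1) * D.lc s (i + 1) (D.lv s j)
  rcases Nat.lt_or_ge (i + 1) (D.ell s) with h | h
  · rw [D.lc_lv s h]
    cases j with
    | zero => rw [F_lv_zero, map_zero, if_neg (Nat.succ_ne_zero i), mul_zero]
    | succ j =>
      rcases Nat.lt_or_ge j (D.ell s) with hj | hj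
      · rw [D.F_lv_succ s j hj, map_smul, D.lc_lv s hi]
        by_cases hij : i = j
        · subst hij; simp
        · rw [if_neg hij, if_neg (by omega)]; simp
      · rw [D.lv_eq_zero s (by omega), smul_zero, map_zero, if_neg (by omega), mul_zero]
  · rw [show i + 1 = D.ell s by omega, gam_ell, zero_mul]
    cases j with
    | zero => rw [F_lv_zero, map_zero]
    | succ j =>
      rcases Nat.lt_or_ge j (D.ell s) with hj | hj
      · rw [D.F_lv_succ s j hj, map_smul, D.lc_lv s hi]
        by_cases hij : i = j
        · subst hij; rw [show i + 1 = D.ell s by omega, gam_ell, zero_smul]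
        · rw [if_neg hij, smul_zero]
      · rw [D.lv_eq_zero s (by omega), smul_zero, map_zero]

theorem lc_K (s : ZMod D.m) {i : ℕ} (hi : i < D.ell s) (v : (D.S s).carrier) :
    D.lc s i (D.K • v) = D.χ (s + 2 * D.n * i) * D.lc s i v := by
  refine LinearMap.congr_fun (D.S_hom_ext s (f := D.lc s i ∘ₗ D.lsm _ D.K)
    (g := D.χ (s + 2 * D.n * i) • D.lc s i) fun j => ?_) v
  change D.lc s i (D.K • D.lv s j) = D.χ (s + 2 * D.n * i) * D.lc s i (D.lv s j)
  rw [K_lv, map_smul, D.lc_lv s hi]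
  by_cases hij : i = j
  · subst hij; rfl
  · rw [if_neg hij, smul_zero, mul_zero]

theorem EF_lv (s : ZMod D.m) (j : ℕ) : D.EF • D.lv s j = D.gam s j • D.lv s j := by
  rw [EF_smul]
  cases j with
  | zero => rw [F_lv_zero, smul_zero, gam_zero, zero_smul]
  | succ j =>
    rcases Nat.lt_or_ge j (D.ell s) with hj | hj
    · rw [D.F_lv_succ s j hj, smul_comm D.E (_ : k), E_lv]
    · rw [D.lv_eq_zero s (by omega), smul_zero, smul_zero, smul_zero]

theorem lc_EF (s : ZMod D.m) {i : ℕ} (hi : i < D.ell s) (v : (D.S s).carrier) :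
    D.lc s i (D.EF • v) = D.gam s i * D.lc s i v := by
  refine LinearMap.congr_fun (D.S_hom_ext s (f := D.lc s i ∘ₗ D.lsm _ D.EF)
    (g := D.gam s i • D.lc s i) fun j => ?_) v
  change D.lc s i (D.EF • D.lv s j) = D.gam s i * D.lc s i (D.lv s j)
  rw [EF_lv, map_smul, D.lc_lv s hi]
  by_cases hij : i = j
  · subst hij; rfl
  · rw [if_neg hij, smul_zero, mul_zero]

theorem inZ_lv (s : ZMod D.m) : D.InZ s (D.lv s 0) := by
  refine ⟨by simpa using D.K_lv s 0, ?_⟩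
  rw [EF_lv, gam_zero, zero_smul, smul_zero]

variable {D} in
-- `EF` is diagonal on `S b` with eigenvalues `gam b j`, which are nonzero for `0 < j < ell b`; its
-- generalised kernel is the lowest line.
theorem InZ.S_eq {s b : ZMod D.m} {v : (D.S b).carrier} (h : D.InZ s v) :
    v = D.lc b 0 v • D.lv b 0 := by
  apply D.S_ext
  intro j hj
  rw [map_smul, D.lc_lv b hj]
  rcases Nat.eq_zero_or_pos j with rfl | h0
  · simp
  · rw [if_neg h0.ne', smul_zero]
    have h1 := congrArg (D.lc b j) h.sq
    rw [D.lc_EF b hj, D.lc_EF b hj, map_zero, mul_eq_zero, mul_eq_zero] at h1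
    have h2 := D.gam_ne_zero_of_lt b h0 hj
    tauto

variable {D} in
theorem InZ.S_eq_zero {s b : ZMod D.m} {v : (D.S b).carrier} (h : D.InZ s v) (hs : s ≠ b) :
    v = 0 := by
  have h1 := h.S_eq
  have h2 := congrArg (D.lc b 0) h.wt
  rw [D.lc_K b (D.ell_pos b), map_smul, Nat.cast_zero, mul_zero, add_zero, smul_eq_mul] at h2
  have h3 : D.lc b 0 v = 0 := by
    by_contra h0
    exact hs (D.χ_inj (mul_right_cancel₀ h0 h2)).symm
  rw [h1, h3, zero_smul]

theorem span_lv (s : ZMod D.m) (N : Submodule D.U (D.S s).carrier) (h : D.lv s 0 ∈ N) : N = ⊤ := by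
  rw [eq_top_iff]
  intro v _
  rw [D.eq_sum_lv s v]
  refine N.sum_mem fun i _ => ?_
  rw [← algebraMap_smul D.U]
  refine N.smul_mem _ ?_
  have := N.smul_mem (D.E ^ i) h
  rwa [E_pow_lv, zero_add] at this

/-- Applying `F` lowers the highest index of a nonzero vector until `F` kills it. Then all its
coordinates except the lowest vanish, since the scalars `gam s j` inside the string are nonzero. -/
theorem lv_mem_of_ne_bot (s : ZMod D.m) (N : Submodule D.U (D.S s).carrier) (hN : N ≠ ⊥) :
    D.lv s 0 ∈ N := by
  have key : ∀ j : ℕ, ∀ v ∈ N, v ≠ 0 → (∀ i, j < i → i < D.ell s → D.lc s i v = 0) →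
      D.lv s 0 ∈ N := by
    have base : ∀ v ∈ N, v ≠ 0 → (∀ i, 0 < i → i < D.ell s → D.lc s i v = 0) →
        D.lv s 0 ∈ N := by
      intro v hv h0 hi
      have h1 : v = D.lc s 0 v • D.lv s 0 := by
        apply D.S_ext
        intro i hi'
        rw [map_smul, D.lc_lv s hi']
        rcases Nat.eq_zero_or_pos i with rfl | hp
        · simp
        · rw [hi i hp hi', if_neg hp.ne', smul_zero]
      have h2 : D.lc s 0 v ≠ 0 := by
        intro h3; rw [h3, zero_smul] at h1; exact h0 h1
      have h3 : D.lv s 0 = algebraMap k D.U (D.lc s 0 v)⁻¹ • v := by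
        rw [algebraMap_smul]
        conv_rhs => rw [h1]
        rw [map_smul, D.lc_lv s (D.ell_pos s), if_pos rfl, smul_eq_mul, mul_one, smul_smul,
          inv_mul_cancel₀ h2, one_smul]
      rw [h3]
      exact N.smul_mem _ hv
    intro j
    induction j with
    | zero => exact base
    | succ j ih =>
      intro v hv h0 hi
      by_cases hF : D.F • v = 0
      · refine base v hv h0 fun i hp hi' => ?_
        obtain ⟨i, rfl⟩ := Nat.exists_eq_succ_of_ne_zero hp.ne'
        have h1 := congrArg (D.lc s i) hF
        rw [D.lc_F s (by omega), map_zero] at h1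
        exact (mul_eq_zero.mp h1).resolve_left (D.gam_ne_zero_of_lt s hp hi')
      · refine ih _ (N.smul_mem D.F hv) hF fun i hp hi' => ?_
        rw [D.lc_F s hi']
        rcases Nat.lt_or_ge (i + 1) (D.ell s) with h | h
        · rw [hi (i + 1) (by omega) h, mul_zero]
        · rw [show i + 1 = D.ell s by omega, gam_ell, zero_mul]
  obtain ⟨v, hv, h0⟩ := N.exists_mem_ne_zero_of_ne_bot hN
  exact key (D.ell s) v hv h0 fun i h1 h2 => absurd h2 (by omega)

instance isSimpleModule_S (s : ZMod D.m) : IsSimpleModule D.U (D.S s).carrier := by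
  have : Nontrivial (D.S s).carrier := ⟨_, _, D.lv_ne_zero s (D.ell_pos s)⟩
  rw [isSimpleModule_iff]
  exact { eq_bot_or_eq_top := fun N => by
            by_cases h : N = ⊥
            · exact Or.inl h
            · exact Or.inr (D.span_lv s N (D.lv_mem_of_ne_bot s N h)) }

/-- The map from `S s` given by a lowest weight vector. -/
def Shom {s : ZMod D.m} {x : X} (hK : D.K • x = D.χ s • x) (hF : D.F • x = 0)
    (hE : D.E ^ D.ell s • x = 0) : (D.S s).carrier →ₗ[D.U] X :=
  let f : (D.S s).carrier →ₗ[k] X :=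
    ∑ i ∈ Finset.range (D.ell s), (D.lc s i).smulRight (D.E ^ i • x)
  have hf : ∀ j, f (D.lv s j) = D.E ^ j • x := by
    intro j
    simp only [f, LinearMap.sum_apply, LinearMap.smulRight_apply]
    rcases Nat.lt_or_ge j (D.ell s) with h | h
    · rw [Finset.sum_eq_single j]
      · rw [D.lc_lv s h, if_pos rfl, one_smul]
      · intro i hi hij
        rw [D.lc_lv s (Finset.mem_range.mp hi), if_neg hij, zero_smul]
      · intro h'; exact absurd (Finset.mem_range.mpr h) h'
    · rw [D.lv_eq_zero s h]
      simp only [map_zero, zero_smul, Finset.sum_const_zero]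
      obtain ⟨r, rfl⟩ := Nat.exists_eq_add_of_le' h
      rw [pow_add, mul_smul, hE, smul_zero]
  { f with
    map_smul' := fun u v => by
      refine D.map_smul_of_gen f ?_ ?_ ?_ u v
      · intro v
        refine LinearMap.congr_fun (D.S_hom_ext s (f := f ∘ₗ D.lsm _ D.E) (g := D.lsm _ D.E ∘ₗ f)
          fun j => ?_) v
        change f (D.E • D.lv s j) = D.E • f (D.lv s j)
        rw [E_lv, hf, hf, pow_succ', mul_smul]
      · intro v
        refine LinearMap.congr_fun (D.S_hom_ext s (f := f ∘ₗ D.lsm _ D.F) (g := D.lsm _ D.F ∘ₗ f)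
          fun j => ?_) v
        change f (D.F • D.lv s j) = D.F • f (D.lv s j)
        cases j with
        | zero => rw [F_lv_zero, hf, pow_zero, one_smul, hF, map_zero]
        | succ j =>
          rcases Nat.lt_or_ge j (D.ell s) with h | h
          · rw [D.F_lv_succ s j h, map_smul, hf, hf, D.F_E_pow_smul hK, EF_smul, hF, smul_zero,
              zero_add, smul_comm (D.E ^ j) (_ : k)]
          · rw [D.lv_eq_zero s (by omega), smul_zero, map_zero, smul_zero]
      · intro v
        refine LinearMap.congr_fun (D.S_hom_ext s (f := f ∘ₗ D.lsm _ D.K) (g := D.lsm _ D.K ∘ₗ f)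
          fun j => ?_) v
        change f (D.K • D.lv s j) = D.K • f (D.lv s j)
        rw [K_lv, map_smul, hf, D.K_E_pow_smul hK] }

theorem Shom_lv {s : ZMod D.m} {x : X} (hK : D.K • x = D.χ s • x) (hF : D.F • x = 0)
    (hE : D.E ^ D.ell s • x = 0) : D.Shom hK hF hE (D.lv s 0) = x := by
  change (∑ i ∈ Finset.range (D.ell s), (D.lc s i).smulRight (D.E ^ i • x)) (D.lv s 0) = x
  simp only [LinearMap.sum_apply, LinearMap.smulRight_apply]
  rw [Finset.sum_eq_single 0]
  · rw [D.lc_lv s (D.ell_pos s), if_pos rfl, one_smul, pow_zero, one_smul]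
  · intro i hi hij
    rw [D.lc_lv s (Finset.mem_range.mp hi), if_neg hij, zero_smul]
  · intro h'; exact absurd (Finset.mem_range.mpr (D.ell_pos s)) h'

/-! ### The submodule generated by a vector of `InZ` -/

/-- The vectors `E^i x` and `E^i F^(n - ell s) x`. -/
def orb (s : ZMod D.m) (x : X) : Fin D.n ⊕ Fin D.n → X :=
  Sum.elim (fun i => D.E ^ i.val • x) (fun i => D.E ^ i.val • D.F ^ (D.n - D.ell s) • x)

theorem smul_mem_span {A : Set X} {u : D.U} (h : ∀ a ∈ A, u • a ∈ Submodule.span k A) (x : X)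
    (hx : x ∈ Submodule.span k A) : u • x ∈ Submodule.span k A := by
  have : Submodule.span k A ≤ (Submodule.span k A).comap (D.lsm X u) := Submodule.span_le.mpr h
  exact this hx

variable {D} in
-- Only stability under `F` is at issue. The bottom vector `F^(n - ell s) x` is killed by `F`; `F x`
-- is a multiple of a power of `E` applied to it, by `InZ.exists_F_eq`; and `F_E_pow_smul` reduces
-- all other cases to these. This is the source of the bound `2n` on the dimension of `P s`.
theorem InZ.smul_mem {s : ZMod D.m} {x : X} (h : D.InZ s x) (u : D.U) :
    u • x ∈ Submodule.span k (Set.range (D.orb s x)) := by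
  have hE1 : ∀ i, D.E ^ i • x ∈ Submodule.span k (Set.range (D.orb s x)) := by
    intro i
    rcases Nat.lt_or_ge i D.n with hi | hi
    · exact Submodule.subset_span ⟨.inl ⟨i, hi⟩, rfl⟩
    · obtain ⟨r, rfl⟩ := Nat.exists_eq_add_of_le' hi
      rw [pow_add, mul_smul, E_pow_n_smul, smul_zero]
      exact zero_mem _
  have hE2 : ∀ i, D.E ^ i • D.F ^ (D.n - D.ell s) • x ∈
      Submodule.span k (Set.range (D.orb s x)) := by
    intro i
    rcases Nat.lt_or_ge i D.n with hi | hi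
    · exact Submodule.subset_span ⟨.inr ⟨i, hi⟩, rfl⟩
    · obtain ⟨r, rfl⟩ := Nat.exists_eq_add_of_le' hi
      rw [pow_add, mul_smul, E_pow_n_smul, smul_zero]
      exact zero_mem _
  have hFx : ∃ c : k, D.F • x = c • D.E ^ (D.n - D.ell s - 1) • D.F ^ (D.n - D.ell s) • x := by
    rcases (D.ell_le s).lt_or_eq with hl | hl
    · have := h.exists_F_eq (D.n - D.ell s - 1) (by omega)
      rwa [show D.n - D.ell s - 1 + 1 = D.n - D.ell s by omega] at this
    · exact ⟨0, by rw [h.F_eq_zero hl, zero_smul]⟩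
  have hFu : D.F • D.F ^ (D.n - D.ell s) • x = 0 := by
    rw [← mul_smul, ← pow_succ', h.F_pow]
  have hwu := D.K_F_pow_smul h.wt (D.n - D.ell s)
  have hx : x ∈ Submodule.span k (Set.range (D.orb s x)) := by simpa using hE1 0
  refine D.smul_mem_of_gen _ (D.smul_mem_span ?_) (D.smul_mem_span ?_) (D.smul_mem_span ?_) u hx
  · rintro _ ⟨i | i, rfl⟩
    · change D.E • D.E ^ i.val • x ∈ _
      rw [← mul_smul, ← pow_succ']; exact hE1 _
    · change D.E • D.E ^ i.val • _ ∈ _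
      rw [← mul_smul, ← pow_succ']; exact hE2 _
  · rintro _ ⟨i | i, rfl⟩
    · change D.F • D.E ^ i.val • x ∈ _
      obtain ⟨c, hc⟩ := hFx
      cases i.val with
      | zero =>
        rw [pow_zero, one_smul, hc]
        exact Submodule.smul_mem _ _ (hE2 _)
      | succ j =>
        rw [D.F_E_pow_smul h.wt, smul_add, EF_smul, hc, smul_comm D.E (_ : k), smul_comm _ (_ : k),
          smul_comm _ (_ : k), ← mul_smul D.E, ← pow_succ', ← mul_smul, ← pow_add]
        exact add_mem (Submodule.smul_mem _ _ (hE2 _)) (Submodule.smul_mem _ _ (hE1 _))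
    · change D.F • D.E ^ i.val • _ ∈ _
      cases i.val with
      | zero => rw [pow_zero, one_smul, hFu]; exact zero_mem _
      | succ j =>
        rw [D.F_E_pow_smul hwu, EF_smul, hFu, smul_zero, zero_add, smul_comm _ (_ : k)]
        exact Submodule.smul_mem _ _ (hE2 _)
  · rintro _ ⟨i | i, rfl⟩
    · change D.K • D.E ^ i.val • x ∈ _
      rw [D.K_E_pow_smul h.wt]; exact Submodule.smul_mem _ _ (hE1 _)
    · change D.K • D.E ^ i.val • _ ∈ _
      rw [D.K_E_pow_smul hwu]; exact Submodule.smul_mem _ _ (hE2 _)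

/-! ### The classification of the simple modules -/

theorem exists_lowest [Nontrivial X] : ∃ (s : ZMod D.m) (x : X), x ≠ 0 ∧ D.K • x = D.χ s • x ∧
    D.F • x = 0 := by
  classical
  obtain ⟨y, hy⟩ := exists_ne (0 : X)
  obtain ⟨t, ht⟩ := D.exists_weight hy
  have hw := D.K_smul_idem_smul t y
  generalize D.idem (-t) • y = x at ht hw
  have hex : ∃ j, D.F ^ j • x = 0 := ⟨D.n, D.F_pow_n_smul x⟩
  have h1 := Nat.find_spec hex
  have h2 : Nat.find hex ≠ 0 := by
    intro h; rw [h, pow_zero, one_smul] at h1; exact ht h1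
  obtain ⟨j, hj⟩ := Nat.exists_eq_succ_of_ne_zero h2
  refine ⟨_, D.F ^ j • x, Nat.find_min hex (by omega), D.K_F_pow_smul hw j, ?_⟩
  rw [← mul_smul, ← pow_succ']
  rwa [hj] at h1

/-- Let `x` be a lowest weight vector. If `E^(ell s) x` were nonzero it would again be killed by
`F`, because `gam` vanishes at `ell s`. It would generate the simple module by powers of `E` alone,
so `E` would be surjective, against nilpotency. Hence it is zero and `Shom` is defined. -/
theorem exists_equiv_S [IsSimpleModule D.U X] :
    ∃ s, Nonempty ((D.S s).carrier ≃ₗ[D.U] X) := by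
  have : Nontrivial X := IsSimpleModule.nontrivial D.U X
  obtain ⟨s, x, hx, hK, hF⟩ := D.exists_lowest (X := X)
  have hE : D.E ^ D.ell s • x = 0 := by
    obtain ⟨r, hr⟩ := Nat.exists_eq_succ_of_ne_zero (D.ell_pos s).ne'
    have hFw : D.F • D.E ^ D.ell s • x = 0 := by
      have h1 := D.gam_ell s
      rw [hr] at h1 ⊢
      rw [D.F_E_pow_smul hK, EF_smul, hF, smul_zero, h1, zero_smul, add_zero, smul_zero]
    have hKw := D.K_E_pow_smul hK (D.ell s)
    by_contra hw
    -- Membership in `InZ` supplies an explicit spanning set of the generated submodule. As `F`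
    -- kills the generator, the second half of that set is zero or repeats the first.
    have hZ : D.InZ _ (D.E ^ D.ell s • x) := ⟨hKw, by rw [EF_smul, EF_smul, hFw]; simp⟩
    have h2 : ∀ y : X, ∃ y', D.E • y' = y := by
      intro y
      have htop : Submodule.span D.U {D.E ^ D.ell s • x} = ⊤ :=
        (eq_bot_or_eq_top _).resolve_left fun h => hw (Submodule.span_singleton_eq_bot.mp h)
      obtain ⟨u, hu⟩ := Submodule.mem_span_singleton.mp (htop ▸ Submodule.mem_top (x := y))
      have h3 : Submodule.span k (Set.range (D.orb (s + 2 * D.n * D.ell s) (D.E ^ D.ell s • x))) ≤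
          LinearMap.range (D.lsm X D.E) := by
        have hw' : D.E ^ D.ell s • x ∈ LinearMap.range (D.lsm X D.E) :=
          ⟨D.E ^ r • x, by
            change D.E • D.E ^ r • x = _
            rw [hr, ← mul_smul, ← pow_succ']⟩
        have h4 : ∀ (i : ℕ) (v : X), v ∈ LinearMap.range (D.lsm X D.E) →
            D.E ^ i • v ∈ LinearMap.range (D.lsm X D.E) := by
          intro i v hv
          cases i with
          | zero => simpa using hv
          | succ i => exact ⟨D.E ^ i • v, by
              change D.E • D.E ^ i • v = _
              rw [← mul_smul, ← pow_succ']⟩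
        rw [Submodule.span_le]
        rintro _ ⟨i | i, rfl⟩
        · exact h4 _ _ hw'
        · refine h4 _ _ ?_
          rcases Nat.eq_zero_or_pos (D.n - D.ell (s + 2 * D.n * D.ell s)) with h5 | h5
          · rw [h5, pow_zero, one_smul]; exact hw'
          · rw [← Nat.sub_add_cancel h5, pow_succ, mul_smul, hFw, smul_zero]
            exact zero_mem _
      rw [← hu]
      exact h3 (hZ.smul_mem u)
    have h3 : ∀ (j : ℕ) (y : X), ∃ y', D.E ^ j • y' = y := by
      intro j
      induction j with
      | zero => intro y; exact ⟨y, by simp⟩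
      | succ j ih =>
        intro y
        obtain ⟨y', hy'⟩ := h2 y
        obtain ⟨y'', hy''⟩ := ih y'
        exact ⟨y'', by rw [pow_succ', mul_smul, hy'', hy']⟩
    obtain ⟨y, hy⟩ := h3 D.n x
    rw [E_pow_n_smul] at hy
    exact hx hy.symm
  refine ⟨s, ⟨LinearEquiv.ofBijective (D.Shom hK hF hE) (LinearMap.bijective_of_ne_zero ?_)⟩⟩
  intro h
  have h1 := D.Shom_lv hK hF hE
  rw [h] at h1
  exact hx h1.symm

end QData
end

/-! ### The modules `P s` and decompositions into them. -/

noncomputable section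

set_option linter.unusedSectionVars false

namespace QData

open Polynomial

variable {k : Type u} [Field k] (D : QData k)
  {X : Type u} [AddCommGroup X] [Module k X] [Module D.U X] [IsScalarTower k D.U X]

/-! ### The indecomposable projective modules -/

theorem span_e_eq (s : ZMod D.m) : (Submodule.span D.U {D.e s}).restrictScalars k ≤
    Submodule.span k (Set.range (D.orb s (D.e s))) := by
  intro x hx
  obtain ⟨u, rfl⟩ := Submodule.mem_span_singleton.mp hx
  exact (D.inZ_e s).smul_mem u

instance (s : ZMod D.m) : FiniteDimensional k (Submodule.span D.U {D.e s}) := by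
  have h2 : FiniteDimensional k (Submodule.span k (Set.range (D.orb s (D.e s)))) :=
    FiniteDimensional.span_of_finite k (Set.finite_range _)
  exact Submodule.finiteDimensional_of_le (D.span_e_eq s)

/-- The projective cover of `S s`: the left ideal generated by the idempotent `e s`. -/
def P (s : ZMod D.m) : FDMod k D.U := FDMod.of (Submodule.span D.U {D.e s})

/-- The generator of `P s`. -/
def pe (s : ZMod D.m) : (D.P s).carrier :=
  FDMod.ofEquiv _ ⟨D.e s, Submodule.mem_span_singleton_self _⟩

theorem exists_smul_pe (s : ZMod D.m) (p : (D.P s).carrier) : ∃ u : D.U, u • D.pe s = p := by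
  obtain ⟨⟨p, hp⟩, rfl⟩ := (FDMod.ofEquiv (k := k) (Submodule.span D.U {D.e s})).surjective p
  obtain ⟨u, rfl⟩ := Submodule.mem_span_singleton.mp hp
  exact ⟨u, rfl⟩

theorem inZ_pe (s : ZMod D.m) : D.InZ s (D.pe s) :=
  ⟨Subtype.ext (D.inZ_e s).wt, Subtype.ext (D.inZ_e s).sq⟩

variable {D} in
/-- The homomorphism from `P s` given by an element of `Z_s`. -/
def InZ.hom {s : ZMod D.m} {x : X} (_h : D.InZ s x) : (D.P s).carrier →ₗ[D.U] X :=
  ((LinearMap.toSpanSingleton D.U X x).domRestrict (Submodule.span D.U {D.e s})).comp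
    (FDMod.ofEquiv (k := k) (Submodule.span D.U {D.e s})).symm.toLinearMap

variable {D} in
theorem InZ.hom_pe {s : ZMod D.m} {x : X} (h : D.InZ s x) : h.hom (D.pe s) = x :=
  h.e_smul

theorem span_orb_pe (s : ZMod D.m) : ⊤ ≤ Submodule.span k (Set.range (D.orb s (D.pe s))) := by
  intro p _
  obtain ⟨u, rfl⟩ := D.exists_smul_pe s p
  exact (D.inZ_pe s).smul_mem u

theorem finrank_P_le (s : ZMod D.m) : Module.finrank k (D.P s).carrier ≤ 2 * D.n := by
  have h := finrank_range_le_card (R := k) (D.orb s (D.pe s))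
  rw [Set.finrank, eq_top_iff.mpr (D.span_orb_pe s), finrank_top, Fintype.card_sum,
    Fintype.card_fin] at h
  omega

theorem finrank_P_le_of_eq (s : ZMod D.m) (hl : D.ell s = D.n) :
    Module.finrank k (D.P s).carrier ≤ D.n := by
  have h := finrank_range_le_card (R := k) (fun i : Fin D.n => D.E ^ i.val • D.pe s)
  have h1 : Submodule.span k (Set.range (fun i : Fin D.n => D.E ^ i.val • D.pe s)) = ⊤ := by
    rw [eq_top_iff]
    refine (D.span_orb_pe s).trans (Submodule.span_mono ?_)
    rintro _ ⟨i | i, rfl⟩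
    · exact ⟨i, rfl⟩
    · exact ⟨i, by simp [orb, hl]⟩
  rwa [Set.finrank, h1, finrank_top, Fintype.card_fin] at h

variable {D} in
theorem InZ.E_pow_F_pow {s : ZMod D.m} {x : X} (h : D.InZ s x) (j : ℕ) (hj : j ≤ D.n) :
    ∃ c : k, D.E ^ (j + 1) • D.F ^ (j + 1) • x = c • D.EF • x := by
  induction j with
  | zero => exact ⟨1, by simp [EF_smul]⟩
  | succ j ih =>
    obtain ⟨c, hc⟩ := ih (by omega)
    have h1 := D.E_F_pow_smul h.wt (j + 1) hj
    have h3 : D.F ^ (j + 1) • D.EF • x = 0 := by rw [pow_succ, mul_smul, h.F_EF, smul_zero]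
    rw [smul_add, h3, zero_add, smul_comm (D.F ^ (j + 1)) (D.gam s _)] at h1
    refine ⟨D.gam s (D.n - (j + 1)) * c, ?_⟩
    rw [pow_succ D.E, mul_smul (D.E ^ (j + 1)), h1, smul_comm (D.E ^ (j + 1)) (_ : k), hc, smul_smul]

/-- In dimension `2n` the spanning vectors of `orb` form a basis. One of them is `E^(n - ell s) F^(n
- ell s)` applied to the generator, and it is a multiple of `EF` applied to the generator. -/
theorem EF_pe_ne_zero {s : ZMod D.m} (hl : D.ell s < D.n)
    (h : Module.finrank k (D.P s).carrier = 2 * D.n) : D.EF • D.pe s ≠ 0 := by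
  intro h0
  have hli := linearIndependent_of_top_le_span_of_card_eq_finrank (D.span_orb_pe s)
    (by rw [h, Fintype.card_sum, Fintype.card_fin]; omega)
  have h1 := D.ell_pos s
  refine hli.ne_zero (.inr ⟨D.n - D.ell s, by omega⟩) ?_
  obtain ⟨c, hc⟩ := (D.inZ_pe s).E_pow_F_pow (D.n - D.ell s - 1) (by omega)
  rw [show D.n - D.ell s - 1 + 1 = D.n - D.ell s by omega, h0, smul_zero] at hc
  exact hc

theorem commute_e_EF (s : ZMod D.m) : Commute (D.e s) D.EF :=
  ((D.commute_aeval_EF (Commute.refl _) _).symm).mul_left (D.idem_mul_EF (-s))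

theorem EF_E_pow_smul {s : ZMod D.m} {x : X} (h : D.K • x = D.χ s • x) (i : ℕ) :
    D.EF • D.E ^ i • x = D.E ^ i • D.EF • x + D.gam s i • D.E ^ i • x := by
  cases i with
  | zero => simp [gam_zero]
  | succ i =>
    rw [EF_smul, D.F_E_pow_smul h, ← mul_smul, ← pow_succ', smul_add,
      smul_comm (D.E ^ (i + 1)) (_ : k)]

variable {D} in
-- This makes the rank of `EF · e s` vanish on `P b` for `b ≠ s`. On the spanning vectors of weight
-- `s` there are two cases: either the vector is an eigenvector of `EF`, and `EF_e_smul_eq_zero`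
-- applies, or a polynomial in `EF` with nonzero roots kills it, and then so does `e s`.
theorem InZ.EF_e_smul {s b : ZMod D.m} {x : X} (h : D.InZ b x) (hs : s ≠ b) (u : D.U) :
    D.EF • D.e s • u • x = 0 := by
  have hFu : D.F • D.F ^ (D.n - D.ell b) • x = 0 := by
    rw [← mul_smul, ← pow_succ', h.F_pow]
  have hwu := D.K_F_pow_smul h.wt (D.n - D.ell b)
  have hEFu : ∀ i, D.EF • D.E ^ i • D.F ^ (D.n - D.ell b) • x =
      D.gam (b - 2 * D.n * ((D.n - D.ell b : ℕ) : ZMod D.m)) i •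
        D.E ^ i • D.F ^ (D.n - D.ell b) • x := by
    intro i
    rw [D.EF_E_pow_smul hwu, EF_smul, hFu]; simp
  have key : Submodule.span k (Set.range (D.orb b x)) ≤
      LinearMap.ker (D.lsm X (D.EF * D.e s)) := by
    rw [Submodule.span_le]
    rintro _ ⟨⟨i, hi⟩ | i, rfl⟩
    · change (D.EF * D.e s) • D.E ^ i • x = 0
      rw [mul_smul]
      have hw := D.K_E_pow_smul h.wt i
      by_cases hsi : b + 2 * D.n * i = s
      · have hi0 : 0 < i := by
          rcases Nat.eq_zero_or_pos i with rfl | h0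
          · simp at hsi; exact absurd hsi.symm hs
          · exact h0
        have hEF := D.EF_E_pow_smul h.wt i
        -- If `ell b < n`, then `EF x` is a multiple of `E^(n - ell b) F^(n - ell b) x`, and
        -- applying `E^i` brings the exponent of `E` to at least `n`. If `ell b = n`, already `F x =
        -- 0`.
        have hw0 : (D.ell b = D.n ∨ D.ell b ≤ i) → D.E ^ i • D.EF • x = 0 := by
          intro h'
          rcases (D.ell_le b).lt_or_eq with hl | hl
          · obtain ⟨c, hc⟩ := h.exists_F_eq (D.n - D.ell b - 1) (by omega)
            obtain ⟨r, hr⟩ : ∃ r, i + 1 + (D.n - D.ell b - 1) = r + D.n :=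
              ⟨i + 1 + (D.n - D.ell b - 1) - D.n, by omega⟩
            rw [EF_smul, hc, smul_comm D.E (_ : k), smul_comm _ (_ : k), ← mul_smul, ← mul_smul,
              mul_assoc, ← pow_succ', ← pow_add, show i + (D.n - D.ell b - 1 + 1) = r + D.n by omega,
              pow_add, D.gen_rel.E_pow, mul_zero, zero_smul, smul_zero]
          · rw [EF_smul, h.F_eq_zero hl, smul_zero, smul_zero]
        by_cases h' : D.ell b = D.n ∨ D.ell b ≤ i
        · rw [hw0 h', zero_add] at hEF
          exact D.EF_e_smul_eq_zero s hw hEF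
        · push Not at h'
          obtain ⟨hl, hil⟩ := h'
          have hl' := lt_of_le_of_ne (D.ell_le b) hl
          have hg := D.gam_ne_zero_of_lt b hi0 hil
          have hbu : b - 2 * D.n * ((D.n - D.ell b : ℕ) : ZMod D.m) = b + 2 * D.n * D.ell b := by
            rw [Nat.cast_sub (D.ell_le b), mul_sub, two_n_mul_n]; ring
          have hg' := D.gam_ne_zero (b + 2 * D.n * D.ell b) (j := i + (D.n - D.ell b))
            (by omega) (by omega) (by rw [D.ell_add_ell hl']; omega)
          rw [hbu] at hEFu
          obtain ⟨c, hc⟩ := h.exists_F_eq (D.n - D.ell b - 1) (by omega)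
          rw [show D.n - D.ell b - 1 + 1 = D.n - D.ell b by omega] at hc
          have hwE : D.E ^ i • D.EF • x =
              c • D.E ^ (i + (D.n - D.ell b)) • D.F ^ (D.n - D.ell b) • x := by
            rw [EF_smul, hc, smul_comm D.E (_ : k), smul_comm _ (_ : k), ← mul_smul, ← mul_smul,
              mul_assoc, ← pow_succ', ← pow_add,
              show i + (D.n - D.ell b - 1 + 1) = i + (D.n - D.ell b) by omega]
          -- The operator `EF - gam b i` sends `E^i x` to a multiple of a vector in the string of
          -- the bottom vector, an eigenvector of `EF`. Its eigenvalue is a value of `gam` at the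
          -- linked weight, nonzero by `ell_add_ell`.
          have h2 : aeval D.EF ((Polynomial.X + C (-D.gam (b + 2 * D.n * D.ell b)
              (i + (D.n - D.ell b)))) * (Polynomial.X + C (-D.gam b i))) • D.E ^ i • x = 0 := by
            have inner : (D.EF + algebraMap k D.U (-D.gam b i)) • D.E ^ i • x =
                D.E ^ i • D.EF • x := by
              rw [add_smul, hEF, algebraMap_smul, neg_smul, add_neg_cancel_right]
            rw [map_mul, mul_smul, map_add, map_add, aeval_X, aeval_C, aeval_C, inner, hwE,
              add_smul, algebraMap_smul, smul_comm D.EF (_ : k), hEFu, smul_comm _ c, neg_smul,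
              smul_neg, add_neg_cancel]
          have h3 : D.e s • D.E ^ i • x = 0 := by
            refine (D.inZ_e_smul s _).eq_zero_of_aeval (IsCoprime.mul_right
              (isCoprime_X_add_C (neg_ne_zero.mpr hg')) (isCoprime_X_add_C (neg_ne_zero.mpr hg))) ?_
            rw [← mul_smul, ← (D.commute_aeval_EF (D.commute_e_EF s) _).eq, mul_smul, h2, smul_zero]
          rw [h3, smul_zero]
      · rw [D.e_smul, D.idem_smul_of_weight_ne hw hsi, smul_zero, smul_zero]
    · change (D.EF * D.e s) • D.E ^ i.val • D.F ^ (D.n - D.ell b) • x = 0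
      rw [mul_smul]
      exact D.EF_e_smul_eq_zero s (D.K_E_pow_smul hwu i) (hEFu i)
  rw [← mul_smul]
  exact key (h.smul_mem u)

/-! ### Decomposition into projective modules -/

instance (X : FDMod k D.U) : Module.Finite D.U X.carrier :=
  Module.Finite.of_restrictScalars_finite k D.U X.carrier

theorem exists_hom_S {X : FDMod k D.U} (N : Submodule D.U X.carrier) (hN : N ≠ ⊤) :
    ∃ b, ∃ f : X.carrier →ₗ[D.U] (D.S b).carrier, Function.Surjective f ∧ ∀ x ∈ N, f x = 0 := by
  obtain ⟨M, hM, hNM⟩ := (eq_top_or_exists_le_coatom N).resolve_left hN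
  have hs : IsSimpleModule D.U (X.carrier ⧸ M) := isSimpleModule_iff_isCoatom.mpr hM
  obtain ⟨b, ⟨e⟩⟩ := D.exists_equiv_S (X := X.carrier ⧸ M)
  refine ⟨b, e.symm.toLinearMap.comp M.mkQ, e.symm.surjective.comp M.mkQ_surjective, fun x hx => ?_⟩
  have : M.mkQ x = 0 := (Submodule.Quotient.mk_eq_zero M).mpr (hNM hx)
  rw [LinearMap.comp_apply, this, map_zero]

/-- A module that is generated by the strings of weight vectors `z_0, …, z_(l-1)` under `E`. -/
structure Strung (X : FDMod k D.U) (l : ℕ) (a : ZMod D.m) (z : ℕ → X.carrier) : Prop where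
  wt : ∀ i < l, D.K • z i = D.χ (a + 2 * D.n * i) • z i
  F : ∀ i, i + 1 < l → ∃ c : k, z i = c • D.F • z (i + 1)
  gen : ∀ x, ∃ y, ∃ c : ℕ → k, x = D.E • y + ∑ i ∈ Finset.range l, c i • z i
  dim : Module.finrank k X.carrier = D.n * l

/-- The indices of the indecomposable summands of a module as in `Strung`. -/
def heads (l : ℕ) (a : ZMod D.m) : Finset ℕ :=
  (Finset.range l).filter fun i => l ≤ i + D.ell (a + 2 * D.n * i)

theorem mem_heads {l : ℕ} {a : ZMod D.m} {i : ℕ} :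
    i ∈ D.heads l a ↔ i < l ∧ l ≤ i + D.ell (a + 2 * D.n * i) := by
  rw [heads, Finset.mem_filter, Finset.mem_range]

variable {D} in
theorem Strung.F_pow {X : FDMod k D.U} {l : ℕ} {a : ZMod D.m} {z : ℕ → X.carrier}
    (h : D.Strung X l a z) (i r : ℕ) (hr : i + r < l) : ∃ c : k, z i = c • D.F ^ r • z (i + r) := by
  induction r with
  | zero => exact ⟨1, by simp⟩
  | succ r ih =>
    obtain ⟨c, hc⟩ := ih (by omega)
    obtain ⟨c', hc'⟩ := h.F (i + r) (by omega)
    refine ⟨c * c', ?_⟩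
    rw [hc, hc', smul_comm _ c', ← mul_smul (D.F ^ r), ← pow_succ, mul_smul]
    rfl

variable {D} in
-- Were `N` proper, some `f` would map `X` onto an `S b` and kill `N`. The lowest coordinate ignores
-- the image of `E`, so it is nonzero on some `f (z i)`, and `z i` has weight `b`. If `i` is not a
-- head, `z i` lies in the image of `F^(ell b)`, which is zero on `S b`. If `i` is a head, `e b`
-- fixes the nonzero vector `f (z i)`, yet `e b • z i` lies in `N`.
theorem Strung.surjective {X : FDMod k D.U} {l : ℕ} {a : ZMod D.m} {z : ℕ → X.carrier}
    (h : D.Strung X l a z) (N : Submodule D.U X.carrier)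
    (hN : ∀ i ∈ D.heads l a, D.e (a + 2 * D.n * i) • z i ∈ N) : N = ⊤ := by
  by_contra hne
  obtain ⟨b, f, hf, hfN⟩ := D.exists_hom_S N hne
  obtain ⟨x, hx⟩ := hf (D.lv b 0)
  obtain ⟨y, c, rfl⟩ := h.gen x
  have h1 := congrArg (D.lc b 0) hx
  rw [map_add, map_smul, map_add, D.lc_zero_E, zero_add, map_sum, map_sum,
    D.lc_lv b (D.ell_pos b), if_pos rfl] at h1
  have hk : ∀ (c : k) (v : X.carrier), f (c • v) = c • f v := fun c v => by
    rw [← algebraMap_smul D.U, map_smul, algebraMap_smul]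
  obtain ⟨i, hi, h2⟩ := Finset.exists_ne_zero_of_sum_ne_zero (h1 ▸ one_ne_zero)
  have hil := Finset.mem_range.mp hi
  rw [hk, map_smul, smul_eq_mul] at h2
  have h3 : D.lc b 0 (f (z i)) ≠ 0 := right_ne_zero_of_mul h2
  have hwt : D.K • f (z i) = D.χ (a + 2 * D.n * i) • f (z i) := by
    rw [← map_smul, h.wt i hil, hk]
  have hb : b = a + 2 * D.n * i := by
    have h4 := congrArg (D.lc b 0) hwt
    rw [D.lc_K b (D.ell_pos b), Nat.cast_zero, mul_zero, add_zero, map_smul, smul_eq_mul] at h4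
    exact D.χ_inj (mul_right_cancel₀ h3 h4)
  by_cases hh : i ∈ D.heads l a
  · have h5 := hfN _ (hN i hh)
    rw [map_smul, ← hb] at h5
    -- The weights along the string of `S b` are distinct because its length does not exceed the
    -- order of `q²`, so weight `b` occurs only at the bottom.
    have h6 : f (z i) = D.lc b 0 (f (z i)) • D.lv b 0 := by
      apply D.S_ext
      intro j hj
      rw [map_smul, D.lc_lv b hj]
      rcases Nat.eq_zero_or_pos j with rfl | h0
      · simp
      · rw [if_neg h0.ne', smul_zero]
        have h4 := congrArg (D.lc b j) hwt
        rw [D.lc_K b hj, map_smul, smul_eq_mul, ← hb] at h4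
        by_contra h7
        have h8 := D.χ_inj (mul_right_cancel₀ h7 h4)
        have h9 : D.χ (2 * D.n * j) = D.χ 0 := by
          congr 1; exact add_eq_left.mp h8
        rw [χ_two_n_mul, χ_zero, pow_mul] at h9
        exact D.prim_q_sq.pow_ne_one_of_pos_of_lt h0.ne' (hj.trans_le (D.ell_le b)) h9
    rw [h6, smul_comm _ (_ : k), (D.inZ_lv b).e_smul] at h5
    exact (smul_ne_zero h3 (D.lv_ne_zero b (D.ell_pos b))) h5
  · have h4 : i + D.ell b < l := by
      rw [mem_heads, ← hb] at hh
      omega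
    obtain ⟨c, hc⟩ := h.F_pow i _ h4
    have h5 : D.F ^ D.ell b • f (z (i + D.ell b)) = 0 := by
      have key : ∀ r, ∀ v : (D.S b).carrier, ∀ j < D.ell b, D.ell b ≤ j + r →
          D.lc b j (D.F ^ r • v) = 0 := by
        intro r
        induction r with
        | zero => intro v j h1 h2; omega
        | succ r ih =>
          intro v j h1 h2
          rw [pow_succ', mul_smul, D.lc_F b h1]
          rcases Nat.lt_or_ge (j + 1) (D.ell b) with h3 | h3
          · rw [ih v (j + 1) h3 (by omega), mul_zero]
          · rw [show j + 1 = D.ell b by omega, gam_ell, zero_mul]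
      apply D.S_ext
      intro j hj
      rw [key _ _ j hj (by omega), map_zero]
    apply h3
    rw [hc, hk, map_smul f, h5, smul_zero, map_zero]

variable {D} in
/-- The decomposition of a module generated by a string into indecomposable projectives. -/
theorem Strung.cls_eq {X : FDMod k D.U} {l : ℕ} {a : ZMod D.m} {z : ℕ → X.carrier}
    (h : D.Strung X l a z)
    (hc : ∀ i ∈ D.heads l a, D.ell (a + 2 * D.n * i) < D.n → D.n ≤ i + D.ell (a + 2 * D.n * i)) :
    D.quasi.cls X = ∑ i ∈ D.heads l a, D.quasi.cls (D.P (a + 2 * D.n * i)) ∧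
      ∀ i ∈ D.heads l a, D.ell (a + 2 * D.n * i) < D.n →
        Module.finrank k (D.P (a + 2 * D.n * i)).carrier = 2 * D.n := by
  classical
  obtain ⟨Q, hQ, hQd, g, hg⟩ := FDMod.exists_cover (B := D.quasi) (D.heads l a)
    (fun i => D.P (a + 2 * D.n * i)) (fun i => (D.inZ_e_smul (a + 2 * D.n * i) (z i)).hom)
  have hsurj : Function.Surjective g := by
    rw [← LinearMap.range_eq_top]
    refine h.surjective _ fun i hi => hg i hi ⟨D.pe _, ?_⟩
    rw [InZ.hom_pe]
  -- These upper bounds for the dimensions add up to at most `n · l`, the dimension of `X`.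
  -- Surjectivity then forces equality for each head, which is the second claim.
  let bd : ℕ → ℕ := fun i => if D.ell (a + 2 * D.n * i) < D.n then 2 * D.n else D.n
  have hbd : ∀ i ∈ D.heads l a, Module.finrank k (D.P (a + 2 * D.n * i)).carrier ≤ bd i := by
    intro i _
    simp only [bd]
    split_ifs with h1
    · exact D.finrank_P_le _
    · exact D.finrank_P_le_of_eq _ (le_antisymm (D.ell_le _) (not_lt.mp h1))
  have hcount : ∑ i ∈ D.heads l a, bd i ≤ D.n * l := by
    let A : Finset ℕ := (D.heads l a).filter fun i : ℕ => D.ell (a + 2 * D.n * i) < D.n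
    let Bf : Finset ℕ := (Finset.range l).filter fun i : ℕ => ¬ l ≤ i + D.ell (a + 2 * D.n * i)
    -- A head `i` with `ell < n` is sent to `i + ell - n`. That index carries the linked weight, of
    -- dimension `n - ell`, and is not a head because `(i + ell - n) + (n - ell) = i < l`. Since the
    -- linked dimension determines `ell`, the map is injective.
    have hAB : A.card ≤ Bf.card := by
      have hA : ∀ i ∈ A, i < l ∧ D.ell (a + 2 * D.n * i) < D.n ∧
          D.n ≤ i + D.ell (a + 2 * D.n * i) := by
        intro i hi
        obtain ⟨h1, h2⟩ := Finset.mem_filter.mp hi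
        exact ⟨(D.mem_heads.mp h1).1, h2, hc i h1 h2⟩
      have hB : ∀ i ∈ A, D.ell (a + 2 * D.n * ((i + D.ell (a + 2 * D.n * i) - D.n : ℕ) : ZMod D.m)) =
          D.n - D.ell (a + 2 * D.n * i) := by
        intro i hi
        obtain ⟨_, h2, h3⟩ := hA i hi
        rw [← D.ell_add_ell h2]
        congr 1
        rw [Nat.cast_sub h3, Nat.cast_add, mul_sub, two_n_mul_n]
        ring
      refine Finset.card_le_card_of_injOn (fun i => i + D.ell (a + 2 * D.n * i) - D.n) ?_ ?_
      · intro i hi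
        obtain ⟨h1, h2, h3⟩ := hA i hi
        refine Finset.mem_filter.mpr ⟨Finset.mem_range.mpr ?_, ?_⟩
        · simp only; omega
        · simp only; rw [hB i hi]; omega
      · intro i hi j hj hij
        simp only at hij
        have h1 := hB i hi
        have h2 := hB j hj
        rw [hij] at h1
        obtain ⟨_, h3, h4⟩ := hA i hi
        obtain ⟨_, h5, h6⟩ := hA j hj
        omega
    have h1 : ∑ i ∈ D.heads l a, bd i = D.n * (D.heads l a).card + D.n * A.card := by
      simp only [bd, A]
      rw [Finset.sum_ite, Finset.sum_const, Finset.sum_const,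
        ← Finset.card_filter_add_card_filter_not (s := D.heads l a)
          (fun i => D.ell (a + 2 * D.n * i) < D.n)]
      simp only [smul_eq_mul]
      ring
    have h2 : (D.heads l a).card + Bf.card = l := by
      simp only [heads, Bf]
      rw [Finset.card_filter_add_card_filter_not, Finset.card_range]
    rw [h1, ← mul_add]
    exact Nat.mul_le_mul_left _ (by omega)
  have hle : Module.finrank k Q.carrier ≤ Module.finrank k X.carrier := by
    rw [hQd, h.dim]
    exact (Finset.sum_le_sum hbd).trans hcount
  refine ⟨by rw [← hQ]; exact (FDMod.cls_eq_of_surjective _ g hsurj hle).symm, ?_⟩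
  have hge : Module.finrank k X.carrier ≤ Module.finrank k Q.carrier :=
    LinearMap.finrank_le_finrank_of_surjective (f := g.restrictScalars k) hsurj
  rw [hQd, h.dim] at hge
  have heq := (Finset.sum_eq_sum_iff_of_le hbd).mp
    (le_antisymm (Finset.sum_le_sum hbd) (hcount.trans hge))
  intro i hi hl
  rw [heq i hi]
  exact if_pos hl

end QData
end

/-! ### Tensor products with an `n`-dimensional simple factor. -/

noncomputable section

set_option linter.unusedSectionVars false

namespace QData

variable {k : Type u} [Field k] (D : QData k)

/-! ### The action on tensor products -/

section tensor

variable (A B : FDMod k D.U)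

/-- Pure tensors in the tensor product of two modules. -/
def tm : A.carrier →ₗ[k] B.carrier →ₗ[k] (FDMod.tensor D.quasi A B).carrier :=
  TensorProduct.mk k A.carrier B.carrier

/-- The action of `U ⊗ U` on the tensor product of two modules. -/
def oact : D.U ⊗[k] D.U →ₐ[k] Module.End k (FDMod.tensor D.quasi A B).carrier :=
  FDMod.outer A.act B.act

variable {A B}

theorem comul_smul (u : D.U) (x : (FDMod.tensor D.quasi A B).carrier) :
    u • x = D.oact A B (D.comul u) x := rfl

theorem oact_tmul (u u' : D.U) (v : A.carrier) (w : B.carrier) :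
    D.oact A B (u ⊗ₜ[k] u') (D.tm A B v w) = D.tm A B (u • v) (u' • w) := rfl

/-- On a tensor product of weight vectors a diagonal element acts through a single coefficient, so
the sums in the comultiplication collapse to one scalar. -/
theorem oact_dg {s t : ZMod D.m} {v : A.carrier} {w : B.carrier} (hv : D.K • v = D.χ s • v)
    (hw : D.K • w = D.χ t • w) (f : ZMod D.m × ZMod D.m → k) :
    D.oact A B (dg D.e₂ f) (D.tm A B v w) = f (-s, -t) • D.tm A B v w := by
  have h : ∀ p : ZMod D.m × ZMod D.m, D.oact A B (D.e₂ p) (D.tm A B v w) =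
      D.tm A B (D.idem p.1 • v) (D.idem p.2 • w) := fun _ => rfl
  rw [dg, map_sum, LinearMap.sum_apply, Finset.sum_eq_single (-s, -t)]
  · rw [map_smul, LinearMap.smul_apply, h, D.idem_smul_of_weight hv, D.idem_smul_of_weight hw]
  · rintro ⟨p, r⟩ _ hp
    rw [map_smul, LinearMap.smul_apply, h]
    by_cases hps : p = -s
    · have hrt : t ≠ -r := fun h' => hp (by rw [hps, h', neg_neg])
      have h2 := D.idem_smul_of_weight_ne hw hrt
      rw [neg_neg] at h2
      rw [h2, map_zero, smul_zero]
    · have h2 := D.idem_smul_of_weight_ne hv (t := -p) (fun h' => hps (by rw [h', neg_neg]))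
      rw [neg_neg] at h2
      rw [h2, map_zero, LinearMap.zero_apply, smul_zero]
  · intro h'; exact absurd (Finset.mem_univ _) h'

variable {s t : ZMod D.m} {v : A.carrier} {w : B.carrier} (hv : D.K • v = D.χ s • v)
  (hw : D.K • w = D.χ t • w)

include hv hw

theorem K_tm : D.K • D.tm A B v w = D.χ (s + t) • D.tm A B v w := by
  rw [comul_smul, show D.comul D.K = _ from D.comul_gen .K, comulGen_K, D.oact_dg hv hw, ← neg_add,
    χ_neg, inv_inv]

theorem E_tm : D.E • D.tm A B v w =
    D.Φ₁ (-s) (-t) • D.tm A B (D.E • v) w + D.χ s • D.tm A B v (D.E • w) := by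
  rw [comul_smul, show D.comul D.E = _ from D.comul_gen .E, comulGen_E, map_add, map_mul, map_mul,
    LinearMap.add_apply, Module.End.mul_apply, Module.End.mul_apply, D.oact_dg hv hw,
    D.oact_dg hv hw, map_smul, map_smul]
  simp only [χ_neg, inv_inv]
  rw [oact_tmul, oact_tmul, one_smul, one_smul]

theorem F_tm : D.F • D.tm A B v w =
    D.Ψ (-s) (-t) • D.tm A B (D.F • v) w + D.tm A B v (D.F • w) := by
  rw [comul_smul, show D.comul D.F = _ from D.comul_gen .F, comulGen_F, map_add, map_mul,
    LinearMap.add_apply, Module.End.mul_apply, D.oact_dg hv hw, map_smul]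
  rw [oact_tmul, oact_tmul, one_smul, one_smul]

end tensor

theorem Φ₁_ne_zero (s t : ZMod D.m) : D.Φ₁ s t ≠ 0 := by
  rw [Φ₁_eq]; exact pow_ne_zero _ (D.L_ne_zero t)

theorem Ψ_ne_zero (s t : ZMod D.m) : D.Ψ s t ≠ 0 := by
  rw [Ψ, Φ₂_eq]
  exact mul_ne_zero (inv_ne_zero (pow_ne_zero _ (D.L_ne_zero t))) (D.χ_ne_zero t)

/-! ### Tensor products of simple modules -/

section simple

variable (a b : ZMod D.m)

/-- The basis vectors of `S a ⊗ S b`. -/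
def tv (i j : ℕ) : (FDMod.tensor D.quasi (D.S a) (D.S b)).carrier :=
  D.tm (D.S a) (D.S b) (D.lv a i) (D.lv b j)

theorem tv_left {i : ℕ} (h : D.ell a ≤ i) (j : ℕ) : D.tv a b i j = 0 := by
  rw [tv, D.lv_eq_zero a h, map_zero, LinearMap.zero_apply]

theorem tv_right (i : ℕ) {j : ℕ} (h : D.ell b ≤ j) : D.tv a b i j = 0 := by
  rw [tv, D.lv_eq_zero b h, map_zero]

theorem K_tv (i j : ℕ) :
    D.K • D.tv a b i j = D.χ (a + b + 2 * D.n * (i + j : ℕ)) • D.tv a b i j := by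
  rw [tv, D.K_tm (D.K_lv a i) (D.K_lv b j)]
  congr 2; push_cast; ring

/-- The twisting coefficients of the comultiplication of `E` matter below only through being
nonzero. -/
theorem E_tv (i j : ℕ) : ∃ c d : k, c ≠ 0 ∧ d ≠ 0 ∧
    D.E • D.tv a b i j = c • D.tv a b (i + 1) j + d • D.tv a b i (j + 1) := by
  refine ⟨D.Φ₁ (-(a + 2 * D.n * i)) (-(b + 2 * D.n * j)), D.χ (a + 2 * D.n * i),
    D.Φ₁_ne_zero _ _, D.χ_ne_zero _, ?_⟩
  rw [tv, D.E_tm (D.K_lv a i) (D.K_lv b j), E_lv, E_lv]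
  rfl

theorem F_tv_zero_zero : D.F • D.tv a b 0 0 = 0 := by
  rw [tv, D.F_tm (D.K_lv a 0) (D.K_lv b 0), F_lv_zero, F_lv_zero, map_zero, map_zero,
    LinearMap.zero_apply, smul_zero, add_zero]

theorem F_tv_succ_zero {i : ℕ} (hi : i < D.ell a) : ∃ c : k, c ≠ 0 ∧
    D.F • D.tv a b (i + 1) 0 = (c * D.gam a (i + 1)) • D.tv a b i 0 := by
  refine ⟨D.Ψ (-(a + 2 * D.n * (i + 1 : ℕ))) (-(b + 2 * D.n * (0 : ℕ))), D.Ψ_ne_zero _ _, ?_⟩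
  rw [tv, D.F_tm (D.K_lv a (i + 1)) (D.K_lv b 0), F_lv_zero, map_zero, add_zero, D.F_lv_succ a i hi,
    map_smul, LinearMap.smul_apply, smul_smul]
  rfl

theorem F_tv_zero_succ {j : ℕ} (hj : j < D.ell b) :
    D.F • D.tv a b 0 (j + 1) = D.gam b (j + 1) • D.tv a b 0 j := by
  rw [tv, D.F_tm (D.K_lv a 0) (D.K_lv b (j + 1)), F_lv_zero, map_zero, LinearMap.zero_apply,
    smul_zero, zero_add, D.F_lv_succ b j hj, map_smul]
  rfl

theorem F_tv_succ_succ {i j : ℕ} (hi : i < D.ell a) (hj : j < D.ell b) : ∃ c : k, c ≠ 0 ∧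
    D.F • D.tv a b (i + 1) (j + 1) = (c * D.gam a (i + 1)) • D.tv a b i (j + 1) +
      D.gam b (j + 1) • D.tv a b (i + 1) j := by
  refine ⟨D.Ψ (-(a + 2 * D.n * (i + 1 : ℕ))) (-(b + 2 * D.n * (j + 1 : ℕ))), D.Ψ_ne_zero _ _, ?_⟩
  rw [tv, D.F_tm (D.K_lv a (i + 1)) (D.K_lv b (j + 1)), D.F_lv_succ b j hj, D.F_lv_succ a i hi,
    map_smul, LinearMap.smul_apply, smul_smul, map_smul]
  rfl

theorem finrank_tensor_S : Module.finrank k (FDMod.tensor D.quasi (D.S a) (D.S b)).carrier =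
    D.ell a * D.ell b := by
  rw [← D.finrank_S a, ← D.finrank_S b]
  exact Module.finrank_tensorProduct

/-- The functional `lc a i ⊗ lc b j`. -/
def tc (i j : ℕ) : (FDMod.tensor D.quasi (D.S a) (D.S b)).carrier →ₗ[k] k :=
  TensorProduct.lift ((LinearMap.mul k k).compl₁₂ (D.lc a i) (D.lc b j))

theorem tc_tv {i j : ℕ} (hi : i < D.ell a) (hj : j < D.ell b) (i' j' : ℕ) :
    D.tc a b i j (D.tv a b i' j') = if i = i' ∧ j = j' then 1 else 0 := by
  change D.lc a i (D.lv a i') * D.lc b j (D.lv b j') = _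
  rw [D.lc_lv a hi, D.lc_lv b hj]
  by_cases h1 : i = i' <;> by_cases h2 : j = j' <;> simp [h1, h2]

theorem mem_of_tv (N : Submodule k (FDMod.tensor D.quasi (D.S a) (D.S b)).carrier)
    (h : ∀ i j, D.tv a b i j ∈ N) (x : (FDMod.tensor D.quasi (D.S a) (D.S b)).carrier) : x ∈ N := by
  have key : ∀ (v : (D.S a).carrier) (w : (D.S b).carrier), D.tm _ _ v w ∈ N := by
    intro v w
    rw [D.eq_sum_lv a v, D.eq_sum_lv b w, map_sum, map_sum]
    refine N.sum_mem fun j _ => ?_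
    rw [LinearMap.sum_apply]
    refine N.sum_mem fun i _ => ?_
    rw [map_smul, map_smul, LinearMap.smul_apply]
    exact N.smul_mem _ (N.smul_mem _ (h i j))
  induction x using TensorProduct.induction_on with
  | zero => exact zero_mem _
  | tmul v w => exact key v w
  | add x y hx hy => exact N.add_mem hx hy

/-- Sums of vectors in the image of `E` and in the span of `z`. -/
theorem gen_of_tv (l : ℕ) (z : ℕ → (FDMod.tensor D.quasi (D.S a) (D.S b)).carrier)
    (h : ∀ i j, D.tv a b i j ∈ LinearMap.range (D.lsm _ D.E) ⊔
      Submodule.span k (z '' (Finset.range l : Set ℕ)))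
    (x : (FDMod.tensor D.quasi (D.S a) (D.S b)).carrier) :
    ∃ y, ∃ c : ℕ → k, x = D.E • y + ∑ i ∈ Finset.range l, c i • z i := by
  obtain ⟨_, ⟨y, rfl⟩, w, hw, hx⟩ := Submodule.mem_sup.mp (D.mem_of_tv a b _ h x)
  obtain ⟨c, hc⟩ := (Submodule.mem_span_image_finset_iff_exists_fun k).mp hw
  classical
  refine ⟨y, fun i => if hi : i ∈ Finset.range l then c ⟨i, hi⟩ else 0, ?_⟩
  rw [← hx, ← hc, ← Finset.sum_coe_sort (Finset.range l)]
  congr 1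
  exact Finset.sum_congr rfl fun i _ => by simp only; rw [dif_pos i.2]

/-- Since the coefficients in `E_tv` are nonzero, `v_i ⊗ w_(j+1)` is a multiple of `v_(i+1) ⊗ w_j`
modulo the image of `E`. Induction on `j` ends at the vectors `v_i ⊗ w_0`. -/
theorem strung_left (hb : D.ell b = D.n) :
    D.Strung (FDMod.tensor D.quasi (D.S a) (D.S b)) (D.ell a) (a + b) (fun i => D.tv a b i 0) where
  wt i _ := D.K_tv a b i 0
  F i hi := by
    obtain ⟨c, hc, h⟩ := D.F_tv_succ_zero a b (show i < D.ell a by omega)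
    have hg := D.gam_ne_zero_of_lt a (Nat.succ_pos i) hi
    refine ⟨(c * D.gam a (i + 1))⁻¹, ?_⟩
    rw [h, smul_smul, inv_mul_cancel₀ (mul_ne_zero hc hg), one_smul]
  gen := by
    refine D.gen_of_tv a b _ _ fun i j => ?_
    induction j generalizing i with
    | zero =>
      rcases Nat.lt_or_ge i (D.ell a) with h | h
      · exact Submodule.mem_sup_right (Submodule.subset_span ⟨i, by simpa using h, rfl⟩)
      · rw [D.tv_left a b h]; exact zero_mem _
    | succ j ih =>
      obtain ⟨c, d, hc, hd, h⟩ := D.E_tv a b i j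
      have h2 : D.tv a b i (j + 1) = d⁻¹ • (D.E • D.tv a b i j - c • D.tv a b (i + 1) j) := by
        rw [h, add_sub_cancel_left, smul_smul, inv_mul_cancel₀ hd, one_smul]
      rw [h2]
      exact Submodule.smul_mem _ _ (Submodule.sub_mem _ (Submodule.mem_sup_left ⟨_, rfl⟩)
        (Submodule.smul_mem _ _ (ih _)))
  dim := by rw [finrank_tensor_S, hb, mul_comm]

/-- Same argument with the factors exchanged. Both orders have the same string of weights, so they
have the same decomposition; this is where commutativity comes from. -/
theorem strung_right (hb : D.ell b = D.n) :
    D.Strung (FDMod.tensor D.quasi (D.S b) (D.S a)) (D.ell a) (a + b) (fun i => D.tv b a 0 i) where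
  wt i _ := by
    have := D.K_tv b a 0 i
    rwa [zero_add, add_comm b a] at this
  F i hi := by
    have h := D.F_tv_zero_succ b a (show i < D.ell a by omega)
    have hg := D.gam_ne_zero_of_lt a (Nat.succ_pos i) hi
    refine ⟨(D.gam a (i + 1))⁻¹, ?_⟩
    rw [h, smul_smul, inv_mul_cancel₀ hg, one_smul]
  gen := by
    refine D.gen_of_tv b a _ _ fun j i => ?_
    induction j generalizing i with
    | zero =>
      rcases Nat.lt_or_ge i (D.ell a) with h | h
      · exact Submodule.mem_sup_right (Submodule.subset_span ⟨i, by simpa using h, rfl⟩)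
      · rw [D.tv_right b a _ h]; exact zero_mem _
    | succ j ih =>
      obtain ⟨c, d, hc, hd, h⟩ := D.E_tv b a j i
      have h2 : D.tv b a (j + 1) i = c⁻¹ • (D.E • D.tv b a j i - d • D.tv b a j (i + 1)) := by
        rw [h, add_sub_cancel_right, smul_smul, inv_mul_cancel₀ hc, one_smul]
      rw [h2]
      exact Submodule.smul_mem _ _ (Submodule.sub_mem _ (Submodule.mem_sup_left ⟨_, rfl⟩)
        (Submodule.smul_mem _ _ (ih _)))
  dim := by rw [finrank_tensor_S, hb]

/-- The class of the simple module of lowest weight `a`. -/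
abbrev cS : D.quasi.GreenRing := D.quasi.cls (D.S a)

/-- The class of the projective cover of the simple module of lowest weight `a`. -/
abbrev cP : D.quasi.GreenRing := D.quasi.cls (D.P a)

/-- Here `P a` has dimension at most `n` and maps onto the `n`-dimensional `S a`. -/
theorem cP_eq_cS (hl : D.ell a = D.n) : D.cP a = D.cS a := by
  refine FDMod.cls_eq_of_surjective _ (D.inZ_lv a).hom ?_
    ((D.finrank_P_le_of_eq a hl).trans_eq (by rw [finrank_S, hl]))
  rw [← LinearMap.range_eq_top]
  exact D.span_lv a _ ⟨_, (D.inZ_lv a).hom_pe⟩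

theorem cS_mul_cS_left (hb : D.ell b = D.n)
    (hc : ∀ i ∈ D.heads (D.ell a) (a + b), D.ell (a + b + 2 * D.n * i) < D.n →
      D.n ≤ i + D.ell (a + b + 2 * D.n * i)) :
    D.cS a * D.cS b = ∑ i ∈ D.heads (D.ell a) (a + b), D.cP (a + b + 2 * D.n * i) := by
  rw [cS, cS, D.quasi.cls_mul]
  exact ((D.strung_left a b hb).cls_eq hc).1

theorem cS_mul_cS_right (hb : D.ell b = D.n)
    (hc : ∀ i ∈ D.heads (D.ell a) (a + b), D.ell (a + b + 2 * D.n * i) < D.n →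
      D.n ≤ i + D.ell (a + b + 2 * D.n * i)) :
    D.cS b * D.cS a = ∑ i ∈ D.heads (D.ell a) (a + b), D.cP (a + b + 2 * D.n * i) := by
  rw [cS, cS, D.quasi.cls_mul]
  exact ((D.strung_right a b hb).cls_eq hc).1

end simple

theorem ell_zero : D.ell 0 = 1 := D.ell_eq 0 one_pos D.n_pos (by rw [χ_zero]; ring)

theorem cS_zero : D.cS 0 = 1 := by
  let o : (FDMod.unit D.quasi).carrier := (1 : k)
  have hK : D.K • o = D.χ 0 • o := by
    change D.counit D.K * (1 : k) = D.χ 0 * 1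
    rw [show D.counit D.K = _ from D.counit_gen .K, χ_zero]; rfl
  have hF : D.F • o = 0 := by
    change D.counit D.F * (1 : k) = 0
    rw [show D.counit D.F = _ from D.counit_gen .F, mul_one]; rfl
  have hE : D.E ^ D.ell 0 • o = 0 := by
    rw [ell_zero, pow_one]
    change D.counit D.E * (1 : k) = 0
    rw [show D.counit D.E = _ from D.counit_gen .E, mul_one]; rfl
  rw [QuasiBialgebra.one_eq_cls]
  refine FDMod.cls_eq_of_surjective _ (D.Shom hK hF hE) ?_ ?_
  · have h : ∀ x : (FDMod.unit D.quasi).carrier,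
        x ∈ LinearMap.range ((D.Shom hK hF hE).restrictScalars k) := by
      intro x
      refine ⟨(show k from x) • D.lv 0 0, ?_⟩
      rw [map_smul]
      change (show k from x) • D.Shom hK hF hE (D.lv 0 0) = x
      rw [D.Shom_lv hK hF hE]
      exact mul_one (show k from x)
    intro x
    obtain ⟨y, hy⟩ := h x
    exact ⟨y, hy⟩
  · rw [finrank_S, ell_zero]
    exact (Module.finrank_self k).ge

end QData
end

/-! ### The product with `V₂`, and the given modules as modules `S s`. -/

noncomputable section

set_option linter.unusedSectionVars false

namespace QData

variable {k : Type u} [Field k] (D : QData k)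

/-! ### Products with the two-dimensional simple module -/

theorem E_pow_tv {a b : ZMod D.m} (ha : D.ell a = 2) (j r : ℕ)
    (x : (FDMod.tensor D.quasi (D.S a) (D.S b)).carrier)
    (hx : ∃ c d : k, x = c • D.tv a b 0 (j + 1) + d • D.tv a b 1 j) :
    ∃ c d : k, D.E ^ r • x = c • D.tv a b 0 (j + r + 1) + d • D.tv a b 1 (j + r) := by
  induction r with
  | zero => simpa using hx
  | succ r ih =>
    obtain ⟨c, d, h⟩ := ih
    obtain ⟨c₁, d₁, _, _, h₁⟩ := D.E_tv a b 0 (j + r + 1)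
    obtain ⟨c₂, d₂, _, _, h₂⟩ := D.E_tv a b 1 (j + r)
    refine ⟨c * d₁, c * c₁ + d * d₂, ?_⟩
    rw [pow_succ', mul_smul, h, smul_add, smul_comm D.E c, smul_comm D.E d, h₁, h₂,
      D.tv_left a b (show D.ell a ≤ 1 + 1 by omega), zero_add, ← add_assoc j r 1]
    module

theorem cls_eq_add {X A B : FDMod k D.U} (f : A.carrier →ₗ[D.U] X.carrier)
    (g : B.carrier →ₗ[D.U] X.carrier) (hfg : ∀ x, ∃ a b, f a + g b = x)
    (hX : Module.finrank k A.carrier + Module.finrank k B.carrier ≤ Module.finrank k X.carrier) :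
    D.quasi.cls X = D.quasi.cls A + D.quasi.cls B := by
  obtain ⟨Q, hQ, hQd, φ, hφ⟩ := FDMod.exists_cover (B := D.quasi) (X := X)
    (Finset.univ : Finset Bool) (fun i => if i then A else B)
    (fun i => match i with | true => f | false => g)
  rw [Fintype.sum_bool] at hQ hQd
  have h2 : D.quasi.cls Q = D.quasi.cls A + D.quasi.cls B := hQ
  rw [← h2]
  refine (FDMod.cls_eq_of_surjective _ φ ?_ (hQd.le.trans hX)).symm
  intro x
  obtain ⟨a, b, rfl⟩ := hfg x
  exact add_mem (hφ true (Finset.mem_univ _) ⟨a, rfl⟩) (hφ false (Finset.mem_univ _) ⟨b, rfl⟩)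

/-- The two images are simple submodules of different dimensions, hence distinct atoms, so they meet
in zero and fill `X` by dimension. -/
theorem cls_eq_add_of_hom {X A B : FDMod k D.U} [IsSimpleModule D.U A.carrier]
    [IsSimpleModule D.U B.carrier] (f : A.carrier →ₗ[D.U] X.carrier) (g : B.carrier →ₗ[D.U] X.carrier)
    (hf : f ≠ 0) (hg : g ≠ 0) (hAB : Module.finrank k A.carrier ≠ Module.finrank k B.carrier)
    (hX : Module.finrank k X.carrier = Module.finrank k A.carrier + Module.finrank k B.carrier) :
    D.quasi.cls X = D.quasi.cls A + D.quasi.cls B := by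
  have hfi := (LinearMap.injective_or_eq_zero f).resolve_right hf
  have hgi := (LinearMap.injective_or_eq_zero g).resolve_right hg
  have hfs : IsSimpleModule D.U (LinearMap.range f) :=
    IsSimpleModule.congr (LinearEquiv.ofInjective f hfi).symm
  have hgs : IsSimpleModule D.U (LinearMap.range g) :=
    IsSimpleModule.congr (LinearEquiv.ofInjective g hgi).symm
  rw [isSimpleModule_iff_isAtom] at hfs hgs
  have hfr : Module.finrank k (LinearMap.range (f.restrictScalars k)) = Module.finrank k A.carrier :=
    LinearMap.finrank_range_of_inj (f := f.restrictScalars k) hfi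
  have hgr : Module.finrank k (LinearMap.range (g.restrictScalars k)) = Module.finrank k B.carrier :=
    LinearMap.finrank_range_of_inj (f := g.restrictScalars k) hgi
  have hne : LinearMap.range f ≠ LinearMap.range g := by
    intro h
    apply hAB
    rw [← hfr, ← hgr]
    have : LinearMap.range (f.restrictScalars k) = LinearMap.range (g.restrictScalars k) := by
      ext x
      exact (Submodule.ext_iff.mp h x)
    rw [this]
  have hdis := hfs.disjoint_of_ne hgs hne
  have hinf : LinearMap.range (f.restrictScalars k) ⊓ LinearMap.range (g.restrictScalars k) = ⊥ := by
    rw [eq_bot_iff]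
    rintro x ⟨h1, h2⟩
    have := (Submodule.disjoint_def.mp hdis) x h1 h2
    rw [this]; exact zero_mem _
  have hsup : LinearMap.range (f.restrictScalars k) ⊔ LinearMap.range (g.restrictScalars k) = ⊤ := by
    apply Submodule.eq_top_of_finrank_eq
    have := Submodule.finrank_sup_add_finrank_inf_eq (LinearMap.range (f.restrictScalars k))
      (LinearMap.range (g.restrictScalars k))
    rw [hinf, finrank_bot, hfr, hgr] at this
    omega
  refine D.cls_eq_add f g (fun x => ?_) hX.ge
  have hx : x ∈ LinearMap.range (f.restrictScalars k) ⊔ LinearMap.range (g.restrictScalars k) :=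
    hsup ▸ Submodule.mem_top
  obtain ⟨_, ⟨a, rfl⟩, _, ⟨b, rfl⟩, rfl⟩ := Submodule.mem_sup.mp hx
  exact ⟨a, b, rfl⟩

/-- The product has two lowest weight vectors, of weights `a + b` and `a + b + 2n`. They give maps
from simple modules of dimensions `ell b + 1` and `ell b - 1`, which together account for the whole
dimension. -/
theorem cS_mul_of_ell_eq_two {a b : ZMod D.m} (ha : D.ell a = 2) (hb : 2 ≤ D.ell b)
    (h1 : D.ell (a + b) = D.ell b + 1) (h2 : D.ell (a + b + 2 * D.n) = D.ell b - 1) :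
    D.cS a * D.cS b = D.cS (a + b) + D.cS (a + b + 2 * D.n) := by
  have hga := D.gam_ne_zero_of_lt a (j := 1) one_pos (by omega)
  have hgb := D.gam_ne_zero_of_lt b (j := 1) one_pos (by omega)
  obtain ⟨c₀, hc₀, hF10⟩ := D.F_tv_succ_zero a b (i := 0) (by omega)
  have hF01 := D.F_tv_zero_succ a b (j := 0) (by omega)
  have hK0 : D.K • D.tv a b 0 0 = D.χ (a + b) • D.tv a b 0 0 := by simpa using D.K_tv a b 0 0
  have hE0 : D.E ^ D.ell (a + b) • D.tv a b 0 0 = 0 := by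
    obtain ⟨c, d, _, _, h⟩ := D.E_tv a b 0 0
    obtain ⟨c', d', h'⟩ := D.E_pow_tv (b := b) ha 0 (D.ell b) (D.E • D.tv a b 0 0)
      ⟨d, c, by rw [h, add_comm]⟩
    rw [h1, pow_succ, mul_smul, h', D.tv_right a b _ (by omega), D.tv_right a b _ (by omega)]
    simp
  -- The coefficient is the one for which `F` kills `w`.
  let w := D.tv a b 1 0 - (c₀ * D.gam a 1 * (D.gam b 1)⁻¹) • D.tv a b 0 1
  have hKw : D.K • w = D.χ (a + b + 2 * D.n) • w := by
    have e1 := D.K_tv a b 1 0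
    have e2 := D.K_tv a b 0 1
    simp only [add_zero, zero_add, Nat.cast_one, mul_one] at e1 e2
    simp only [w]
    rw [smul_sub, smul_comm D.K (_ : k), e1, e2, smul_sub, smul_comm (D.χ _)]
  have hFw : D.F • w = 0 := by
    simp only [w]
    rw [smul_sub, smul_comm D.F (_ : k), hF10, hF01, smul_smul, zero_add, mul_assoc,
      inv_mul_cancel₀ hgb, mul_one, sub_self]
  -- By degree this vector is a multiple of the last basis vector `v_1 ⊗ w_(r+1)`, where `ell b = r
  -- + 2`. It is killed by `F`, as `gam` vanishes at `ell`, whereas `F (v_1 ⊗ w_(r+1))` has a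
  -- nonzero coefficient at `v_0 ⊗ w_(r+1)`. So the multiple is zero.
  have hEw : D.E ^ D.ell (a + b + 2 * D.n) • w = 0 := by
    obtain ⟨r, hr⟩ : ∃ r, D.ell b = r + 2 := ⟨D.ell b - 2, by omega⟩
    obtain ⟨c, d, h⟩ := D.E_pow_tv (b := b) ha 0 (D.ell (a + b + 2 * D.n)) w
      ⟨-(c₀ * D.gam a 1 * (D.gam b 1)⁻¹), 1, by
        simp only [w]; rw [one_smul, neg_smul, sub_eq_add_neg, add_comm]⟩
    have hFE : D.F • D.E ^ D.ell (a + b + 2 * D.n) • w = 0 := by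
      have hg := D.gam_ell (a + b + 2 * D.n)
      rw [show D.ell (a + b + 2 * D.n) = r + 1 by omega] at hg ⊢
      rw [D.F_E_pow_smul hKw, EF_smul, hFw, smul_zero, hg, zero_smul, add_zero, smul_zero]
    rw [D.tv_right a b 0 (by omega), smul_zero, zero_add, zero_add,
      show D.ell (a + b + 2 * D.n) = r + 1 by omega] at h
    rw [show D.ell (a + b + 2 * D.n) = r + 1 by omega] at hFE ⊢
    rw [h] at hFE ⊢
    obtain ⟨c', hc', hF⟩ := D.F_tv_succ_succ a b (i := 0) (j := r) (by omega) (by omega)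
    rw [smul_comm D.F d, show (1 : ℕ) = 0 + 1 from rfl, hF] at hFE
    have h5 := congrArg (D.tc a b 0 (r + 1)) hFE
    rw [map_smul, map_add, map_smul, map_smul, D.tc_tv a b (by omega) (by omega),
      D.tc_tv a b (by omega) (by omega), map_zero, if_pos ⟨rfl, rfl⟩, if_neg (by omega)] at h5
    simp only [smul_eq_mul, mul_one, mul_zero, add_zero] at h5
    rw [(mul_eq_zero.mp h5).resolve_right (mul_ne_zero hc' hga), zero_smul]
  have hw : w ≠ 0 := by
    intro h
    have h5 := congrArg (D.tc a b 1 0) h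
    simp only [w] at h5
    rw [map_sub, map_smul, D.tc_tv a b (by omega) (by omega), D.tc_tv a b (by omega) (by omega),
      map_zero, if_pos ⟨rfl, rfl⟩, if_neg (by omega), smul_zero, sub_zero] at h5
    exact one_ne_zero h5
  have h00 : D.tv a b 0 0 ≠ 0 := by
    intro h
    have h5 := congrArg (D.tc a b 0 0) h
    rw [D.tc_tv a b (by omega) (by omega), map_zero, if_pos ⟨rfl, rfl⟩] at h5
    exact one_ne_zero h5
  rw [cS, cS, D.quasi.cls_mul]
  refine D.cls_eq_add_of_hom (D.Shom hK0 (D.F_tv_zero_zero a b) hE0) (D.Shom hKw hFw hEw) ?_ ?_ ?_ ?_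
  · intro h
    have := D.Shom_lv hK0 (D.F_tv_zero_zero a b) hE0
    rw [h] at this
    exact h00 this.symm
  · intro h
    have := D.Shom_lv hKw hFw hEw
    rw [h] at this
    exact hw this.symm
  · rw [finrank_S, finrank_S]; omega
  · rw [finrank_tensor_S, finrank_S, finrank_S, ha]; omega

/-! ### Weights -/

theorem χ_n : D.χ D.n = D.q := by rw [χ_natCast]; rfl

theorem χ_n_mul (j : ℕ) : D.χ (D.n * j) = D.q ^ j := by
  rw [← Nat.cast_mul, χ_natCast, pow_mul]; rfl

theorem n_mul_n : (D.n * D.n : ZMod D.m) = 0 := by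
  rw [← Nat.cast_mul, ← sq, ZMod.natCast_self]

theorem ell_of_add {s : ZMod D.m} {d : ℕ} (h0 : 0 < d) (hd : d ≤ D.n) (hs : s + D.n * d = D.n) :
    D.ell s = d := by
  refine D.ell_eq s h0 hd ?_
  rw [mul_comm 2, pow_mul, ← mul_pow, ← χ_n_mul, ← χ_add, hs, χ_n]

theorem ell_neg_n : D.ell (-D.n) = 2 :=
  D.ell_of_add two_pos D.two_lt.le (by push_cast; ring)

theorem V₂_eq : D.V₂ = D.S (-D.n) := by
  have hq := D.q_ne_zero
  have h3 := D.q_sub_inv_ne_zero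
  refine D.chain_congr D.V₂_rel _ D.ell_neg_n.symm (by rw [χ_neg, χ_n]) ?_
  intro j hj
  obtain rfl | rfl : j = 0 ∨ j = 1 := by omega
  · simp [gam_zero]
  · rw [if_pos rfl, gam, χ_neg, χ_n, eq_comm, inv_mul_eq_iff_eq_mul₀ (pow_ne_zero 2 h3)]
    field_simp
    ring

theorem L_natCast (t : ℕ) : D.L t = D.q ^ t := by
  rw [L, χ_natCast, ← pow_mul, mul_comm, pow_mul]; rfl

theorem L_n_mul (a : ℕ) : D.L (D.n * a) = 1 := by
  rw [← Nat.cast_mul, L_natCast, pow_mul, q_pow_n, one_pow]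

theorem L_natCast_ne_one {t : ℕ} (h0 : 0 < t) (ht : t < D.n) : D.L t ≠ 1 := by
  rw [L_natCast]
  exact D.prim_q.pow_ne_one_of_pos_of_lt h0.ne' ht

/-- If `ell s < n`, the `n`-th power of `χ(s)² q^(2 ell s) = q²` says `L(s)² = 1`. Also `L(s)^n =
1`, and `n` is odd, so `L(s) = 1`. -/
theorem ell_eq_n {s : ZMod D.m} (h : D.L s ≠ 1) : D.ell s = D.n := by
  by_contra hne
  have hlt := lt_of_le_of_ne (D.ell_le s) hne
  have h1 := D.χ_sq_of_ell_lt hlt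
  have h2 : (D.χ s ^ 2 * D.q ^ (2 * D.ell s)) ^ D.n = (D.q ^ 2) ^ D.n := by rw [h1]
  rw [mul_pow, ← pow_mul (D.q), mul_comm _ D.n, pow_mul D.q D.n, q_pow_n, one_pow, mul_one,
    ← pow_mul D.q, mul_comm 2 D.n, pow_mul D.q D.n, q_pow_n, one_pow, ← pow_mul, mul_comm 2,
    pow_mul] at h2
  have h3 : D.L s ^ 2 = 1 := h2
  have h4 : D.L s ^ D.n = 1 := by rw [L, ← pow_mul, ← sq]; exact D.χ_pow_m s
  obtain ⟨r, hr⟩ := D.odd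
  rw [hr, pow_succ, pow_mul, h3, one_pow, one_mul] at h4
  exact h h4

theorem VV_eq {t : ℕ} (h0 : 0 < t) (ht : t < D.n) (r : ℕ) : D.VV t r = D.S (t + 2 * D.n * r) := by
  have hL : D.L (t + 2 * D.n * r) ≠ 1 := by
    rw [L_add, mul_comm (2 : ZMod D.m), mul_assoc, show (2 * r : ZMod D.m) = (2 * r : ℕ) by push_cast; rfl,
      L_n_mul, mul_one]
    exact D.L_natCast_ne_one h0 ht
  have hχ : D.χ (t + 2 * D.n * r) = D.bq ^ t * D.q ^ (2 * r) := by
    rw [χ_add, χ_two_n_mul, χ_natCast]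
  refine D.chain_congr (D.VV_rel t r) _ (D.ell_eq_n hL).symm hχ.symm ?_
  intro j _
  rw [gam, hχ, γ, mul_add 2 r j, pow_add]
  have hq := D.q_ne_zero
  have h1 := pow_ne_zero t D.bq_ne_zero
  have h2 := pow_ne_zero (2 * r) hq
  have h3 := pow_ne_zero (2 * j) hq
  have h4 := D.q_sub_inv_ne_zero
  have h5 : 1 - D.q ^ 2 ≠ 0 := fun h => D.q_sq_ne_one (sub_eq_zero.mp h).symm
  have e1 : D.q - D.q⁻¹ = -(1 - D.q ^ 2) * D.q⁻¹ := by field_simp; ring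
  have e2 : 1 - (D.q ^ 2)⁻¹ = -(1 - D.q ^ 2) * (D.q ^ 2)⁻¹ := by field_simp; ring
  rw [e1, e2]
  generalize D.q ^ (2 * j) = Q at h3 ⊢
  generalize D.q ^ (2 * r) = P at h2 ⊢
  generalize D.bq ^ t = b at h1 ⊢
  generalize 1 - D.q ^ 2 = R at h5 ⊢
  field_simp
  ring

end QData
end

/-! ### Products in the Green ring through Chebyshev polynomials. -/

noncomputable section

set_option linter.unusedSectionVars false

namespace QData

open Polynomial

variable {k : Type u} [Field k] (D : QData k)

/-! ### Relations in the Green ring -/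

/-- The value of a polynomial at the class of the two-dimensional simple module. -/
abbrev ay : ℤ[X] →ₐ[ℤ] D.quasi.GreenRing := aeval (D.cS (-D.n))

/-- The class of the simple module of dimension `n` with weights in `⟨q⟩`. -/
abbrev st : D.quasi.GreenRing := D.cS D.n

theorem ell_neg_n_mul {d : ℕ} (hd : d < D.n) : D.ell (-(D.n * d)) = d + 1 :=
  D.ell_of_add d.succ_pos hd (by push_cast; ring)

theorem ell_n_add {d : ℕ} (hd : d < D.n) : D.ell (D.n + D.n * d) = D.n - d := by
  refine D.ell_of_add (by omega) (by omega) ?_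
  rw [Nat.cast_sub hd.le, mul_sub, n_mul_n]; ring

theorem ell_n : D.ell D.n = D.n := by
  have := D.ell_n_add D.n_pos
  rwa [Nat.cast_zero, mul_zero, add_zero, Nat.sub_zero] at this

theorem two_mul_cS {d : ℕ} (h0 : 0 < d) (hd : d + 1 < D.n) :
    D.cS (-D.n) * D.cS (-(D.n * d)) =
      D.cS (-(D.n * (d + 1 : ℕ))) + D.cS (-(D.n * (d - 1 : ℕ))) := by
  have e1 : -D.n + -(D.n * d) = (-(D.n * (d + 1 : ℕ)) : ZMod D.m) := by push_cast; ring
  have e2 : -D.n + -(D.n * d) + 2 * D.n = (-(D.n * (d - 1 : ℕ)) : ZMod D.m) := by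
    rw [Nat.cast_sub (show 1 ≤ d by omega)]; push_cast; ring
  have h1 := D.ell_neg_n_mul (d := d) (by omega)
  have h2 := D.cS_mul_of_ell_eq_two D.ell_neg_n (b := -(D.n * d)) (by omega)
    (by rw [e1, D.ell_neg_n_mul hd, h1]) (by rw [e2, D.ell_neg_n_mul (by omega), h1]; omega)
  rw [h2, e2, e1]

/-- The Clebsch-Gordan rule `two_mul_cS` is the defining recurrence of the polynomials `S_d`, as
long as the dimension `d + 1` stays at most `n`. -/
theorem ay_S {d : ℕ} (hd : d < D.n) : D.ay (Chebyshev.S ℤ d) = D.cS (-(D.n * d)) := by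
  induction d using Nat.strong_induction_on with
  | _ d ih =>
    match d with
    | 0 => simp [cS_zero]
    | 1 => simp
    | d + 2 =>
      have h1 := ih (d + 1) (by omega) (by omega)
      have h0 := ih d (by omega) (by omega)
      have h2 := D.two_mul_cS (d := d + 1) (by omega) (by omega)
      push_cast at h1 ⊢
      rw [Chebyshev.S_add_two, map_sub, map_mul, aeval_X, h1, h0, eq_comm]
      refine eq_sub_of_add_eq ?_
      rw [Nat.add_sub_cancel] at h2
      push_cast at h2
      rw [h2, add_assoc (d : ZMod D.m), show (1 + 1 : ZMod D.m) = 2 by norm_num]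

theorem ay_S_top : D.ay (Chebyshev.S ℤ (D.n - 1 : ℕ)) = D.st := by
  have := D.n_pos
  rw [D.ay_S (by omega)]
  congr 1
  rw [Nat.cast_sub (show 1 ≤ D.n by omega), mul_sub, n_mul_n]
  push_cast; ring

/-- The weight with index `i` has a simple module of dimension `n - (2i - d)` if `d ≤ 2i` and `d -
2i` otherwise. In the first case adding `i` gives at least `n`, in the second at most `d`, so the
heads are the upper half of the string. -/
theorem heads_neg {d : ℕ} (hd : d < D.n) :
    D.heads (d + 1) (-(D.n * d) + D.n) = (Finset.range (d + 1)).filter (fun i => d ≤ 2 * i) ∧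
    ∀ i ∈ D.heads (d + 1) (-(D.n * d) + D.n), D.n ≤ i + D.ell (-(D.n * d) + D.n + 2 * D.n * i) := by
  have e1 : ∀ i, d ≤ 2 * i → i ≤ d →
      D.ell (-(D.n * d) + D.n + 2 * D.n * i) = D.n - (2 * i - d) := by
    intro i h1 h2
    rw [← D.ell_n_add (show 2 * i - d < D.n by omega), Nat.cast_sub h1]
    congr 1; push_cast; ring
  have e2 : ∀ i, 2 * i < d → D.ell (-(D.n * d) + D.n + 2 * D.n * i) = d - 2 * i := by
    intro i h1
    refine D.ell_of_add (by omega) (by omega) ?_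
    rw [Nat.cast_sub h1.le]; push_cast; ring
  have key : D.heads (d + 1) (-(D.n * d) + D.n) =
      (Finset.range (d + 1)).filter (fun i => d ≤ 2 * i) := by
    ext i
    rw [mem_heads, Finset.mem_filter, Finset.mem_range]
    refine and_congr_right fun hi => ?_
    rcases Nat.lt_or_ge (2 * i) d with h | h
    · rw [e2 i h]; omega
    · rw [e1 i h (by omega)]; omega
  refine ⟨key, fun i hi => ?_⟩
  rw [key, Finset.mem_filter, Finset.mem_range] at hi
  rw [e1 i hi.2 (by omega)]; omega

theorem cS_neg_mul_st {d : ℕ} (hd : d < D.n) : D.cS (-(D.n * d)) * D.st =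
    ∑ i ∈ Finset.range (d + 1), if d ≤ 2 * i then D.cP (-(D.n * d) + D.n + 2 * D.n * i) else 0 := by
  have h := D.heads_neg hd
  have h2 := D.cS_mul_cS_left (-(D.n * d)) D.n D.ell_n
  rw [D.ell_neg_n_mul hd] at h2
  rw [h2 fun i hi _ => h.2 i hi, h.1, Finset.sum_filter]

theorem cP_n : D.cP D.n = D.st := D.cP_eq_cS _ D.ell_n

/-- Passing from `d` to `d + 2` shifts the index of summation in `cS_neg_mul_st` by one and adds
only the top summand. With `C_d = S_d - S_(d-2)` this isolates each projective class. -/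
theorem cP_rec {d : ℕ} (hd : d + 2 < D.n) : D.cS (-(D.n * (d + 2 : ℕ))) * D.st =
    D.cS (-(D.n * d)) * D.st + D.cP (D.n + D.n * (d + 2 : ℕ)) := by
  rw [D.cS_neg_mul_st hd, D.cS_neg_mul_st (by omega), Finset.sum_range_succ, if_pos (by omega),
    Finset.sum_range_succ', if_neg (by omega), add_zero]
  congr 1
  · refine Finset.sum_congr rfl fun i _ => ?_
    by_cases h : d ≤ 2 * i
    · rw [if_pos h, if_pos (by omega)]
      congr 1; push_cast; ring
    · rw [if_neg h, if_neg (by omega)]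
  · congr 1; push_cast; ring

theorem C_eq_S_sub_S (d : ℤ) : Chebyshev.C ℤ d = Chebyshev.S ℤ d - Chebyshev.S ℤ (d - 2) := by
  have h1 := Chebyshev.C_eq_S_sub_X_mul_S ℤ d
  have h2 := Chebyshev.S_eq ℤ d
  rw [h1]
  linear_combination h2

theorem cP_eq {d : ℕ} (h0 : 0 < d) (hd : d < D.n) :
    D.cP (D.n + D.n * d) = D.ay (Chebyshev.C ℤ d) * D.st := by
  match d, h0 with
  | 1, _ =>
    have h := D.cS_neg_mul_st hd
    rw [Finset.sum_range_succ, Finset.sum_range_one, if_neg (by omega), zero_add, if_pos (by omega)]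
      at h
    rw [Nat.cast_one, Nat.cast_one, Chebyshev.C_one, aeval_X]
    rw [Nat.cast_one, mul_one] at h
    rw [h]
    congr 1; ring
  | d + 2, _ =>
    rw [C_eq_S_sub_S, map_sub, D.ay_S hd, show ((d + 2 : ℕ) : ℤ) - 2 = (d : ℕ) by push_cast; ring,
      D.ay_S (by omega), sub_mul, D.cP_rec hd, add_sub_cancel_left]

/-! ### Products of simple modules of dimension `n` -/

theorem typ_mul_typ {a b : ZMod D.m} (ha : D.ell a = D.n) (hb : D.ell b = D.n) :
    D.cS a * D.cS b = ∑ i ∈ D.heads D.n (a + b), D.cP (a + b + 2 * D.n * i) := by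
  have h := D.cS_mul_cS_left a b hb
  rw [ha] at h
  exact h fun i hi _ => (D.mem_heads.mp hi).2

theorem L_add_n_mul (s : ZMod D.m) (a : ℕ) : D.L (s + D.n * a) = D.L s := by
  rw [L_add, L_n_mul, mul_one]

theorem L_add_two_n_mul (s : ZMod D.m) (a : ℕ) : D.L (s + 2 * D.n * a) = D.L s := by
  rw [← D.L_add_n_mul s (2 * a)]
  congr 1; push_cast; ring

theorem heads_of_L {s : ZMod D.m} (hs : D.L s ≠ 1) (l : ℕ) (hl : l ≤ D.n) :
    D.heads l s = Finset.range l := by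
  ext i
  rw [mem_heads, Finset.mem_range, D.ell_eq_n (s := s + 2 * D.n * i) (by rwa [L_add_two_n_mul])]
  omega

theorem cP_of_L {s : ZMod D.m} (hs : D.L s ≠ 1) (i : ℕ) :
    D.cP (s + 2 * D.n * i) = D.cS (s + 2 * D.n * i) :=
  D.cP_eq_cS _ (D.ell_eq_n (by rwa [L_add_two_n_mul]))

theorem L_neg_n_add (b : ZMod D.m) : D.L (-D.n + b) = D.L b := by
  have h := D.L_add_n_mul (-D.n + b) 1
  rw [← h]; congr 1; push_cast; ring

theorem two_mul_typ {b : ZMod D.m} (hb : D.L b ≠ 1) :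
    D.cS (-D.n) * D.cS b = D.cS (b - D.n) + D.cS (b + D.n) := by
  have hs : D.L (-D.n + b) ≠ 1 := by rwa [L_neg_n_add]
  have h := D.cS_mul_cS_left (-D.n) b (D.ell_eq_n hb)
  rw [D.ell_neg_n, D.heads_of_L hs 2 D.two_lt.le, Finset.sum_range_succ, Finset.sum_range_one] at h
  rw [h, D.cP_of_L hs, D.cP_of_L hs]
  · congr 2 <;> (push_cast; ring)
  · intro i _ hi
    rw [D.ell_eq_n (by rwa [L_add_two_n_mul])] at hi
    exact absurd hi (lt_irrefl _)

theorem typ_mul_two {b : ZMod D.m} (hb : D.L b ≠ 1) :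
    D.cS b * D.cS (-D.n) = D.cS (-D.n) * D.cS b := by
  have hs : D.L (-D.n + b) ≠ 1 := by rwa [L_neg_n_add]
  have hc : ∀ i ∈ D.heads (D.ell (-D.n)) (-D.n + b), D.ell (-D.n + b + 2 * D.n * i) < D.n →
      D.n ≤ i + D.ell (-D.n + b + 2 * D.n * i) := by
    intro i _ hi
    rw [D.ell_eq_n (by rwa [L_add_two_n_mul])] at hi
    exact absurd hi (lt_irrefl _)
  rw [D.cS_mul_cS_left (-D.n) b (D.ell_eq_n hb) hc, D.cS_mul_cS_right (-D.n) b (D.ell_eq_n hb) hc]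

theorem typ_mul_comm {a b : ZMod D.m} (ha : D.ell a = D.n) (hb : D.ell b = D.n) :
    D.cS a * D.cS b = D.cS b * D.cS a := by
  rw [D.typ_mul_typ ha hb, D.typ_mul_typ hb ha, add_comm a b]

/-- Multiplication by `y` acts on these classes as the sum of the translations by `n` and `-n`, and
`C_j(T + T⁻¹) = T^j + T^(-j)`. -/
theorem ay_C_mul_typ {b : ZMod D.m} (hb : D.L b ≠ 1) (j : ℕ) :
    D.ay (Chebyshev.C ℤ j) * D.cS b = D.cS (b - D.n * j) + D.cS (b + D.n * j) := by
  induction j using Nat.strong_induction_on with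
  | _ j ih =>
    match j with
    | 0 =>
      have h2 : D.ay 2 = 2 := map_ofNat _ 2
      simp [h2, two_mul]
    | 1 => simp [D.two_mul_typ hb]
    | j + 2 =>
      have h1 := ih (j + 1) (by omega)
      have h0 := ih j (by omega)
      have hp : D.L (b + D.n * (j + 1 : ℕ)) ≠ 1 := by rwa [L_add_n_mul]
      have hm : D.L (b - D.n * (j + 1 : ℕ)) ≠ 1 := by
        rwa [← D.L_add_n_mul _ (j + 1), sub_add_cancel]
      push_cast at h1 hp hm ⊢
      rw [Chebyshev.C_add_two, map_sub, map_mul, aeval_X, sub_mul, mul_assoc, h1, h0, mul_add,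
        D.two_mul_typ hp, D.two_mul_typ hm]
      have e1 : (b - D.n * (j + 1) - D.n : ZMod D.m) = b - D.n * (j + 2) := by ring
      have e2 : (b - D.n * (j + 1) + D.n : ZMod D.m) = b - D.n * j := by ring
      have e3 : (b + D.n * (j + 1) - D.n : ZMod D.m) = b + D.n * j := by ring
      have e4 : (b + D.n * (j + 1) + D.n : ZMod D.m) = b + D.n * (j + 2) := by ring
      rw [e1, e2, e3, e4]
      abel

/-- The sum of the classes `S (b + n i)` over `i` modulo `n`. -/
def osum (b : ZMod D.m) : D.quasi.GreenRing := ∑ i ∈ Finset.range D.n, D.cS (b + D.n * i)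

theorem osum_add (b : ZMod D.m) (c : ℕ) : D.osum (b + D.n * c) = D.osum b := by
  induction c with
  | zero => simp
  | succ c ih =>
    rw [← ih, osum, osum]
    obtain ⟨N, hN⟩ := Nat.exists_eq_succ_of_ne_zero D.n_pos.ne'
    have hz : (D.n * (N + 1 : ℕ) : ZMod D.m) = 0 := by rw [← Nat.succ_eq_add_one, ← hN, n_mul_n]
    rw [show Finset.range D.n = Finset.range (N + 1) by rw [hN], Finset.sum_range_succ,
      Finset.sum_range_succ']
    congr 1
    · exact Finset.sum_congr rfl fun i _ => congrArg D.cS (by push_cast; ring)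
    · congr 1
      have : (b + D.n * (c + 1 : ℕ) + D.n * N : ZMod D.m) = b + D.n * c + D.n * (N + 1 : ℕ) := by
        push_cast; ring
      rw [this, hz]; simp

/-- Doubling permutes the residues modulo an odd number: the second half of the doubled indices,
reduced by the period, runs over the odd residues. -/
theorem sum_range_two_mul_of_periodic {M : Type*} [AddCommMonoid M] (g : ℕ → M) (h : ℕ)
    (hg : ∀ i, g (i + (2 * h + 1)) = g i) :
    ∑ i ∈ Finset.range (2 * h + 1), g (2 * i) = ∑ i ∈ Finset.range (2 * h + 1), g i := by
  have h1 : ∀ r, ∑ i ∈ Finset.range (2 * r + 1), g i =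
      ∑ i ∈ Finset.range (r + 1), g (2 * i) + ∑ i ∈ Finset.range r, g (2 * i + 1) := by
    intro r
    induction r with
    | zero => simp
    | succ r ih =>
      rw [show 2 * (r + 1) + 1 = 2 * r + 1 + 1 + 1 by ring, Finset.sum_range_succ,
        Finset.sum_range_succ, ih, Finset.sum_range_succ (fun i => g (2 * i)) (r + 1),
        Finset.sum_range_succ (fun i => g (2 * i + 1)) r]
      rw [show 2 * (r + 1) = 2 * r + 1 + 1 by ring]
      abel
  rw [h1 h, show 2 * h + 1 = (h + 1) + h by ring, Finset.sum_range_add]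
  congr 1
  refine Finset.sum_congr rfl fun i _ => ?_
  rw [← hg (2 * i + 1)]
  congr 1; ring

/-- All weights of the string have simple modules of dimension `n`, so every index is a head and
every summand is simple. Steps of `2n` run through the same weights as steps of `n`, because `n` is
odd. -/
theorem typ_mul_eq_osum {a b : ZMod D.m} (ha : D.L a ≠ 1) (hb : D.L b ≠ 1) (hab : D.L (a + b) ≠ 1) :
    D.cS a * D.cS b = D.osum (a + b) := by
  rw [D.typ_mul_typ (D.ell_eq_n ha) (D.ell_eq_n hb), D.heads_of_L hab _ le_rfl, osum]
  obtain ⟨h, hn⟩ := D.odd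
  have := sum_range_two_mul_of_periodic (fun i => D.cS (a + b + D.n * i)) h (fun i => by
    congr 1
    rw [← hn, Nat.cast_add, mul_add, n_mul_n, add_zero])
  rw [show Finset.range D.n = Finset.range (2 * h + 1) by rw [hn], ← this]
  refine Finset.sum_congr rfl fun i _ => ?_
  rw [D.cP_of_L hab]
  congr 2; push_cast; ring

theorem sum_range_symm {M : Type*} [AddCommMonoid M] (g : ℤ → M) (h : ℕ) :
    ∑ i ∈ Finset.range (2 * h + 1), g (i - h) =
      g 0 + ∑ i ∈ Finset.range h, (g (-(i + 1 : ℕ)) + g (i + 1 : ℕ)) := by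
  induction h with
  | zero => simp
  | succ h ih =>
    rw [show 2 * (h + 1) + 1 = 2 * h + 1 + 1 + 1 by ring, Finset.sum_range_succ,
      Finset.sum_range_succ', Finset.sum_range_succ _ h, ← add_assoc, ← ih]
    have e : ∀ i : ℕ, ((i + 1 : ℕ) : ℤ) - (h + 1 : ℕ) = i - h := fun i => by push_cast; ring
    simp only [e]
    rw [← add_assoc]
    congr 2
    push_cast; ring_nf

/-- For `n = 2h + 1`, the polynomial is the sum of the translations by `nj` for `-h ≤ j ≤ h`, a full
set of residues. It is the polynomial `g₄`. -/
theorem ay_mul_typ_eq_osum {b : ZMod D.m} (hb : D.L b ≠ 1) :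
    D.ay (1 + ∑ j ∈ Finset.Icc 1 ((D.n - 1) / 2), Chebyshev.C ℤ j) * D.cS b = D.osum b := by
  obtain ⟨h, hn⟩ := D.odd
  have h1 := sum_range_symm (fun i : ℤ => D.cS (b + D.n * (i : ZMod D.m))) h
  have h2 : D.osum b = ∑ i ∈ Finset.range (2 * h + 1),
      D.cS (b + D.n * (((i - h : ℤ)) : ZMod D.m)) := by
    have h3 := D.osum_add (b - D.n * h) h
    rw [sub_add_cancel] at h3
    rw [h3, osum, show Finset.range D.n = Finset.range (2 * h + 1) by rw [hn]]
    exact Finset.sum_congr rfl fun i _ => congrArg D.cS (by push_cast; ring)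
  rw [h2, h1, map_add, map_one, add_mul, one_mul, map_sum, Finset.sum_mul]
  congr 1
  · simp
  · rw [show (D.n - 1) / 2 = h by omega, ← Finset.Ico_add_one_right_eq_Icc, Finset.sum_Ico_eq_sum_range,
      Nat.add_sub_cancel]
    refine Finset.sum_congr rfl fun i _ => ?_
    rw [D.ay_C_mul_typ hb]
    congr 2 <;> (push_cast; ring)

/-- By `typ_mul_typ` the product depends on `a + b` only, and `st` has weight `n`. -/
theorem typ_mul_of_add_eq_two_n {a b : ZMod D.m} (ha : D.ell a = D.n) (hb : D.ell b = D.n)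
    (hab : a + b = 2 * D.n) : D.cS a * D.cS b = D.st * D.st := by
  rw [D.typ_mul_typ ha hb, D.typ_mul_typ D.ell_n D.ell_n, hab, two_mul]

theorem ell_three_n_add {i : ℕ} (hi : i + 1 < D.n) : D.ell (3 * D.n + 2 * D.n * i) =
    if D.n ≤ 2 * i + 2 then 2 * D.n - 2 - 2 * i else D.n - 2 - 2 * i := by
  split_ifs with h
  · refine D.ell_of_add (by omega) (by omega) ?_
    rw [show 2 * D.n - 2 - 2 * i = 2 * D.n - (2 + 2 * i) by omega,
      Nat.cast_sub (show 2 + 2 * i ≤ 2 * D.n by omega)]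
    push_cast
    linear_combination 2 * D.n_mul_n
  · refine D.ell_of_add (by omega) (by omega) ?_
    rw [show D.n - 2 - 2 * i = D.n - (2 + 2 * i) by omega,
      Nat.cast_sub (show 2 + 2 * i ≤ D.n by omega)]
    push_cast
    linear_combination D.n_mul_n

theorem ay_S_mul_st_eq : D.ay (Chebyshev.S ℤ (D.n - 2 : ℕ)) * D.st =
    ∑ i ∈ Finset.range (D.n - 1), if D.n ≤ 2 * i + 2 then D.cP (3 * D.n + 2 * D.n * i) else 0 := by
  have h2 := D.two_lt
  rw [D.ay_S (by omega), D.cS_neg_mul_st (by omega), show D.n - 2 + 1 = D.n - 1 by omega]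
  refine Finset.sum_congr rfl fun i _ => ?_
  have e : (-(D.n * (D.n - 2 : ℕ)) + D.n + 2 * D.n * i : ZMod D.m) = 3 * D.n + 2 * D.n * i := by
    rw [Nat.cast_sub h2.le]
    push_cast
    linear_combination -D.n_mul_n
  rw [e]
  by_cases h : D.n ≤ 2 * i + 2
  · rw [if_pos h, if_pos (by omega)]
  · rw [if_neg h, if_neg (by omega)]

/-- The last index `n - 1` of the string has weight `n` and contributes `st`. On the remaining
indices the heads and summands are those of `S_(n-2)(y) st`. -/
theorem typ_mul_of_add_eq_three_n {a b : ZMod D.m} (ha : D.ell a = D.n) (hb : D.ell b = D.n)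
    (hab : a + b = 3 * D.n) :
    D.cS a * D.cS b = D.st + D.ay (Chebyshev.S ℤ (D.n - 2 : ℕ)) * D.st := by
  obtain ⟨N, hN⟩ := Nat.exists_eq_succ_of_ne_zero D.n_pos.ne'
  have e : (3 * D.n + 2 * D.n * N : ZMod D.m) = D.n := by
    have : (D.n : ZMod D.m) = N + 1 := by rw [hN]; push_cast; ring
    have h2 := D.n_mul_n
    linear_combination 2 * h2 - 2 * D.n * this
  rw [D.typ_mul_typ ha hb, hab, ay_S_mul_st_eq, heads, Finset.sum_filter,
    show Finset.range D.n = Finset.range (N + 1) by rw [hN], Finset.sum_range_succ, add_comm,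
    show D.n - 1 = N by omega]
  congr 1
  · rw [e, ell_n, if_pos (by omega), cP_n]
  · refine Finset.sum_congr rfl fun i hi => ?_
    have hi' := Finset.mem_range.mp hi
    have h1 := D.ell_three_n_add (i := i) (by omega)
    by_cases h : D.n ≤ 2 * i + 2
    · rw [if_pos h] at h1 ⊢
      rw [if_pos (by omega)]
    · rw [if_neg h] at h1 ⊢
      rw [if_neg (by omega)]

/-- The same summands as for `3n`, but here `st` comes from the index `0` and the others are shifted
by one. -/
theorem typ_mul_of_add_eq_n {a b : ZMod D.m} (ha : D.ell a = D.n) (hb : D.ell b = D.n)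
    (hab : a + b = D.n) :
    D.cS a * D.cS b = D.st + D.ay (Chebyshev.S ℤ (D.n - 2 : ℕ)) * D.st := by
  obtain ⟨N, hN⟩ := Nat.exists_eq_succ_of_ne_zero D.n_pos.ne'
  rw [D.typ_mul_typ ha hb, hab, ay_S_mul_st_eq, heads, Finset.sum_filter,
    show Finset.range D.n = Finset.range (N + 1) by rw [hN], Finset.sum_range_succ', add_comm,
    show D.n - 1 = N by omega]
  congr 1
  · rw [Nat.cast_zero, mul_zero, add_zero, ell_n, if_pos (by omega), cP_n]
  · refine Finset.sum_congr rfl fun i hi => ?_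
    have hi' := Finset.mem_range.mp hi
    have h1 := D.ell_three_n_add (i := i) (by omega)
    have e : (D.n + 2 * D.n * (i + 1 : ℕ) : ZMod D.m) = 3 * D.n + 2 * D.n * i := by push_cast; ring
    rw [e]
    by_cases h : D.n ≤ 2 * i + 2
    · rw [if_pos h] at h1 ⊢
      rw [if_pos (by omega)]
    · rw [if_neg h] at h1 ⊢
      rw [if_neg (by omega)]

/-- The translate `S (t + c)` times `S (n - t)`. -/
theorem two_mul_typ_mul {t : ZMod D.m} (ht : D.L t ≠ 1) (j : ℕ) (x : D.quasi.GreenRing) :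
    D.cS (-D.n) * (D.cS (t + D.n * (j + 1 : ℕ)) * x) =
      D.cS (t + D.n * j) * x + D.cS (t + D.n * (j + 2 : ℕ)) * x := by
  have e1 : t + D.n * (j + 1 : ℕ) - D.n = t + D.n * j := by push_cast; ring
  have e2 : t + D.n * (j + 1 : ℕ) + D.n = t + D.n * (j + 2 : ℕ) := by push_cast; ring
  rw [← mul_assoc, D.two_mul_typ (by rwa [L_add_n_mul]), add_mul, e1, e2]

/-- Take two typical simple modules whose weights add to `2n`. Multiplying their product by `y`
translates the first factor by `n` and `-n`, which gives the products with weight sums `n` and `3n`.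
As these two are equal and `st = S_(n-1)(y)`, this is `y S_(n-1) st = 2 (1 + S_(n-2)) st`, and `y
S_(n-1) - 2 S_(n-2) = C_n`. -/
theorem ay_C_mul_st : D.ay (Chebyshev.C ℤ D.n - 2) * D.st = 0 := by
  have h2 := D.two_lt
  have hL := D.L_natCast_ne_one (t := 1) one_pos (by omega)
  have hL' : D.L (D.n - 1 : ℕ) ≠ 1 := D.L_natCast_ne_one (by omega) (by omega)
  have hs : ((1 : ℕ) : ZMod D.m) + (D.n - 1 : ℕ) = D.n := by
    rw [← Nat.cast_add]; congr 1; omega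
  have h := D.two_mul_typ_mul hL 0 (D.cS (D.n - 1 : ℕ))
  have hL2 : ∀ j : ℕ, D.ell (((1 : ℕ) : ZMod D.m) + D.n * j) = D.n := fun j =>
    D.ell_eq_n (by rwa [L_add_n_mul])
  rw [D.typ_mul_of_add_eq_n (hL2 0) (D.ell_eq_n hL') (by push_cast at hs ⊢; linear_combination hs),
    D.typ_mul_of_add_eq_three_n (hL2 (0 + 2)) (D.ell_eq_n hL') (by push_cast at hs ⊢; linear_combination hs),
    D.typ_mul_of_add_eq_two_n (hL2 (0 + 1)) (D.ell_eq_n hL') (by push_cast at hs ⊢; linear_combination hs)]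
    at h
  have h3 : D.st * D.st = D.ay (Chebyshev.S ℤ (D.n - 1 : ℕ)) * D.st := by rw [ay_S_top]
  have h4 : D.cS (-D.n) = D.ay X := (aeval_X _).symm
  have h5 : (Chebyshev.C ℤ D.n - 2 : ℤ[X]) =
      X * Chebyshev.S ℤ (D.n - 1 : ℕ) - 2 * Chebyshev.S ℤ (D.n - 2 : ℕ) - 2 := by
    rw [C_eq_S_sub_S, Chebyshev.S_eq, Nat.cast_sub (by omega : 1 ≤ D.n), Nat.cast_sub h2.le]
    push_cast; ring
  rw [h3, h4, ← mul_assoc] at h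
  rw [h5, map_sub, map_sub, map_mul, map_mul, map_ofNat, sub_mul, sub_mul, h, mul_assoc, two_mul, two_mul]
  abel

/-- The products with weight sum `jn` satisfy the three-term recurrence `two_mul_typ_mul`. It is run
from the sums `2n` and `3n` through `4n` to `5n`. -/
theorem typ_mul_of_add_eq_five_n {a b : ZMod D.m} (ha : D.L a ≠ 1) (hb : D.L b ≠ 1)
    (hab : a + b = 5 * D.n) :
    D.cS a * D.cS b = D.ay (Chebyshev.S ℤ (D.n - 4) + X ^ 2 - 1) * D.st := by
  have h2 := D.two_lt
  have hLt : D.L (a - D.n * (4 : ℕ)) ≠ 1 := by rwa [← D.L_add_n_mul _ 4, sub_add_cancel]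
  generalize ht : a - D.n * (4 : ℕ) = t at hLt
  have hat : a = t + D.n * (2 + 2 : ℕ) := by rw [← ht]; push_cast; ring
  have hL2 : ∀ j : ℕ, D.ell (t + D.n * j) = D.n := fun j => D.ell_eq_n (by rwa [L_add_n_mul])
  have hlb := D.ell_eq_n hb
  have h1 := D.two_mul_typ_mul hLt 1 (D.cS b)
  have h3 := D.two_mul_typ_mul hLt 2 (D.cS b)
  rw [hat] at hab
  push_cast at hab
  have p2 := D.typ_mul_of_add_eq_two_n (hL2 1) hlb (by push_cast; linear_combination hab)
  have p3 := D.typ_mul_of_add_eq_three_n (hL2 2) hlb (by push_cast; linear_combination hab)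
  have h6 : D.st * D.st = D.ay (Chebyshev.S ℤ (D.n - 1 : ℕ)) * D.st := by rw [ay_S_top]
  have h4 : D.cS (-D.n) = D.ay X := (aeval_X _).symm
  rw [show 1 + 1 = 2 from rfl, p3, p2, h6, h4] at h1
  rw [p3, h4, show 2 + 1 = 1 + 2 from rfl, ← sub_eq_iff_eq_add'.mpr h1] at h3
  rw [hat, ← sub_eq_iff_eq_add'.mpr h3]
  have h7 : (Chebyshev.S ℤ (D.n - 4) + X ^ 2 - 1 : ℤ[X]) =
      X * (X * (1 + Chebyshev.S ℤ (D.n - 2 : ℕ)) - Chebyshev.S ℤ (D.n - 1 : ℕ)) -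
        (1 + Chebyshev.S ℤ (D.n - 2 : ℕ)) := by
    have e1 := Chebyshev.S_eq ℤ ((D.n : ℤ) - 1)
    have e2 := Chebyshev.S_eq ℤ ((D.n : ℤ) - 2)
    rw [Nat.cast_sub (by omega : 1 ≤ D.n), Nat.cast_sub h2.le]
    push_cast
    ring_nf at e1 e2 ⊢
    linear_combination e2 + X * e1
  rw [h7]
  simp only [map_sub, map_mul, map_add, map_one, sub_mul, mul_sub, mul_add, add_mul, mul_assoc,
    one_mul, mul_one]

end QData
end

/-! ### Rank functions, linear independence and projective summands. -/

noncomputable section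

set_option linter.unusedSectionVars false

namespace QuasiBialgebra

variable {k H : Type u} [Field k] [Ring H] [Algebra k H] (B : QuasiBialgebra k H)

/-- The rank of the action of `u`, on isomorphism classes. -/
def isoRank (u : H) : B.IsoClass → ℤ :=
  Quotient.lift (fun M : FDMod k H => (Module.finrank k (LinearMap.range (M.act u)) : ℤ)) (by
    rintro M N ⟨f, hf⟩
    have h : LinearMap.range (N.act u) = (LinearMap.range (M.act u)).map f.toLinearMap := by
      ext x
      constructor
      · rintro ⟨y, rfl⟩
        exact ⟨_, ⟨f.symm y, rfl⟩, by simp [hf]⟩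
      · rintro ⟨_, ⟨y, rfl⟩, rfl⟩
        exact ⟨f y, (hf u y).symm⟩
    rw [h, LinearEquiv.finrank_map_eq])

theorem lift_isoRank_eq_zero (u : H) (x : FreeAbelianGroup B.IsoClass) (hx : x ∈ B.greenIdeal) :
    FreeAbelianGroup.lift (B.isoRank u) x = 0 := by
  have h : AddSubgroup.closure B.greenRel ≤ (FreeAbelianGroup.lift (B.isoRank u)).ker := by
    rw [AddSubgroup.closure_le]
    rintro _ ⟨M, N, rfl⟩
    have h1 : Module.finrank k (LinearMap.range ((M.act u).prodMap (N.act u))) =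
        Module.finrank k (LinearMap.range (M.act u)) + Module.finrank k (LinearMap.range (N.act u)) := by
      rw [LinearMap.range_prodMap, ← Module.finrank_prod]
      exact LinearEquiv.finrank_eq
        { toFun := fun x => (⟨x.1.1, x.2.1⟩, ⟨x.1.2, x.2.2⟩)
          invFun := fun p => ⟨(p.1.1, p.2.1), ⟨p.1.2, p.2.2⟩⟩
          map_add' := fun _ _ => rfl
          map_smul' := fun _ _ => rfl }
    have h2 : Module.finrank k (LinearMap.range ((FDMod.sum M N).act u)) =
        Module.finrank k (LinearMap.range (M.act u)) + Module.finrank k (LinearMap.range (N.act u)) :=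
      h1
    change FreeAbelianGroup.lift (B.isoRank u) _ = 0
    rw [map_sub, map_sub, FreeAbelianGroup.lift_apply_of, FreeAbelianGroup.lift_apply_of,
      FreeAbelianGroup.lift_apply_of]
    change (Module.finrank k (LinearMap.range ((FDMod.sum M N).act u)) : ℤ) -
      Module.finrank k (LinearMap.range (M.act u)) - Module.finrank k (LinearMap.range (N.act u)) = 0
    rw [h2]; push_cast; ring
  exact h hx

/-- The additive function on the Green ring with value the rank of the action of `u`. -/
def rk (u : H) : B.GreenRing →+ ℤ :=
  QuotientAddGroup.lift B.greenIdeal.toAddSubgroup (FreeAbelianGroup.lift (B.isoRank u))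
    (B.lift_isoRank_eq_zero u)

theorem rk_cls (u : H) (M : FDMod k H) :
    B.rk u (B.cls M) = Module.finrank k (LinearMap.range (M.act u)) :=
  FreeAbelianGroup.lift_apply_of _ _

theorem rk_cls_eq_zero {u : H} {M : FDMod k H} (h : ∀ x : M.carrier, u • x = 0) :
    B.rk u (B.cls M) = 0 := by
  have : M.act u = 0 := LinearMap.ext h
  rw [rk_cls, this, LinearMap.range_zero, finrank_bot, Nat.cast_zero]

theorem rk_cls_ne_zero {u : H} {M : FDMod k H} {x : M.carrier} (h : u • x ≠ 0) :
    B.rk u (B.cls M) ≠ 0 := by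
  rw [rk_cls, Nat.cast_ne_zero, Ne, Submodule.finrank_eq_zero, LinearMap.range_eq_bot]
  intro h'
  exact h (LinearMap.congr_fun h' x)

end QuasiBialgebra

namespace QData

open Polynomial

variable {k : Type u} [Field k] (D : QData k)

/-! ### Linear independence of the classes of simple and projective modules -/

theorem rk_e_cS (s : ZMod D.m) : D.quasi.rk (D.e s) (D.cS s) ≠ 0 := by
  refine D.quasi.rk_cls_ne_zero (x := D.lv s 0) ?_
  rw [(D.inZ_lv s).e_smul]
  exact D.lv_ne_zero s (D.ell_pos s)

theorem rk_e_cS_of_ne {s b : ZMod D.m} (h : s ≠ b) : D.quasi.rk (D.e s) (D.cS b) = 0 :=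
  D.quasi.rk_cls_eq_zero fun x => (D.inZ_e_smul s x).S_eq_zero h

theorem rk_EF_e_cS (s b : ZMod D.m) : D.quasi.rk (D.EF * D.e s) (D.cS b) = 0 := by
  refine D.quasi.rk_cls_eq_zero fun x => ?_
  rw [mul_smul, (D.inZ_e_smul s x).S_eq, smul_comm D.EF (_ : k), EF_lv, gam_zero, zero_smul, smul_zero]

theorem rk_EF_e_cP_of_ne {s b : ZMod D.m} (h : s ≠ b) : D.quasi.rk (D.EF * D.e s) (D.cP b) = 0 := by
  refine D.quasi.rk_cls_eq_zero fun x => ?_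
  obtain ⟨u, rfl⟩ := D.exists_smul_pe b x
  rw [mul_smul]
  exact (D.inZ_pe b).EF_e_smul h u

/-- The lower bound is not computed directly: it is the equality case of the dimension count in
`Strung.cls_eq`, for the product of `S (-nd)` and `S n` at the head `d`. -/
theorem finrank_P {d : ℕ} (h0 : 0 < d) (hd : d < D.n) :
    Module.finrank k (D.P (D.n + D.n * d)).carrier = 2 * D.n := by
  have h := D.heads_neg hd
  have h1 := (D.strung_left (-(D.n * d)) D.n D.ell_n)
  rw [D.ell_neg_n_mul hd] at h1
  have h2 := (h1.cls_eq fun i hi _ => h.2 i hi).2 d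
    (by rw [h.1, Finset.mem_filter, Finset.mem_range]; omega)
  have e : (-(D.n * d) + D.n + 2 * D.n * d : ZMod D.m) = D.n + D.n * d := by ring
  rw [e, D.ell_n_add hd] at h2
  exact h2 (by omega)

theorem rk_EF_e_cP {d : ℕ} (h0 : 0 < d) (hd : d < D.n) :
    D.quasi.rk (D.EF * D.e (D.n + D.n * d)) (D.cP (D.n + D.n * d)) ≠ 0 := by
  refine D.quasi.rk_cls_ne_zero (x := D.pe _) ?_
  rw [mul_smul, (D.inZ_pe _).e_smul]
  exact D.EF_pe_ne_zero (by rw [D.ell_n_add hd]; omega) (D.finrank_P h0 hd)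

/-- The classes of the simple modules and of the indecomposable projective modules that are
not simple. -/
def simpleProj : ZMod D.m ⊕ Fin (D.n - 1) → D.quasi.GreenRing :=
  Sum.elim D.cS (fun j => D.cP (D.n + D.n * (j.val + 1 : ℕ)))

/-- The system is triangular. The rank of `EF · e s` vanishes on all simple classes and isolates one
nonsimple projective; once those coefficients are zero, the rank of `e s` isolates one simple class.
-/
theorem linearIndependent_simpleProj : LinearIndependent ℤ D.simpleProj := by
  rw [Fintype.linearIndependent_iff]
  intro g hg
  rw [Fintype.sum_sum_type] at hg
  simp only [simpleProj, Sum.elim_inl, Sum.elim_inr] at hg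
  have hP : ∀ j, g (.inr j) = 0 := by
    intro j
    have hj := j.isLt
    have h := congrArg (D.quasi.rk (D.EF * D.e (D.n + D.n * (j.val + 1 : ℕ)))) hg
    rw [map_add, map_sum, map_sum, map_zero, Finset.sum_eq_zero, zero_add,
      Finset.sum_eq_single j] at h
    · rw [map_zsmul, smul_eq_mul] at h
      exact (mul_eq_zero.mp h).resolve_right (D.rk_EF_e_cP (Nat.succ_pos _) (by omega))
    · intro i _ hi
      have hi' := i.isLt
      rw [map_zsmul, rk_EF_e_cP_of_ne, smul_zero]
      intro he
      have h1 := congrArg D.ell he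
      rw [D.ell_n_add (by omega), D.ell_n_add (by omega)] at h1
      exact hi (Fin.ext (by omega))
    · intro h'; exact absurd (Finset.mem_univ _) h'
    · intro b _
      rw [map_zsmul, rk_EF_e_cS, smul_zero]
  intro i
  rcases i with s | j
  · have h := congrArg (D.quasi.rk (D.e s)) hg
    rw [Finset.sum_eq_zero (s := (Finset.univ : Finset (Fin (D.n - 1))))
      (fun j _ => by rw [hP j, zero_smul]), add_zero, map_sum, map_zero,
      Finset.sum_eq_single s] at h
    · rw [map_zsmul, smul_eq_mul] at h
      exact (mul_eq_zero.mp h).resolve_right (D.rk_e_cS s)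
    · intro b _ hb
      rw [map_zsmul, D.rk_e_cS_of_ne hb.symm, smul_zero]
    · intro h'; exact absurd (Finset.mem_univ _) h'
  · exact hP j

/-! ### Projective modules -/

theorem isProjective_P (s : ZMod D.m) : (D.P s).IsProjective := by
  let f : D.U →ₗ[D.U] (D.P s).carrier := LinearMap.toSpanSingleton D.U _ (D.pe s)
  have h : (D.inZ_pe s).hom = LinearMap.id := by
    refine LinearMap.ext fun p => ?_
    obtain ⟨u, rfl⟩ := D.exists_smul_pe s p
    rw [map_smul, InZ.hom_pe, LinearMap.id_apply]
  let g : (D.P s).carrier →ₗ[D.U] D.U := (D.inZ_e s).hom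
  refine Module.Projective.of_split g f (LinearMap.ext fun p => ?_)
  obtain ⟨u, rfl⟩ := D.exists_smul_pe s p
  have hg : g (D.pe s) = D.e s := InZ.hom_pe _
  rw [LinearMap.comp_apply, LinearMap.id_apply, map_smul, map_smul, hg,
    LinearMap.toSpanSingleton_apply, (D.inZ_pe s).e_smul]

theorem P_hom_ext {s : ZMod D.m} {X : Type u} [AddCommGroup X] [Module D.U X]
    {f g : (D.P s).carrier →ₗ[D.U] X} (h : f (D.pe s) = g (D.pe s)) : f = g := by
  refine LinearMap.ext fun p => ?_
  obtain ⟨u, rfl⟩ := D.exists_smul_pe s p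
  rw [map_smul, map_smul, h]

/-- A surjection from `M` to some `S b` lifts to `h : M → P b`, and a preimage of the lowest vector,
projected by `e b`, gives `g : P b → M`. If `h ∘ g` were not onto, some `f'` would map `P b` onto a
simple module and kill its image. Such an `f'` is a nonzero multiple of the canonical map to `S b`,
which does not vanish on that image. -/
theorem exists_P_summand {M : FDMod k D.U} (hM : M.IsProjective) [Nontrivial M.carrier] :
    ∃ b, ∃ g : (D.P b).carrier →ₗ[D.U] M.carrier, ∃ h : M.carrier →ₗ[D.U] (D.P b).carrier,
      Function.Bijective (h ∘ₗ g) := by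
  have hM' : Module.Projective D.U M.carrier := hM
  obtain ⟨b, f, hf, -⟩ := D.exists_hom_S (X := M) ⊥ bot_ne_top
  obtain ⟨x, hx⟩ := hf (D.lv b 0)
  have hπ : Function.Surjective (D.inZ_lv b).hom := by
    rw [← LinearMap.range_eq_top]
    exact D.span_lv b _ ⟨_, (D.inZ_lv b).hom_pe⟩
  obtain ⟨h, hh⟩ := Module.projective_lifting_property _ f hπ
  let g : (D.P b).carrier →ₗ[D.U] M.carrier := (D.inZ_e_smul b x).hom
  have hg : (D.inZ_lv b).hom (h (g (D.pe b))) = D.lv b 0 := by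
    rw [← LinearMap.comp_apply, hh, InZ.hom_pe, map_smul, hx, (D.inZ_lv b).e_smul]
  have hsurj : Function.Surjective (h ∘ₗ g) := by
    rw [← LinearMap.range_eq_top]
    by_contra hne
    obtain ⟨c, f', hf', hf0⟩ := D.exists_hom_S (X := D.P b) _ hne
    have hk : ∀ (c' : k) (v : (D.P b).carrier), f' (c' • v) = c' • f' v := fun c' v => by
      rw [← algebraMap_smul D.U, map_smul, algebraMap_smul]
    have hZ : D.InZ b (f' (D.pe b)) :=
      ⟨by rw [← map_smul, (D.inZ_pe b).wt, hk], by
        rw [← map_smul, ← map_smul, (D.inZ_pe b).sq, map_zero]⟩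
    have hne0 : f' (D.pe b) ≠ 0 := by
      intro h0
      have : f' = 0 := D.P_hom_ext h0
      obtain ⟨y, hy⟩ := hf' (D.lv c 0)
      rw [this] at hy
      exact D.lv_ne_zero c (D.ell_pos c) hy.symm
    have hcb : b = c := by
      by_contra hcb
      exact hne0 (hZ.S_eq_zero hcb)
    subst hcb
    have hS := hZ.S_eq
    have hf'π : f' = algebraMap k (Module.End D.U (D.S b).carrier) (D.lc b 0 (f' (D.pe b))) ∘ₗ
        (D.inZ_lv b).hom := by
      refine D.P_hom_ext ?_
      rw [LinearMap.comp_apply, InZ.hom_pe]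
      exact hS
    have h1 := hf0 _ ⟨D.pe b, rfl⟩
    rw [hf'π, LinearMap.comp_apply, LinearMap.comp_apply, hg] at h1
    exact hne0 (hS.trans h1)
  refine ⟨b, g, h, ?_, hsurj⟩
  exact (LinearMap.injective_iff_surjective (f := (h ∘ₗ g).restrictScalars k)).mpr hsurj

/-- Induction on dimension: after a summand `P b` is split off, the complement `ker h` is again
projective and strictly smaller. -/
theorem cls_mem_of_isProjective {A : AddSubgroup D.quasi.GreenRing} (hA : ∀ b, D.cP b ∈ A)
    {M : FDMod k D.U} (hM : M.IsProjective) : D.quasi.cls M ∈ A := by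
  induction hN : Module.finrank k M.carrier using Nat.strong_induction_on generalizing M with
  | _ N ih =>
    rcases subsingleton_or_nontrivial M.carrier with hs | hn
    · rw [D.quasi.cls_eq_zero_of_subsingleton]; exact zero_mem _
    · obtain ⟨b, g, h, hgh⟩ := D.exists_P_summand hM
      let σ := LinearEquiv.ofBijective (h ∘ₗ g) hgh
      have hσ : ∀ p, h (g (σ.symm p)) = p := fun p => σ.apply_symm_apply p
      have hfd : FiniteDimensional k (LinearMap.ker h) :=
        inferInstanceAs (FiniteDimensional k ((LinearMap.ker h).restrictScalars k))
      let Q : FDMod k D.U := FDMod.of (LinearMap.ker h)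
      let ι : Q.carrier →ₗ[D.U] M.carrier := (LinearMap.ker h).subtype
      let r : M.carrier →ₗ[D.U] LinearMap.ker h :=
        (LinearMap.id - g ∘ₗ σ.symm.toLinearMap ∘ₗ h).codRestrict _ fun x => by
          rw [LinearMap.mem_ker]
          change h (x - g (σ.symm (h x))) = 0
          rw [map_sub, hσ, sub_self]
      have hQ : Q.IsProjective := by
        have hM' : Module.Projective D.U M.carrier := hM
        refine Module.Projective.of_split (LinearMap.ker h).subtype r (LinearMap.ext fun x => ?_)
        refine Subtype.ext ?_
        change x.1 - g (σ.symm (h x.1)) = x.1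
        rw [LinearMap.mem_ker.mp x.2, map_zero, map_zero, sub_zero]
      have hd : Module.finrank k (D.P b).carrier + Module.finrank k Q.carrier =
          Module.finrank k M.carrier := by
        have := LinearMap.finrank_range_add_finrank_ker (h.restrictScalars k)
        have hr : LinearMap.range (h.restrictScalars k) = ⊤ :=
          LinearMap.range_eq_top.mpr fun p => ⟨_, hσ p⟩
        rw [hr, finrank_top] at this
        exact this
      have hpos : 0 < Module.finrank k (D.P b).carrier := by
        have : Nontrivial (D.P b).carrier := by
          refine ⟨D.pe b, 0, fun h0 => ?_⟩
          have h1 := (D.inZ_lv b).hom_pe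
          rw [h0, map_zero] at h1
          exact D.lv_ne_zero b (D.ell_pos b) h1.symm
        exact Module.finrank_pos
      rw [D.cls_eq_add g ι (fun x => ⟨σ.symm (h x), r x, by
        change g (σ.symm (h x)) + (x - g (σ.symm (h x))) = x
        abel⟩) hd.le]
      exact add_mem (hA b) (ih _ (by omega) hQ rfl)

end QData
end

/-! ### The polynomial side: Chebyshev identities and a spanning set. -/

noncomputable section

namespace PCR

open Polynomial

/-- Evaluation of an integral polynomial at an element of a commutative ring. -/
def ev {A : Type*} [CommRing A] (y : A) : ℤ[X] →+* A := eval₂RingHom (Int.castRingHom A) y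

@[simp] theorem ev_X {A : Type*} [CommRing A] (y : A) : ev y X = y := eval₂_X _ _

theorem ev_eq_sum_range {A : Type*} [CommRing A] (y : A) (p : ℤ[X]) :
    ev y p = ∑ i ∈ Finset.range (p.natDegree + 1), p.coeff i • y ^ i := by
  refine (eval₂_eq_sum_range (Int.castRingHom A) y).trans (Finset.sum_congr rfl fun i _ => ?_)
  rw [zsmul_eq_mul]; rfl

theorem map_ev {A B : Type*} [CommRing A] [CommRing B] (φ : A →+* B) (y : A) (p : ℤ[X]) :
    φ (ev y p) = ev (φ y) p := by
  refine (hom_eval₂ p (Int.castRingHom A) φ y).trans ?_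
  rw [RingHom.eq_intCast' (φ.comp _)]; rfl

/-! ### The polynomials in terms of Chebyshev polynomials -/

section chebyshev

variable {A : Type*} [CommRing A] (y : A)

/-- Pascal's rule in the form of the recurrence of the polynomials `S_N`. Summing up to `N` instead
of `N / 2` keeps the ranges uniform, the extra binomial coefficients being zero. -/
theorem sum_choose_succ_succ (N : ℕ) :
    ∑ i ∈ Finset.range (N + 2 + 1), (-1) ^ i * ((N + 2 - i).choose i : A) * y ^ (N + 2 - 2 * i) =
      y * ∑ i ∈ Finset.range (N + 1 + 1), (-1) ^ i * ((N + 1 - i).choose i : A) * y ^ (N + 1 - 2 * i) -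
        ∑ i ∈ Finset.range (N + 1), (-1) ^ i * ((N - i).choose i : A) * y ^ (N - 2 * i) := by
  rw [Finset.sum_range_succ, Nat.sub_self, Nat.choose_eq_zero_of_lt (Nat.succ_pos _),
    Finset.sum_range_succ', Finset.sum_range_succ' _ (N + 1)]
  simp only [Nat.cast_zero, mul_zero, zero_mul, add_zero, pow_zero, Nat.sub_zero, Nat.choose_zero_right,
    Nat.cast_one, one_mul]
  rw [mul_add, ← pow_succ', add_sub_right_comm, Finset.mul_sum, ← Finset.sum_sub_distrib]
  congr 1
  refine Finset.sum_congr rfl fun j hj => ?_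
  have hj' := Finset.mem_range.mp hj
  rw [show N + 2 - (j + 1) = N - j + 1 by omega, show N + 1 - (j + 1) = N - j by omega,
    Nat.choose_succ_succ, show N + 2 - 2 * (j + 1) = N - 2 * j by omega]
  -- In the first case the exponents on the two sides may differ through truncated subtraction, but
  -- the binomial coefficient in front is zero.
  rcases Nat.lt_or_ge (N - j) (j + 1) with h | h
  · rw [Nat.choose_eq_zero_of_lt h]; push_cast; ring
  · rw [show N - 2 * j = N + 1 - 2 * (j + 1) + 1 by omega]; push_cast; ring

theorem ev_S_eq_sum_range (N : ℕ) : ev y (Chebyshev.S ℤ N) =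
    ∑ i ∈ Finset.range (N + 1), (-1) ^ i * ((N - i).choose i : A) * y ^ (N - 2 * i) := by
  induction N using Nat.strong_induction_on with
  | _ N ih =>
    match N with
    | 0 => simp
    | 1 => simp [Finset.sum_range_succ]
    | N + 2 =>
      rw [sum_choose_succ_succ, ← ih (N + 1) (by omega), ← ih N (by omega)]
      push_cast
      rw [Chebyshev.S_add_two, map_sub, map_mul, ev_X]

theorem ev_S_eq_sum (N : ℕ) : ev y (Chebyshev.S ℤ N) =
    ∑ i ∈ Finset.Icc 0 (N / 2), (-1) ^ i * ((N - i).choose i : A) * y ^ (N - 2 * i) := by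
  rw [ev_S_eq_sum_range]
  refine (Finset.sum_subset (fun i hi => ?_) fun i hi hi' => ?_).symm
  · rw [Finset.mem_Icc] at hi; rw [Finset.mem_range]; omega
  · rw [Finset.mem_range] at hi; rw [Finset.mem_Icc] at hi'
    rw [Nat.choose_eq_zero_of_lt (by omega), Nat.cast_zero, mul_zero, zero_mul]

theorem lucas_zero {N : ℕ} (hN : 0 < N) : lucas N 0 = 1 := by
  rw [lucas, Nat.sub_zero, Nat.choose_zero_right, mul_one, Nat.div_self hN, Nat.cast_one]

/-- The two binomial coefficients are those of `S_N` and `S_(N-2)`, which matches `C_N = S_N -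
S_(N-2)`. -/
theorem lucas_succ {N j : ℕ} (h : 2 * (j + 1) ≤ N) :
    lucas N (j + 1) = (N - (j + 1)).choose (j + 1) + (N - 2 - j).choose j := by
  obtain ⟨M, rfl⟩ := Nat.exists_eq_add_of_le' (show j + 2 ≤ N by omega)
  have e : (M + (j + 2)) * (M + 1).choose (j + 1) =
      (M + 1) * ((M + 1).choose (j + 1) + M.choose j) := by
    have := Nat.add_one_mul_choose_eq M j
    rw [show M + (j + 2) = (M + 1) + (j + 1) by ring, add_mul, mul_comm (j + 1), ← this]
    ring
  rw [lucas, show M + (j + 2) - (j + 1) = M + 1 by omega, e, Nat.mul_div_cancel_left _ M.succ_pos,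
    show M + (j + 2) - 2 - j = M by omega]
  push_cast; ring

theorem lucas_two_mul {i : ℕ} (hi : 0 < i) : lucas (2 * i) i = 2 := by
  obtain ⟨j, rfl⟩ := Nat.exists_eq_succ_of_ne_zero hi.ne'
  rw [Nat.succ_eq_add_one, lucas_succ le_rfl, show 2 * (j + 1) - (j + 1) = j + 1 by omega,
    show 2 * (j + 1) - 2 - j = j by omega, Nat.choose_self, Nat.choose_self]
  rfl

theorem ev_C_eq_sum {N : ℕ} (hN : 0 < N) : ev y (Chebyshev.C ℤ N) =
    ∑ i ∈ Finset.Icc 0 (N / 2), (-1) ^ i * (lucas N i : A) * y ^ (N - 2 * i) := by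
  rw [QData.C_eq_S_sub_S, map_sub, ev_S_eq_sum]
  match N, hN with
  | 1, _ => simp [lucas_zero]
  | N + 2, _ =>
    rw [show ((N + 2 : ℕ) : ℤ) - 2 = (N : ℕ) by push_cast; ring, ev_S_eq_sum,
      ← Nat.range_succ_eq_Icc_zero, ← Nat.range_succ_eq_Icc_zero,
      show (N + 2) / 2 = N / 2 + 1 by omega, Finset.sum_range_succ', Finset.sum_range_succ' _ (N / 2 + 1),
      lucas_zero (by omega), add_sub_right_comm, ← Finset.sum_sub_distrib]
    congr 1
    · refine Finset.sum_congr rfl fun j hj => ?_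
      have hj' := Finset.mem_range.mp hj
      rw [lucas_succ (by omega), show N + 2 - 2 * (j + 1) = N - 2 * j by omega,
        show N + 2 - 2 - j = N - j by omega]
      push_cast; ring
    · simp

theorem sum_C_eq_sum (h : ℕ) : ev y (∑ j ∈ Finset.Icc 1 h, Chebyshev.C ℤ j) =
    ∑ j ∈ Finset.Icc 1 h, ∑ i ∈ Finset.Icc 0 ((h - j) / 2),
      (-1) ^ i * (lucas (j + 2 * i) i : A) * y ^ j +
    ∑ i ∈ Finset.Icc 1 (h / 2), (-1) ^ i * 2 := by
  -- Because of this value a term `N = 0` can be added for free, and the substitution `j = N - 2i`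
  -- then runs over a full triangle. The terms with `j = 0` have coefficient `2` and are split off
  -- at the end.
  have h0 : lucas 0 0 = 0 := rfl
  have e1 : ev y (∑ j ∈ Finset.Icc 1 h, Chebyshev.C ℤ j) =
      ∑ N ∈ Finset.Icc 0 h, ∑ i ∈ Finset.Icc 0 (N / 2),
        (-1) ^ i * (lucas N i : A) * y ^ (N - 2 * i) := by
    rw [map_sum, ← Finset.add_sum_Ioc_eq_sum_Icc (Nat.zero_le h)]
    simp only [Nat.zero_div, Finset.Icc_self, Finset.sum_singleton, h0, Int.cast_zero, mul_zero,
      zero_mul, zero_add]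
    exact Finset.sum_congr rfl fun N hN => ev_C_eq_sum y (Finset.mem_Ioc.mp hN).1
  have e2 : ∑ N ∈ Finset.Icc 0 h, ∑ i ∈ Finset.Icc 0 (N / 2),
        (-1) ^ i * (lucas N i : A) * y ^ (N - 2 * i) =
      ∑ j ∈ Finset.Icc 0 h, ∑ i ∈ Finset.Icc 0 ((h - j) / 2),
        (-1) ^ i * (lucas (j + 2 * i) i : A) * y ^ j := by
    rw [Finset.sum_sigma', Finset.sum_sigma']
    refine Finset.sum_nbij' (fun p => ⟨p.1 - 2 * p.2, p.2⟩) (fun p => ⟨p.1 + 2 * p.2, p.2⟩) ?_ ?_ ?_ ?_ ?_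
    · rintro ⟨N, i⟩ hp
      simp only [Finset.mem_sigma, Finset.mem_Icc] at hp ⊢
      omega
    · rintro ⟨N, i⟩ hp
      simp only [Finset.mem_sigma, Finset.mem_Icc] at hp ⊢
      omega
    · rintro ⟨N, i⟩ hp
      simp only [Finset.mem_sigma, Finset.mem_Icc] at hp
      simp only [Sigma.mk.injEq, heq_eq_eq, and_true]
      omega
    · rintro ⟨N, i⟩ _
      simp only [Sigma.mk.injEq, heq_eq_eq, and_true]
      omega
    · rintro ⟨N, i⟩ hp
      simp only [Finset.mem_sigma, Finset.mem_Icc] at hp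
      simp only
      rw [show N - 2 * i + 2 * i = N by omega]
  rw [e1, e2, ← Finset.add_sum_Ioc_eq_sum_Icc (Nat.zero_le h), add_comm]
  congr 1
  rw [← Finset.add_sum_Ioc_eq_sum_Icc (Nat.zero_le _)]
  simp only [mul_zero, add_zero, h0, Int.cast_zero, zero_add, pow_zero, mul_one, Nat.sub_zero]
  refine Finset.sum_congr rfl fun i hi => ?_
  rw [lucas_two_mul (Finset.mem_Icc.mp hi).1]
  norm_num

end chebyshev

variable {n : ℕ}

theorem f₁_eq : f₁ n = ev (y n) (Chebyshev.S ℤ (n - 1 : ℕ)) :=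
  (ev_S_eq_sum _ _).symm

theorem f₂_eq (h : Odd n) : f₂ n = ev (y n) (Chebyshev.C ℤ n - 2) := by
  have h0 := h.pos
  obtain ⟨r, hr⟩ := h
  rw [f₂, map_sub, map_ofNat, ev_C_eq_sum _ h0, show n / 2 = (n - 1) / 2 by omega]

theorem f₄_eq (h : Odd n) (hn : 2 < n) : f₄ n = ev (y n) (Chebyshev.S ℤ (n - 2 : ℕ)) := by
  obtain ⟨r, hr⟩ := h
  rw [f₄, ev_S_eq_sum, ← Nat.range_succ_eq_Icc_zero, ← Finset.Ico_add_one_right_eq_Icc,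
    Finset.sum_Ico_eq_sum_range, show (n - 1) / 2 + 1 - 1 = (n - 2) / 2 + 1 by omega]
  refine Finset.sum_congr rfl fun i _ => ?_
  rw [Nat.add_sub_cancel_left, show n - (1 + i) - 1 = n - 2 - i by omega,
    show n - 2 * (1 + i) = n - 2 - 2 * i by omega]

theorem g₁_eq (h : Odd n) : g₁ n = ev (y n) (Chebyshev.C ℤ ((n + 1) / 2 : ℕ)) := by
  obtain ⟨r, hr⟩ := h
  rw [g₁, ev_C_eq_sum _ (by omega), show (n + 1) / 4 = (n + 1) / 2 / 2 by omega]

theorem g₂_eq (hn : 2 < n) : g₂ n = ev (y n) (Chebyshev.C ℤ ((n - 1) / 2 : ℕ)) := by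
  rw [g₂, ev_C_eq_sum _ (by omega), show (n - 1) / 4 = (n - 1) / 2 / 2 by omega]

theorem g₃_eq (h : Odd n) (hn : 2 < n) :
    g₃ n = ev (y n) (Chebyshev.S ℤ (n - 4) + X ^ 2 - 1) := by
  rw [g₃, map_sub, map_add, map_pow, ev_X, map_one]
  congr 2
  obtain ⟨r, hr⟩ := h
  -- For `n = 3` the sum is empty, in agreement with `S_(-1) = 0`.
  rcases Nat.lt_or_ge n 4 with h4 | h4
  · have : n = 3 := by omega
    subst this
    rw [Finset.Icc_eq_empty (by norm_num), Finset.sum_empty,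
      show ((3 : ℕ) : ℤ) - 4 = -1 by norm_num, Chebyshev.S_neg_one, map_zero]
  · rw [show (n : ℤ) - 4 = (n - 4 : ℕ) by rw [Nat.cast_sub h4]; rfl, ev_S_eq_sum,
      ← Nat.range_succ_eq_Icc_zero, ← Finset.Ico_add_one_right_eq_Icc,
      Finset.sum_Ico_eq_sum_range, show (n - 1) / 2 + 1 - 2 = (n - 4) / 2 + 1 by omega]
    refine Finset.sum_congr rfl fun i _ => ?_
    rw [Nat.add_sub_cancel_left, show n - 2 - (2 + i) = n - 4 - i by omega,
      show n - 2 * (2 + i) = n - 4 - 2 * i by omega, pow_add]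
    norm_num

theorem g₄_eq (h : Odd n) :
    g₄ n = ev (y n) (1 + ∑ j ∈ Finset.Icc 1 ((n - 1) / 2), Chebyshev.C ℤ j) := by
  obtain ⟨r, hr⟩ := h
  rw [map_add, map_one, sum_C_eq_sum, g₄, show (n - 1) / 4 = (n - 1) / 2 / 2 by omega, add_comm 1]
  congr 2
  refine Finset.sum_congr rfl fun j _ => ?_
  rw [show (n - 1 - 2 * j) / 4 = ((n - 1) / 2 - j) / 2 by omega]

/-! ### Degrees -/

theorem monic_S (N : ℕ) : (Chebyshev.S ℤ N).Monic ∧ (Chebyshev.S ℤ N).natDegree = N := by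
  induction N using Nat.strong_induction_on with
  | _ N ih =>
    match N with
    | 0 => simp
    | 1 => simp
    | N + 2 =>
      obtain ⟨h1, h2⟩ := ih (N + 1) (by omega)
      obtain ⟨_, h3⟩ := ih N (by omega)
      push_cast at h1 h2 ⊢
      have hd : (X * Chebyshev.S ℤ (N + 1) : ℤ[X]).natDegree = N + 2 := by
        rw [monic_X.natDegree_mul h1, natDegree_X, h2]; ring
      have hlt : (Chebyshev.S ℤ N).degree < (X * Chebyshev.S ℤ (N + 1) : ℤ[X]).degree := by
        refine degree_lt_degree ?_
        rw [hd, h3]; omega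
      rw [Chebyshev.S_add_two]
      exact ⟨(monic_X.mul h1).sub_of_left hlt, by
        rw [natDegree_sub_eq_left_of_natDegree_lt (by rw [hd, h3]; omega), hd]⟩

theorem monic_C {N : ℕ} (h : 0 < N) : (Chebyshev.C ℤ N).Monic ∧ (Chebyshev.C ℤ N).natDegree = N := by
  rw [QData.C_eq_S_sub_S]
  match N, h with
  | 1, _ => simp
  | N + 2, _ =>
    obtain ⟨h1, h2⟩ := monic_S (N + 2)
    obtain ⟨h3, h4⟩ := monic_S N
    rw [show ((N + 2 : ℕ) : ℤ) - 2 = (N : ℕ) by push_cast; ring]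
    exact ⟨h1.sub_of_left (degree_lt_degree (by omega)), by
      rw [natDegree_sub_eq_left_of_natDegree_lt (by omega), h2]⟩

theorem monic_one_add_sum_C (h : ℕ) : (1 + ∑ j ∈ Finset.Icc 1 h, Chebyshev.C ℤ j : ℤ[X]).Monic ∧
    (1 + ∑ j ∈ Finset.Icc 1 h, Chebyshev.C ℤ j : ℤ[X]).natDegree = h := by
  induction h with
  | zero => simp
  | succ h ih =>
    obtain ⟨h1, h2⟩ := monic_C (N := h + 1) (by omega)
    rw [Finset.sum_Icc_succ_top (by omega), ← add_assoc]
    exact ⟨h1.add_of_right (degree_lt_degree (by omega)), by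
      rw [natDegree_add_eq_right_of_natDegree_lt (by omega), h2]⟩

/-! ### A spanning set of the quotient -/

/-- Divide `X^j` by the monic `p`: the remainder is handled by `h1`, the multiple of `p` by `h2`. -/
theorem pow_mul_mem {A : Type*} [CommRing A] (y z : A) (W : Submodule ℤ A) {p : ℤ[X]} (hp : p.Monic)
    (h1 : ∀ i < p.natDegree, y ^ i * z ∈ W) (h2 : ∀ j, y ^ j * (ev y p * z) ∈ W) (j : ℕ) :
    y ^ j * z ∈ W := by
  have h3 : ∀ (r : ℤ[X]) (w : A), (∀ i ≤ r.natDegree, y ^ i * w ∈ W) → ev y r * w ∈ W := by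
    intro r w hr
    rw [ev_eq_sum_range, Finset.sum_mul]
    refine W.sum_mem fun i hi => ?_
    rw [smul_mul_assoc]
    exact W.smul_mem _ (hr i (by have := Finset.mem_range.mp hi; omega))
  have h4 := congrArg (ev y) (modByMonic_add_div (X ^ j : ℤ[X]) (q := p))
  rw [map_pow, ev_X, map_add, map_mul] at h4
  rw [← h4, add_mul, mul_comm (ev y p), mul_assoc]
  refine W.add_mem ?_ (h3 _ _ fun i _ => h2 i)
  by_cases h0 : (X ^ j : ℤ[X]) %ₘ p = 0
  · rw [h0, map_zero, zero_mul]; exact W.zero_mem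
  · refine h3 _ _ fun i hi => h1 i (lt_of_le_of_lt hi ?_)
    exact natDegree_lt_natDegree h0 (degree_modByMonic_lt _ hp)

/-- The quotient ring. -/
abbrev Quot (n : ℕ) : Type := Poly n ⧸ J n

/-- The quotient map. -/
abbrev mk (n : ℕ) : Poly n →+* Quot n := Ideal.Quotient.mk (J n)

/-- The index type of the basis. -/
abbrev BIdx (n : ℕ) : Type :=
  Fin (2 * n - 1) ⊕ (Idx n × Fin ((n + 1) / 2)) ⊕ (Idx n × Fin ((n - 1) / 2))

/-- The spanning family of the quotient. -/
def fam (n : ℕ) : BIdx n → Quot n :=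
  Sum.elim (fun i => mk n (y n) ^ (i : ℕ))
    (Sum.elim (fun p => mk n (y n) ^ (p.2 : ℕ) * mk n (x p.1))
      (fun p => mk n (y n) ^ (p.2 : ℕ) * mk n (ε p.1)))

theorem mk_eq_of_rel {p q : Poly n} (h : Rel n (p - q)) : mk n p = mk n q :=
  Ideal.Quotient.eq.mpr (Ideal.subset_span h)

theorem mk_ev (p : ℤ[X]) : mk n (ev (y n) p) = ev (mk n (y n)) p := map_ev _ _ _

/-- The span is stable under multiplication by the variables. The monic polynomials `f₁ f₂`, `g₁ -
g₂` and `g₄`, of degrees `2n - 1`, `(n+1)/2` and `(n-1)/2`, bound the powers of `y` alone, in front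
of `x_t`, and in front of `ε_t`; in the last case the rest is moved to `x_t`. The other relations
remove every product of two variables different from `y`. -/
theorem span_fam (h : Odd n) (hn : 2 < n) : Submodule.span ℤ (Set.range (fam n)) = ⊤ := by
  have hodd := h
  obtain ⟨r, hr⟩ := hodd
  set W := Submodule.span ℤ (Set.range (fam n)) with hW
  set Y := mk n (y n) with hY
  have hsub : ∀ i, fam n i ∈ W := fun i => Submodule.subset_span ⟨i, rfl⟩
  have hy : ∀ j, Y ^ j ∈ W := by
    intro j
    obtain ⟨m1, d1⟩ := monic_S (n - 1)
    obtain ⟨m2, d2⟩ := monic_C (N := n) (by omega)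
    have d3 : (2 : ℤ[X]).natDegree < (Chebyshev.C ℤ n).natDegree := by
      rw [d2, natDegree_ofNat]; omega
    have m3 : (Chebyshev.C ℤ n - 2 : ℤ[X]).Monic := m2.sub_of_left (degree_lt_degree d3)
    have d4 : (Chebyshev.C ℤ n - 2 : ℤ[X]).natDegree = n := by
      rw [natDegree_sub_eq_left_of_natDegree_lt d3, d2]
    have hrel : ev Y (Chebyshev.S ℤ (n - 1 : ℕ) * (Chebyshev.C ℤ n - 2)) = 0 := by
      rw [hY, ← mk_ev, map_mul, ← f₁_eq, ← f₂_eq h]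
      exact Ideal.Quotient.eq_zero_iff_mem.mpr (Ideal.subset_span Rel.yy)
    have := pow_mul_mem Y 1 W (m1.mul m3) (fun i hi => ?_) (fun j => ?_) j
    · rwa [mul_one] at this
    · rw [m1.natDegree_mul m3, d1, d4] at hi
      rw [mul_one]
      exact hsub (.inl ⟨i, by omega⟩)
    · rw [hrel, zero_mul, mul_zero]; exact W.zero_mem
  have hx : ∀ t j, Y ^ j * mk n (x t) ∈ W := by
    intro t j
    obtain ⟨m1, d1⟩ := monic_C (N := (n + 1) / 2) (by omega)
    obtain ⟨m2, d2⟩ := monic_C (N := (n - 1) / 2) (by omega)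
    have d3 : (Chebyshev.C ℤ ((n - 1) / 2 : ℕ)).natDegree < (Chebyshev.C ℤ ((n + 1) / 2 : ℕ)).natDegree := by
      rw [d1, d2]; omega
    have hrel : ev Y (Chebyshev.C ℤ ((n + 1) / 2 : ℕ) - Chebyshev.C ℤ ((n - 1) / 2 : ℕ)) *
        mk n (x t) = 0 := by
      rw [hY, ← mk_ev, map_sub, ← g₁_eq h, ← g₂_eq hn, ← map_mul]
      exact Ideal.Quotient.eq_zero_iff_mem.mpr (Ideal.subset_span (Rel.yx t))
    refine pow_mul_mem Y _ W (m1.sub_of_left (degree_lt_degree d3)) (fun i hi => ?_) (fun j => ?_) j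
    · rw [natDegree_sub_eq_left_of_natDegree_lt d3, d1] at hi
      exact hsub (.inr (.inl (t, ⟨i, hi⟩)))
    · rw [hrel, mul_zero]; exact W.zero_mem
  have hay : ∀ (z : Quot n), (∀ j, Y ^ j * z ∈ W) → ∀ (p : ℤ[X]) (j : ℕ),
      Y ^ j * (ev Y p * z) ∈ W := by
    intro z hz p j
    rw [ev_eq_sum_range, Finset.sum_mul, Finset.mul_sum]
    refine W.sum_mem fun i _ => ?_
    rw [smul_mul_assoc, mul_smul_comm, ← mul_assoc, ← pow_add]
    exact W.smul_mem _ (hz _)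
  have hg : ∀ t, mk n (g₄ n) * mk n (x t) = mk n (g₄ n) * mk n (ε t) := by
    intro t
    rw [← map_mul, ← map_mul]
    exact mk_eq_of_rel (by rw [← mul_sub]; exact Rel.xε t)
  have hε : ∀ t j, Y ^ j * mk n (ε t) ∈ W := by
    intro t j
    obtain ⟨m1, d1⟩ := monic_one_add_sum_C ((n - 1) / 2)
    refine pow_mul_mem Y _ W m1 (fun i hi => ?_) (fun j => ?_) j
    · rw [d1] at hi
      exact hsub (.inr (.inr (t, ⟨i, hi⟩)))
    · have h1 := hg t
      rw [g₄_eq h, mk_ev] at h1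
      rw [← h1]
      exact hay _ (hx t) _ j
  have hay1 : ∀ (p : ℤ[X]) (j : ℕ), Y ^ j * ev Y p ∈ W := by
    intro p j
    have := hay 1 (fun j => by rw [mul_one]; exact hy j) p j
    rwa [mul_one] at this
  have hxx : ∀ t t' j, Y ^ j * (mk n (x t) * mk n (x t')) ∈ W := by
    intro t t' j
    have ht := Finset.mem_Icc.mp t.2
    have ht' := Finset.mem_Icc.mp t'.2
    rw [← map_mul]
    rcases lt_trichotomy (t.val + t'.val) n with hlt | heq | hgt
    · rw [mk_eq_of_rel (Rel.xx_lt t t' ⟨t.val + t'.val, Finset.mem_Icc.mpr (by omega)⟩ rfl), map_mul,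
        g₄_eq h, mk_ev]
      exact hay _ (hx _) _ j
    · rw [mk_eq_of_rel (Rel.xx_eq t t' heq), f₄_eq h hn, f₁_eq,
        show (1 : Poly n) = ev (y n) (1 : ℤ[X]) from (map_one _).symm, ← map_add, ← map_mul, mk_ev]
      exact hay1 _ _
    · rw [mk_eq_of_rel (Rel.xx_gt t t' ⟨t.val + t'.val - n, Finset.mem_Icc.mpr (by omega)⟩
        (by simp only; omega)), map_mul, g₄_eq h, mk_ev]
      exact hay _ (hx _) _ j
  have hxε : ∀ t t' j, Y ^ j * (mk n (x t) * mk n (ε t')) ∈ W := by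
    intro t t' j
    have := hxx t t' j
    rwa [← map_mul, mk_eq_of_rel (Rel.xx_xε t t'), map_mul] at this
  have hεε : ∀ t t' j, Y ^ j * (mk n (ε t) * mk n (ε t')) ∈ W := by
    intro t t' j
    by_cases htt : t.val + t'.val = n
    · rw [← map_mul, mk_eq_of_rel (Rel.εε_eq t t' htt), g₃_eq h hn, f₁_eq, ← map_mul, mk_ev]
      exact hay1 _ _
    · have := hxx t t' j
      rwa [← map_mul, mk_eq_of_rel (Rel.xx_εε t t' htt), map_mul] at this
  have hgen : ∀ (v : Var n), ∀ w ∈ W, w * mk n (MvPolynomial.X v) ∈ W := by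
    intro v w hw
    have hle : W ≤ W.comap (LinearMap.mulRight ℤ (mk n (MvPolynomial.X v))) := by
      rw [hW, Submodule.span_le]
      rintro _ ⟨i, rfl⟩
      change fam n i * mk n (MvPolynomial.X v) ∈ W
      match i, v with
      | .inl i, .y => exact (pow_succ Y i.val) ▸ hy _
      | .inl i, .x t => exact hx t _
      | .inl i, .ε t => exact hε t _
      | .inr (.inl (t, j)), .y =>
        change Y ^ (j : ℕ) * mk n (x t) * Y ∈ W
        rw [mul_right_comm, ← pow_succ]; exact hx t _
      | .inr (.inl (t, j)), .x t' =>
        change Y ^ (j : ℕ) * mk n (x t) * mk n (x t') ∈ W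
        rw [mul_assoc]; exact hxx t t' _
      | .inr (.inl (t, j)), .ε t' =>
        change Y ^ (j : ℕ) * mk n (x t) * mk n (ε t') ∈ W
        rw [mul_assoc]; exact hxε t t' _
      | .inr (.inr (t, j)), .y =>
        change Y ^ (j : ℕ) * mk n (ε t) * Y ∈ W
        rw [mul_right_comm, ← pow_succ]; exact hε t _
      | .inr (.inr (t, j)), .x t' =>
        change Y ^ (j : ℕ) * mk n (ε t) * mk n (x t') ∈ W
        rw [mul_assoc, mul_comm (mk n (ε t))]; exact hxε t' t _
      | .inr (.inr (t, j)), .ε t' =>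
        change Y ^ (j : ℕ) * mk n (ε t) * mk n (ε t') ∈ W
        rw [mul_assoc]; exact hεε t t' _
    exact hle hw
  rw [eq_top_iff]
  rintro q -
  obtain ⟨p, rfl⟩ := Ideal.Quotient.mk_surjective q
  induction p using MvPolynomial.induction_on with
  | C c =>
    have h1 : mk n (MvPolynomial.C c) = c • Y ^ 0 := by
      rw [pow_zero, zsmul_one, ← map_intCast (mk n) c]; congr 1
    rw [h1]
    exact W.smul_mem _ (hy 0)
  | add p q hp hq => rw [map_add]; exact W.add_mem hp hq
  | mul_X p v hp => rw [map_mul]; exact hgen v _ hp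

end PCR
end

/-! ### Generators of the projective class ring. -/

noncomputable section

namespace QData

open Polynomial

variable {k : Type u} [Field k] (D : QData k)

/-! ### The projective class ring -/

theorem n_mul_mod (a : ℕ) : (D.n * (a % D.n : ℕ) : ZMod D.m) = D.n * a := by
  conv_rhs => rw [← Nat.mod_add_div a D.n]
  push_cast
  rw [mul_add, ← mul_assoc, n_mul_n, zero_mul, add_zero]

theorem exists_of_L_eq_one {b : ZMod D.m} (hb : D.L b = 1) : ∃ j < D.n, b = D.n + D.n * (j : ℕ) := by
  rw [← ZMod.natCast_zmod_val b, L_natCast] at hb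
  obtain ⟨c, hc⟩ := D.prim_q.dvd_of_pow_eq_one _ hb
  -- With `b = nc` the equation `b = n + nj` asks for `j = c - 1` modulo `n`.
  refine ⟨(c + (D.n - 1)) % D.n, Nat.mod_lt _ D.n_pos, ?_⟩
  rw [n_mul_mod, ← ZMod.natCast_zmod_val b, hc, Nat.cast_add, Nat.cast_sub D.n_pos]
  push_cast
  linear_combination -D.n_mul_n

theorem exists_of_L_ne_one {b : ZMod D.m} (hb : D.L b ≠ 1) :
    ∃ t a : ℕ, 0 < t ∧ t < D.n ∧ b = t + D.n * a := by
  refine ⟨b.val % D.n, b.val / D.n, Nat.pos_of_ne_zero fun h => hb ?_, Nat.mod_lt _ D.n_pos, ?_⟩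
  · obtain ⟨c, hc⟩ := Nat.dvd_of_mod_eq_zero h
    rw [← ZMod.natCast_zmod_val b, hc, Nat.cast_mul, L_n_mul]
  · conv_lhs => rw [← ZMod.natCast_zmod_val b, ← Nat.mod_add_div b.val D.n]
    push_cast; rfl

/-- The classes of the modules that correspond to the variables. -/
def varCls : PCR.Var D.n → D.quasi.GreenRing
  | .y => D.cS (-D.n)
  | .x t => D.cS t.val
  | .ε t => D.cS (t.val + 2 * D.n)

theorem idx_pos (t : PCR.Idx D.n) : 0 < t.val ∧ t.val < D.n := by
  have := Finset.mem_Icc.mp t.2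
  have := D.n_pos
  omega

theorem L_idx (t : PCR.Idx D.n) : D.L t.val ≠ 1 := D.L_natCast_ne_one (D.idx_pos t).1 (D.idx_pos t).2

theorem L_idx_add (t : PCR.Idx D.n) : D.L (t.val + 2 * D.n) ≠ 1 := by
  have := D.L_add_two_n_mul t.val 1
  rw [Nat.cast_one, mul_one] at this
  rw [this]; exact D.L_idx t

theorem varCls_comm (u v : PCR.Var D.n) : D.varCls u * D.varCls v = D.varCls v * D.varCls u := by
  match u, v with
  | .y, .y => rfl
  | .y, .x t => exact (D.typ_mul_two (D.L_idx t)).symm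
  | .y, .ε t => exact (D.typ_mul_two (D.L_idx_add t)).symm
  | .x t, .y => exact D.typ_mul_two (D.L_idx t)
  | .ε t, .y => exact D.typ_mul_two (D.L_idx_add t)
  | .x t, .x t' => exact D.typ_mul_comm (D.ell_eq_n (D.L_idx t)) (D.ell_eq_n (D.L_idx t'))
  | .x t, .ε t' => exact D.typ_mul_comm (D.ell_eq_n (D.L_idx t)) (D.ell_eq_n (D.L_idx_add t'))
  | .ε t, .x t' => exact D.typ_mul_comm (D.ell_eq_n (D.L_idx_add t)) (D.ell_eq_n (D.L_idx t'))
  | .ε t, .ε t' => exact D.typ_mul_comm (D.ell_eq_n (D.L_idx_add t)) (D.ell_eq_n (D.L_idx_add t'))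

section generators

variable {R : Subring D.quasi.GreenRing}

theorem ay_mem (hR : ∀ v, D.varCls v ∈ R) (p : ℤ[X]) : D.ay p ∈ R := by
  induction p using Polynomial.induction_on' with
  | add p q hp hq => rw [map_add]; exact add_mem hp hq
  | monomial i c =>
    rw [← C_mul_X_pow_eq_monomial, map_mul, map_pow, aeval_X, aeval_C]
    exact mul_mem (by rw [eq_intCast]; exact intCast_mem _ _) (pow_mem (hR .y) _)

/-- Two reflections make a translation: `C_a(y)` about `t` exchanges `t + na` and `t - na`, and
`C_(a+2)(y)` about `t + 2n` exchanges `t - na` and `t + n(a + 4)`. Starting from `a = 0` and `a = 2`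
this reaches every even `a`, and an odd `a` may be replaced by the even number `a + n`. -/
theorem cS_add_mem (hR : ∀ v, D.varCls v ∈ R) {t : PCR.Idx D.n} (a : ℕ) : D.cS (t.val + D.n * a) ∈ R := by
  have h0 : D.cS (t.val + D.n * (0 : ℕ)) ∈ R := by
    rw [Nat.cast_zero, mul_zero, add_zero]; exact hR (.x t)
  have h2 : D.cS (t.val + D.n * (2 : ℕ)) ∈ R := by
    rw [Nat.cast_ofNat, mul_comm (D.n : ZMod D.m)]; exact hR (.ε t)
  have h4 : ∀ a : ℕ, D.cS (t.val + D.n * a) ∈ R → D.cS (t.val + D.n * (a + 4 : ℕ)) ∈ R := by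
    intro a ha
    have e1 : D.cS (t.val - D.n * a) ∈ R := by
      have := sub_mem (mul_mem (D.ay_mem hR (Chebyshev.C ℤ a)) h0) ha
      rwa [Nat.cast_zero, mul_zero, add_zero, D.ay_C_mul_typ (D.L_idx t), add_sub_cancel_right] at this
    have := sub_mem (mul_mem (D.ay_mem hR (Chebyshev.C ℤ (a + 2 : ℕ))) h2) e1
    rw [D.ay_C_mul_typ (by rw [L_add_n_mul]; exact D.L_idx t)] at this
    have e2 : (t.val + D.n * (2 : ℕ) - D.n * (a + 2 : ℕ) : ZMod D.m) = t.val - D.n * a := by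
      push_cast; ring
    have e3 : (t.val + D.n * (2 : ℕ) + D.n * (a + 2 : ℕ) : ZMod D.m) = t.val + D.n * (a + 4 : ℕ) := by
      push_cast; ring
    rwa [e2, e3, add_sub_cancel_left] at this
  have heven : ∀ i : ℕ, D.cS (t.val + D.n * (2 * i : ℕ)) ∈ R := by
    intro i
    induction i using Nat.strong_induction_on with
    | _ i ih =>
      match i with
      | 0 => exact h0
      | 1 => exact h2
      | i + 2 =>
        rw [show 2 * (i + 2) = 2 * i + 4 by ring]
        exact h4 _ (ih i (by omega))
  rcases Nat.even_or_odd' a with ⟨i, rfl | rfl⟩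
  · exact heven i
  · obtain ⟨h, hn⟩ := D.odd
    have := heven (i + h + 1)
    rwa [show 2 * (i + h + 1) = 2 * i + 1 + D.n by omega, Nat.cast_add _ D.n, mul_add, n_mul_n,
      add_zero] at this

theorem cS_mem (hR : ∀ v, D.varCls v ∈ R) (b : ZMod D.m) : D.cS b ∈ R := by
  by_cases hb : D.L b = 1
  · obtain ⟨j, hj, rfl⟩ := D.exists_of_L_eq_one hb
    have e : (D.n + D.n * j : ZMod D.m) = -(D.n * (D.n - 1 - j : ℕ)) := by
      rw [Nat.sub_sub, Nat.cast_sub (by omega)]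
      push_cast
      linear_combination D.n_mul_n
    rw [e, ← D.ay_S (by omega)]
    exact D.ay_mem hR _
  · obtain ⟨t, a, h0, ht, rfl⟩ := D.exists_of_L_ne_one hb
    exact D.cS_add_mem hR (t := ⟨t, Finset.mem_Icc.mpr (by omega)⟩) a

theorem cP_mem (hR : ∀ v, D.varCls v ∈ R) (b : ZMod D.m) : D.cP b ∈ R := by
  by_cases hb : D.L b = 1
  · obtain ⟨j, hj, rfl⟩ := D.exists_of_L_eq_one hb
    rcases Nat.eq_zero_or_pos j with rfl | h0
    · rw [Nat.cast_zero, mul_zero, add_zero, cP_n]; exact D.cS_mem hR _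
    · rw [D.cP_eq h0 hj]
      exact mul_mem (D.ay_mem hR _) (D.cS_mem hR _)
  · rw [D.cP_eq_cS _ (D.ell_eq_n hb)]; exact D.cS_mem hR _

end generators

theorem cS_mem_projClassRing (b : ZMod D.m) : D.cS b ∈ D.quasi.projClassRing :=
  Subring.subset_closure ⟨D.S b, Or.inr (D.isSimpleModule_S b), rfl⟩

theorem varCls_mem (v : PCR.Var D.n) : D.varCls v ∈ D.quasi.projClassRing := by
  cases v <;> exact D.cS_mem_projClassRing _

/-- Projective modules are handled by splitting off summands `P b`, simple ones by the
classification. This gives both the commutativity of the ring and the surjectivity of the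
presentation. -/
theorem projClassRing_le [IsAlgClosed k] [CharZero k] {R : Subring D.quasi.GreenRing}
    (hR : ∀ v, D.varCls v ∈ R) : D.quasi.projClassRing ≤ R := by
  rw [QuasiBialgebra.projClassRing, Subring.closure_le]
  rintro _ ⟨M, hM | hM, rfl⟩
  · exact D.cls_mem_of_isProjective (A := R.toAddSubgroup) (D.cP_mem hR) hM
  · have : IsSimpleModule D.U M.carrier := hM
    obtain ⟨s, ⟨f⟩⟩ := D.exists_equiv_S (X := M.carrier)
    rw [← D.quasi.cls_eq_of_equiv f]
    exact D.cS_mem hR s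

variable [IsAlgClosed k] [CharZero k]

theorem isMulCommutative_projClassRing : IsMulCommutative D.quasi.projClassRing := by
  have h := Subring.isMulCommutative_closure (s := Set.range D.varCls) (by
    rintro _ ⟨u, rfl⟩ _ ⟨v, rfl⟩
    exact D.varCls_comm u v)
  have hle := D.projClassRing_le (R := Subring.closure (Set.range D.varCls))
    fun v => Subring.subset_closure ⟨v, rfl⟩
  have hcomm : ∀ a ∈ D.quasi.projClassRing, ∀ b ∈ D.quasi.projClassRing, a * b = b * a := by
    intro a ha b hb
    have := h.is_comm.comm ⟨a, hle ha⟩ ⟨b, hle hb⟩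
    rwa [MulMemClass.mk_mul_mk, MulMemClass.mk_mul_mk, Subtype.mk.injEq] at this
  refine ⟨⟨fun a b => Subtype.ext ?_⟩⟩
  rw [Subring.coe_mul, Subring.coe_mul]
  exact hcomm a.1 a.2 b.1 b.2

/-- The commutative ring structure of the projective class ring. -/
abbrev commRingProj : CommRing D.quasi.projClassRing where
  mul_comm := D.isMulCommutative_projClassRing.is_comm.comm

/-- The homomorphism from the polynomial ring to the projective class ring. -/
def toProj : PCR.Poly D.n →+* D.quasi.projClassRing :=
  letI := D.commRingProj
  MvPolynomial.eval₂Hom (Int.castRingHom _) fun v => ⟨D.varCls v, D.varCls_mem v⟩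

/-- The homomorphism from the polynomial ring to the Green ring. -/
def toGreen : PCR.Poly D.n →+* D.quasi.GreenRing := D.quasi.projClassRing.subtype.comp D.toProj

theorem toGreen_X (v : PCR.Var D.n) : D.toGreen (MvPolynomial.X v) = D.varCls v := by
  let _ := D.commRingProj
  exact congrArg Subtype.val
    (MvPolynomial.eval₂Hom_X' (Int.castRingHom D.quasi.projClassRing) _ v)

theorem toGreen_ev (p : ℤ[X]) : D.toGreen (PCR.ev (PCR.y D.n) p) = D.ay p := by
  have : D.toGreen.comp (PCR.ev (PCR.y D.n)) = D.ay.toRingHom := by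
    refine Polynomial.ringHom_ext (fun a => ?_) ?_
    · simp
    · rw [RingHom.comp_apply, PCR.ev_X, toGreen_X]
      exact (aeval_X _).symm
  exact congrArg (· p) this

end QData
end

/-! ### The relations, the basis and the isomorphism. -/

noncomputable section

namespace QData

open Polynomial

variable {k : Type u} [Field k] (D : QData k)

/-- Outside the case `t + s = n` the product is a full orbit sum, which does not see `a` and `b`. In
that case the branch is left as it stands, because the product depends on `a + b`. -/
theorem cS_mul_cS_idx (t s : PCR.Idx D.n) (a b : ℕ) :
    D.cS (t.val + D.n * a) * D.cS (s.val + D.n * b) =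
      if (t.val + s.val : ℕ) = D.n then D.cS (t.val + D.n * a) * D.cS (s.val + D.n * b)
      else D.osum (t.val + s.val : ℕ) := by
  split_ifs with h
  · rfl
  · have hL : D.L (t.val + s.val : ℕ) ≠ 1 := by
      have := D.idx_pos t; have := D.idx_pos s
      rw [L_natCast]
      intro h1
      obtain ⟨c, hc⟩ := D.prim_q.dvd_of_pow_eq_one _ h1
      rcases (show c = 0 ∨ c = 1 ∨ 2 ≤ c by omega) with rfl | rfl | hc2
      · omega
      · omega
      · nlinarith
    have e : (t.val + D.n * a + (s.val + D.n * b) : ZMod D.m) =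
        (t.val + s.val : ℕ) + D.n * (a + b : ℕ) := by push_cast; ring
    rw [D.typ_mul_eq_osum (by rw [L_add_n_mul]; exact D.L_idx t) (by rw [L_add_n_mul]; exact D.L_idx s)
      (by rwa [e, L_add_n_mul]), e, osum_add]

theorem varCls_x (t : PCR.Idx D.n) : D.varCls (.x t) = D.cS (t.val + D.n * (0 : ℕ)) := by
  rw [Nat.cast_zero, mul_zero, add_zero]; rfl

theorem varCls_ε (t : PCR.Idx D.n) : D.varCls (.ε t) = D.cS (t.val + D.n * (2 : ℕ)) := by
  rw [Nat.cast_ofNat, mul_comm (D.n : ZMod D.m)]; rfl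

theorem x_mul_x_of_add_eq {t s : PCR.Idx D.n} (h : t.val + s.val = D.n) :
    D.varCls (.x t) * D.varCls (.x s) = D.st + D.ay (Chebyshev.S ℤ (D.n - 2 : ℕ)) * D.st :=
  D.typ_mul_of_add_eq_n (D.ell_eq_n (D.L_idx t)) (D.ell_eq_n (D.L_idx s)) (by exact_mod_cast congrArg (Nat.cast (R := ZMod D.m)) h)

theorem x_mul_ε_of_add_eq {t s : PCR.Idx D.n} (h : t.val + s.val = D.n) :
    D.varCls (.x t) * D.varCls (.ε s) = D.st + D.ay (Chebyshev.S ℤ (D.n - 2 : ℕ)) * D.st := by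
  have h' : (t.val + s.val : ZMod D.m) = D.n := by
    exact_mod_cast congrArg (Nat.cast (R := ZMod D.m)) h
  exact D.typ_mul_of_add_eq_three_n (D.ell_eq_n (D.L_idx t)) (D.ell_eq_n (D.L_idx_add s))
    (by linear_combination h')

theorem ε_mul_ε_of_add_eq {t s : PCR.Idx D.n} (h : t.val + s.val = D.n) :
    D.varCls (.ε t) * D.varCls (.ε s) = D.ay (Chebyshev.S ℤ (D.n - 4) + X ^ 2 - 1) * D.st := by
  have h' : (t.val + s.val : ZMod D.m) = D.n := by
    exact_mod_cast congrArg (Nat.cast (R := ZMod D.m)) h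
  exact D.typ_mul_of_add_eq_five_n (D.L_idx_add t) (D.L_idx_add s) (by linear_combination h')

theorem card_bIdx : Fintype.card (PCR.BIdx D.n) = D.n ^ 2 + D.n - 1 := by
  obtain ⟨h, hn⟩ := D.odd
  simp only [Fintype.card_sum, Fintype.card_prod, Fintype.card_fin, Fintype.card_coe, Nat.card_Icc]
  rw [hn, show (2 * h + 1 + 1) / 2 = h + 1 by omega, show (2 * h + 1 - 1) / 2 = h by omega,
    show 2 * h + 1 - 1 + 1 - 1 = 2 * h by omega, show 2 * (2 * h + 1) - 1 = 4 * h + 1 by omega]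
  symm
  apply Nat.sub_eq_of_eq_add
  ring

theorem card_simpleProj : Fintype.card (ZMod D.m ⊕ Fin (D.n - 1)) = D.n ^ 2 + D.n - 1 := by
  rw [Fintype.card_sum, ZMod.card, Fintype.card_fin, Nat.add_sub_assoc D.n_pos]

theorem simpleProj_mem (i : ZMod D.m ⊕ Fin (D.n - 1)) : D.simpleProj i ∈ D.quasi.projClassRing := by
  cases i with
  | inl s => exact D.cS_mem_projClassRing s
  | inr j => exact Subring.subset_closure ⟨_, Or.inl (D.isProjective_P _), rfl⟩

theorem cls_V₂ : D.quasi.cls D.V₂ = D.varCls .y := by rw [V₂_eq]; rfl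

theorem cls_VV_zero (t : PCR.Idx D.n) : D.quasi.cls (D.VV t 0) = D.varCls (.x t) := by
  rw [D.VV_eq (D.idx_pos t).1 (D.idx_pos t).2, Nat.cast_zero, mul_zero, add_zero]; rfl

theorem cls_VV_one (t : PCR.Idx D.n) : D.quasi.cls (D.VV t 1) = D.varCls (.ε t) := by
  rw [D.VV_eq (D.idx_pos t).1 (D.idx_pos t).2, Nat.cast_one, mul_one]; rfl

variable [IsAlgClosed k] [CharZero k]

theorem toGreen_g₄_mul (t : PCR.Idx D.n) (a : ℕ) :
    D.toGreen (PCR.g₄ D.n) * D.cS (t.val + D.n * a) = D.osum t.val := by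
  rw [PCR.g₄_eq D.odd, toGreen_ev, D.ay_mul_typ_eq_osum (by rw [L_add_n_mul]; exact D.L_idx t), osum_add]

theorem toGreen_eq_zero_of_rel {p : PCR.Poly D.n} (hp : PCR.Rel D.n p) : D.toGreen p = 0 := by
  have h2 := D.two_lt
  have hst : D.toGreen (PCR.f₁ D.n) = D.st := by rw [PCR.f₁_eq, toGreen_ev, ay_S_top]
  cases hp with
  | yy =>
    rw [mul_comm, map_mul, hst, PCR.f₂_eq D.odd, toGreen_ev, ay_C_mul_st]
  -- For `n = 2h + 1` one has `n(h+1) = -nh` in `ℤ/n²`, so `C_(h+1)` and `C_h` produce the same two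
  -- translates of `S t`.
  | yx t =>
    obtain ⟨h, hn⟩ := D.odd
    rw [map_mul, map_sub, PCR.g₁_eq D.odd, PCR.g₂_eq h2, toGreen_ev, toGreen_ev, toGreen_X, sub_mul,
      sub_eq_zero]
    change D.ay _ * D.cS t.val = D.ay _ * D.cS t.val
    rw [D.ay_C_mul_typ (D.L_idx t), D.ay_C_mul_typ (D.L_idx t), add_comm,
      show (D.n + 1) / 2 = h + 1 by omega, show (D.n - 1) / 2 = h by omega]
    have hn' : (D.n : ZMod D.m) = 2 * h + 1 := by exact_mod_cast congrArg (Nat.cast (R := ZMod D.m)) hn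
    congr 2
    · push_cast; linear_combination D.n_mul_n - (D.n : ZMod D.m) * hn'
    · push_cast; linear_combination -D.n_mul_n + (D.n : ZMod D.m) * hn'
  | xε t =>
    rw [map_mul, map_sub, toGreen_X, toGreen_X, varCls_x, varCls_ε, mul_sub, toGreen_g₄_mul,
      toGreen_g₄_mul, sub_self]
  | xx_xε t s =>
    rw [map_sub, map_mul, map_mul, toGreen_X, toGreen_X, toGreen_X, sub_eq_zero]
    by_cases h : t.val + s.val = D.n
    · rw [D.x_mul_x_of_add_eq h, D.x_mul_ε_of_add_eq h]
    · rw [varCls_x, varCls_x, varCls_ε, cS_mul_cS_idx, D.cS_mul_cS_idx t s 0 2, if_neg h, if_neg h]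
  | xx_εε t s h =>
    rw [map_sub, map_mul, map_mul, toGreen_X, toGreen_X, toGreen_X, toGreen_X, sub_eq_zero, varCls_x,
      varCls_x, varCls_ε, varCls_ε, cS_mul_cS_idx, D.cS_mul_cS_idx t s 2 2, if_neg h, if_neg h]
  | xx_lt t s r h =>
    have := D.idx_pos r
    rw [map_sub, map_mul, map_mul, toGreen_X, toGreen_X, toGreen_X, sub_eq_zero, varCls_x, varCls_x,
      varCls_x, cS_mul_cS_idx, if_neg (by omega), h, toGreen_g₄_mul]
  -- The orbit sum over `r + n` is the orbit sum over `r`.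
  | xx_gt t s r h =>
    have := D.idx_pos r
    have e := D.osum_add r.val 1
    rw [map_sub, map_mul, map_mul, toGreen_X, toGreen_X, toGreen_X, sub_eq_zero, varCls_x, varCls_x,
      varCls_x, cS_mul_cS_idx, if_neg (by omega), h, toGreen_g₄_mul, ← e, Nat.cast_add, Nat.cast_one,
      mul_one]
  | xx_eq t s h =>
    rw [map_sub, map_mul, map_mul, toGreen_X, toGreen_X, D.x_mul_x_of_add_eq h, hst, map_add, map_one,
      PCR.f₄_eq D.odd h2, toGreen_ev, add_mul, one_mul, add_comm, sub_self]
  | εε_eq t s h =>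
    rw [map_sub, map_mul, map_mul, toGreen_X, toGreen_X, D.ε_mul_ε_of_add_eq h, hst, PCR.g₃_eq D.odd h2,
      toGreen_ev, sub_self]

/-- The homomorphism from the quotient ring to the projective class ring. -/
def fromQuot : PCR.Quot D.n →+* D.quasi.projClassRing :=
  Ideal.Quotient.lift (PCR.J D.n) D.toProj fun p hp => by
    have hle : PCR.J D.n ≤ RingHom.ker D.toProj :=
      Ideal.span_le.mpr fun p hp => Subtype.ext (D.toGreen_eq_zero_of_rel hp)
    exact hle hp

theorem coe_fromQuot_mk (p : PCR.Poly D.n) :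
    (D.fromQuot (PCR.mk D.n p) : D.quasi.GreenRing) = D.toGreen p := rfl

theorem fromQuot_surjective : Function.Surjective D.fromQuot := by
  intro a
  obtain ⟨p, hp⟩ := D.projClassRing_le (R := D.toGreen.range) (fun v => ⟨_, D.toGreen_X v⟩) a.2
  exact ⟨PCR.mk D.n p, Subtype.ext hp⟩

theorem span_fromQuot_fam :
    Submodule.span ℤ (Set.range fun i => D.fromQuot (PCR.fam D.n i)) = ⊤ := by
  have h := congrArg (Submodule.map D.fromQuot.toAddMonoidHom.toIntLinearMap)
    (PCR.span_fam D.odd D.two_lt)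
  rw [Submodule.map_span, ← Set.range_comp, Submodule.map_top,
    LinearMap.range_eq_top.mpr D.fromQuot_surjective] at h
  exact h

theorem linearIndependent_fromQuot_fam :
    LinearIndependent ℤ fun i => D.fromQuot (PCR.fam D.n i) := by
  have hspan := D.span_fromQuot_fam
  have : Module.Finite ℤ D.quasi.projClassRing :=
    ⟨hspan ▸ Submodule.fg_span (Set.finite_range _)⟩
  have hli : LinearIndependent ℤ fun i => (⟨D.simpleProj i, D.simpleProj_mem i⟩ :
      D.quasi.projClassRing) :=
    LinearIndependent.of_comp D.quasi.projClassRing.subtype.toAddMonoidHom.toIntLinearMap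
      D.linearIndependent_simpleProj
  have e := Fintype.equivOfCardEq (D.card_bIdx.trans D.card_simpleProj.symm)
  have hli' := hli.comp e e.injective
  -- Coefficient vectors embed into the ring by the independent family of simple and projective
  -- classes and map onto it by the spanning family. The two families have the same size `n² + n -
  -- 1`, so the surjection is injective.
  refine OrzechProperty.injective_of_surjective_of_injective _ _ hli' ?_
  rw [← LinearMap.range_eq_top, Finsupp.range_linearCombination]
  exact hspan

/-- The basis of the projective class ring. -/
def basis : Module.Basis (PCR.BIdx D.n) ℤ D.quasi.projClassRing :=
  Module.Basis.mk D.linearIndependent_fromQuot_fam D.span_fromQuot_fam.ge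

theorem basis_apply (i : PCR.BIdx D.n) : D.basis i = D.fromQuot (PCR.fam D.n i) :=
  Module.Basis.mk_apply _ _ i

/-- An element of the kernel is a combination of `PCR.fam`, and the images of these elements are
independent. -/
theorem fromQuot_injective : Function.Injective D.fromQuot := by
  rw [injective_iff_map_eq_zero]
  intro a ha
  have hmem : a ∈ Submodule.span ℤ (Set.range (PCR.fam D.n)) := by
    rw [PCR.span_fam D.odd D.two_lt]; trivial
  rw [← Finsupp.range_linearCombination] at hmem
  obtain ⟨c, rfl⟩ := hmem
  have h := Finsupp.apply_linearCombination ℤ D.fromQuot.toAddMonoidHom.toIntLinearMap (PCR.fam D.n) c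
  have hc : c = 0 := D.linearIndependent_fromQuot_fam (by
    rw [map_zero]
    exact h.symm.trans ha)
  rw [hc, map_zero]

theorem coe_basis_pow (i : Fin (2 * D.n - 1)) :
    (D.basis (.inl i) : D.quasi.GreenRing) = D.varCls .y ^ (i : ℕ) := by
  rw [basis_apply, ← toGreen_X, ← map_pow, ← coe_fromQuot_mk, map_pow]; rfl

theorem coe_basis_x (t : PCR.Idx D.n) (j : Fin ((D.n + 1) / 2)) :
    (D.basis (.inr (.inl (t, j))) : D.quasi.GreenRing) = D.varCls .y ^ (j : ℕ) * D.varCls (.x t) := by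
  rw [basis_apply, ← toGreen_X, ← toGreen_X, ← map_pow, ← map_mul, ← coe_fromQuot_mk, map_mul, map_pow]
  rfl

theorem coe_basis_ε (t : PCR.Idx D.n) (l : Fin ((D.n - 1) / 2)) :
    (D.basis (.inr (.inr (t, l))) : D.quasi.GreenRing) = D.varCls .y ^ (l : ℕ) * D.varCls (.ε t) := by
  rw [basis_apply, ← toGreen_X, ← toGreen_X, ← map_pow, ← map_mul, ← coe_fromQuot_mk, map_mul, map_pow]
  rfl

end QData
end

theorem theorem5p5p10 {k : Type u} [Field k] [IsAlgClosed k] [CharZero k] (D : QData k) :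
    (∃ Θ : (PCR.Poly D.n ⧸ PCR.J D.n) ≃+* D.quasi.projClassRing,
      (Θ (Ideal.Quotient.mk (PCR.J D.n) (PCR.y D.n)) : D.quasi.GreenRing) =
        D.quasi.cls D.V₂ ∧
      (∀ t : PCR.Idx D.n,
        (Θ (Ideal.Quotient.mk (PCR.J D.n) (PCR.x t)) : D.quasi.GreenRing) =
          D.quasi.cls (D.VV t 0)) ∧
      (∀ t : PCR.Idx D.n,
        (Θ (Ideal.Quotient.mk (PCR.J D.n) (PCR.ε t)) : D.quasi.GreenRing) =
          D.quasi.cls (D.VV t 1))) ∧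
    (∃ b : Module.Basis
        (Fin (2 * D.n - 1) ⊕ (PCR.Idx D.n × Fin ((D.n + 1) / 2)) ⊕
          (PCR.Idx D.n × Fin ((D.n - 1) / 2))) ℤ D.quasi.projClassRing,
      (∀ i, (b (Sum.inl i) : D.quasi.GreenRing) = D.quasi.cls D.V₂ ^ (i : ℕ)) ∧
      (∀ t j, (b (Sum.inr (Sum.inl (t, j))) : D.quasi.GreenRing) =
        D.quasi.cls D.V₂ ^ (j : ℕ) * D.quasi.cls (D.VV t 0)) ∧
      (∀ t l, (b (Sum.inr (Sum.inr (t, l))) : D.quasi.GreenRing) =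
        D.quasi.cls D.V₂ ^ (l : ℕ) * D.quasi.cls (D.VV t 1))) ∧
    Module.finrank ℤ D.quasi.projClassRing = D.n ^ 2 + D.n - 1 := by
  refine ⟨⟨RingEquiv.ofBijective D.fromQuot ⟨D.fromQuot_injective, D.fromQuot_surjective⟩, ?_, ?_, ?_⟩,
    ⟨D.basis, ?_, ?_, ?_⟩, (Module.finrank_eq_card_basis D.basis).trans D.card_bIdx⟩
  · rw [D.cls_V₂]; exact D.toGreen_X .y
  · intro t; rw [D.cls_VV_zero]; exact D.toGreen_X (.x t)
  · intro t; rw [D.cls_VV_one]; exact D.toGreen_X (.ε t)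
  · intro i; rw [D.cls_V₂]; exact D.coe_basis_pow i
  · intro t j; rw [D.cls_V₂, D.cls_VV_zero]; exact D.coe_basis_x t j
  · intro t l; rw [D.cls_V₂, D.cls_VV_one]; exact D.coe_basis_ε t l
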